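/- **Setting.** Everything is smooth, real and finite-dimensional. Let $M$ be a manifold of dimension $n\ge 1$ and $\pi:Q\to M$ a bundle (a manifold fibred over $M$, with local coordinates $(x^\mu,\varphi^K)$ projecting to coordinates $x^\mu$ of $M$; the index $K$ is suppressed). For a bundle $Y\to M$ let $VY\subset TY$ be the bundle of vectors tangent to the fibres over $M$, $V^*Y$ its dual, and write $V^*Y\otimes\Lambda^kM$ for $V^*Y\otimes_Y\Lambda^kT^*M$, the bundle whose fibre at $y\in Y_x$ is the space of linear maps $V_yY\to\Lambda^kT^*_xM$. Put $$Q^I:=J^1Q,\qquad P:=V^*Q\otimes\Lambda^{n-1}M,\qquad \widetilde P^I:=J^1P,$$ with coordinates $(x^\mu,\varphi,\varphi_{,\mu})$, $(x^\mu,\varphi,p^\mu)$ (that is, $p=p^\mu\,\delta\varphi\otimes(\partial_\mu\lrcorner\, d^nx)$) and $(x^\mu,\varphi,p^\mu,\varphi_{,\mu},p^\mu_{\ ,\nu})$; $J^1P$ is a bundle over $Q^I$ by forgetting $p^\mu,p^\mu_{\ ,\nu}$. On $J^1P$ consider the vertical two-form with values in $\Lambda^nT^*M$ $$\widetilde\omega^I=\big(\delta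 p^\mu_{\ ,\mu}\wedge\delta\varphi+\delta p^\mu\wedge\delta\varphi_{,\mu}\big)\otimes d^nx ,$$ where $\delta$ is the vertical differential. For a bundle $Y\to M$, the space $V^*Y\otimes\Lambda^nM$ carries the canonical vertical $\Lambda^nT^*M$-valued two-form $\omega_Y=\delta\theta_Y$, where $\theta_Y$ is the tautological one-form; in coordinates $\omega_Y=\delta\eta\wedge\delta y$, where $y$ are fibre coordinates of $Y$ and $\eta$ the associated covector coordinates with values in $\Lambda^nT^*M$. For a submanifold $S$ of a bundle over $M$ with such a two-form $\omega$, the *degeneracy distribution* of $\omega|_S$ consists of the vertical vectors $a$ tangent to $S$ such that $\omega(a,b)=0$ for all vertical $b$ tangent to $S$ at the same point; two points of $S$ are in the same *degeneracy leaf* if they can be joined by a finite chain of smooth vertical curves in $S$ (each in one fibre over $M$) which are tangent to this distribution. A map $f:S\to Z$ onto a bundle $Z\to M$ with a vertical two-form $\omega'$ is called a *reduction* of $(S,\omega|_S)$ onto $(Z,\omega')$ if it is a smooth surjective submersion over $M$ (with a smooth local section through each point of $S$), its fibres are exactly the degeneracy leaves of $\omega|_S$, and $\omega'$ is the unique vertical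 $\Lambda^nT^*M$-valued two-form on $Z$ with $f^*\omega'=\omega|_S$ on vertical vectors tangent to $S$. A vertical two-form is *symplectic* if it is smooth, $\delta$-closed, and nondegenerate on each vertical space. Let $\Psi:J^1P\to V^*Q^I\otimes\Lambda^nM$ be the map over $Q^I$ given by $$\langle (v,v_\mu),\Psi(\zeta)\rangle=(v\,p^\mu_{\ ,\mu}+p^\mu v_\mu)\,d^nx .$$ Let $\mathcal C\subset Q^I$ be a regular constraint sub-bundle, i.e. an embedded submanifold which is fibred over $M$ by the restriction of $Q^I\to M$. Let $J^1P|_{\mathcal C}$ and $V^*Q^I|_{\mathcal C}\otimes\Lambda^nM$ be the parts of $J^1P$ and $V^*Q^I\otimes\Lambda^nM$ over $\mathcal C$, let $\widetilde\omega^I_{\mathcal C}=\widetilde\omega^I|_{J^1P|_{\mathcal C}}$, let $$r:V^*Q^I|_{\mathcal C}\otimes\Lambda^nM\to V^*\mathcal C\otimes\Lambda^nM$$ be the restriction of covectors to $V\mathcal C$, and let $\Psi_{\mathcal C}=r\circ\Psi|_{J^1P|_{\mathcal C}}$. **Statement.** 1. $\Psi$ is canonical: if $p$ is a smooth local section of $P\to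 M$ near $x_0$ over the section $s$ of $Q$, and $v$ is the vertical field along $s$ given by $v(x)=\partial_t\sigma_t(x)|_{t=0}$ for a smooth family $\sigma_t$ of local sections of $Q$ with $\sigma_0=s$, then for $\zeta=j^1_{x_0}p$ and $w=\partial_t\, j^1_{x_0}\sigma_t|_{t=0}\in VQ^I$ one has $\langle w,\Psi(\zeta)\rangle=(d\langle v,p\rangle)(x_0)$. 2. $\Psi$ is a reduction of $(J^1P,\widetilde\omega^I)$ onto $(V^*Q^I\otimes\Lambda^nM,\ \omega_{Q^I})$. So the infinitesimal phase bundle $P^I=J^1P/(\text{degeneracy of }\widetilde\omega^I)$, with its induced form $\omega^I$, is $V^*Q^I\otimes\Lambda^nM$ with $\omega_{Q^I}$. 3. $\Psi_{\mathcal C}$ is a reduction of $(J^1P|_{\mathcal C},\ \widetilde\omega^I_{\mathcal C})$ onto $(V^*\mathcal C\otimes\Lambda^nM,\ \omega_{\mathcal C})$; in particular, the fibres of $\Psi_{\mathcal C}$ are precisely the degeneracy leaves of $\widetilde\omega^I_{\mathcal C}$. 4. $r$ is a reduction of $P^I_{\mathcal C}=V^*Q^I|_{\mathcal C}\otimes\Lambda^nM$,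 with the restriction $\omega^I_{\mathcal C}$ of $\omega_{Q^I}$, onto $(V^*\mathcal C\otimes\Lambda^nM,\ \omega_{\mathcal C})$. 5. The induced form $\omega_{\mathcal C}$ is symplectic. 6. $\Psi_{\mathcal C}$ and $r$ are maps over $\mathcal C$ which, on the fibre over each $c\in\mathcal C$, are linear (for the vector bundle structure of $J^1P\to Q^I$ with fibre coordinates $p^\mu,p^\mu_{\ ,\nu}$, respectively for that of $V^*Q^I\otimes\Lambda^nM\to Q^I$) and surjective onto $V_c^*\mathcal C\otimes\Lambda^nM$. 7. Consequently $\Psi_{\mathcal C}$ and $r$ induce bijections (canonical identifications, by 3, 4 and 6 linear over $\mathcal C$ and compatible with the forms) $$J^1P|_{\mathcal C}\big/(\text{degeneracy of }\widetilde\omega^I_{\mathcal C})\;\cong\;V^*\mathcal C\otimes_{\mathcal C}\Lambda^nM\;\cong\;P^I_{\mathrm{reduced}}:=P^I_{\mathcal C}\big/(\text{degeneracy of }\omega^I_{\mathcal C}).$$ -/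

import Mathlib

open scoped ContDiff Manifold Topology
open Set

noncomputable section

/-! ### Fibred manifolds -/

section Fibred

variable (E G : Type*) [NormedAddCommGroup E] [NormedSpace ℝ E]
  [NormedAddCommGroup G] [NormedSpace ℝ G]

/-- `π : Y → M` is a bundle described in bundle coordinates: around each point `y` the preferred
chart of `Y` has the form `(x, φ)`, where `x` is the preferred chart of `M` at `π y` (the base
coordinates `x^μ`) and `φ` takes values in `G` (the fibre coordinates).
In Mathlib, `T_y Y` is `E × G` and `T_{π y} M` is `E`, both by means of the preferred
charts, so that `dπ` is the first projection and the vertical space `V_y Y = ker dπ` is `G`. -/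
class IsFibred {M Y : Type*} [TopologicalSpace M] [ChartedSpace E M]
    [TopologicalSpace Y] [ChartedSpace (E × G) Y] (π : Y → M) : Prop where
  mem_source : ∀ y y' : Y, y' ∈ (chartAt (E × G) y).source → π y' ∈ (chartAt E (π y)).source
  fst_chart : ∀ y y' : Y, y' ∈ (chartAt (E × G) y).source →
    (chartAt (E × G) y y').1 = chartAt E (π y) (π y')

variable {E G} {Y : Type*} [TopologicalSpace Y] [ChartedSpace (E × G) Y]

/-- The derivative at `z` of the change from the preferred chart at `i` to that at `j`. -/
def tcc (E G : Type*) [NormedAddCommGroup E] [NormedSpace ℝ E] [NormedAddCommGroup G]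
    [NormedSpace ℝ G] {Y : Type*} [TopologicalSpace Y] [ChartedSpace (E × G) Y]
    [IsManifold 𝓘(ℝ, E × G) ∞ Y] (i j z : Y) : (E × G) →L[ℝ] (E × G) :=
  tangentCoordChange 𝓘(ℝ, E × G) i j z

/-- The base block of a linear map of `E × G`. -/
def baseBlock (L : (E × G) →L[ℝ] (E × G)) : E →L[ℝ] E :=
  ContinuousLinearMap.fst ℝ E G ∘L L ∘L ContinuousLinearMap.inl ℝ E G

/-- The vertical block of a linear map of `E × G`. -/
def fibreBlock (L : (E × G) →L[ℝ] (E × G)) : G →L[ℝ] G :=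
  ContinuousLinearMap.snd ℝ E G ∘L L ∘L ContinuousLinearMap.inr ℝ E G

theorem tcc_self [IsManifold 𝓘(ℝ, E × G) ∞ Y] {i z : Y} (h : z ∈ (chartAt (E × G) i).source)
    (v : E × G) : tcc E G i i z v = v :=
  tangentCoordChange_self (by simpa using h)

theorem tcc_comp [IsManifold 𝓘(ℝ, E × G) ∞ Y] {i j l z : Y}
    (hi : z ∈ (chartAt (E × G) i).source) (hj : z ∈ (chartAt (E × G) j).source)
    (hl : z ∈ (chartAt (E × G) l).source) (v : E × G) :
    tcc E G j l z (tcc E G i j z v) = tcc E G i l z v :=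
  tangentCoordChange_comp (by simpa using ⟨⟨hi, hj⟩, hl⟩)

theorem tcc_vert [IsManifold 𝓘(ℝ, E × G) ∞ Y] {M : Type*} [TopologicalSpace M]
    [ChartedSpace E M] (π : Y → M) [IsFibred E G π] {i j z : Y}
    (hi : z ∈ (chartAt (E × G) i).source) (hj : z ∈ (chartAt (E × G) j).source) (g : G) :
    (tcc E G i j z (0, g)).1 = 0 := by
  have h0 := hasFDerivWithinAt_tangentCoordChange (I := 𝓘(ℝ, E × G)) (x := i) (y := j) (z := z)
    (by simpa using ⟨hi, hj⟩)
  simp only [mfld_simps, hasFDerivWithinAt_univ] at h0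
  set a := chartAt (E × G) i z with ha
  have hline : HasDerivAt (fun t : ℝ => a + t • ((0 : E), g)) ((0 : E), g) 0 := by
    simpa using ((hasDerivAt_id (0 : ℝ)).smul_const ((0 : E), g)).const_add a
  have h1 : HasFDerivAt (chartAt (E × G) j ∘ (chartAt (E × G) i).symm)
      (tcc E G i j z) (a + (0 : ℝ) • ((0 : E), g)) := by simpa [tcc] using h0
  have h2 := h1.comp_hasDerivAt (0 : ℝ) hline
  have h3 := (ContinuousLinearMap.fst ℝ E G).hasFDerivAt.comp_hasDerivAt (0 : ℝ) h2
  have hev : ∀ᶠ w in 𝓝 a, w ∈ (chartAt (E × G) i).target ∧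
      (chartAt (E × G) i).symm w ∈ (chartAt (E × G) j).source := by
    have : ((chartAt (E × G) i).symm.trans (chartAt (E × G) j)).source ∈ 𝓝 a := by
      apply ((chartAt (E × G) i).symm.trans (chartAt (E × G) j)).open_source.mem_nhds
      simp [ha, hi, hj]
    filter_upwards [this] with w hw
    simpa using hw
  have hkey : ∀ w, w ∈ (chartAt (E × G) i).target ∧
      (chartAt (E × G) i).symm w ∈ (chartAt (E × G) j).source →
      ((chartAt (E × G) j) ((chartAt (E × G) i).symm w)).1 =
        chartAt E (π j) ((chartAt E (π i)).symm w.1) := by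
    rintro w ⟨hw, hw'⟩
    have hs := (chartAt (E × G) i).map_target hw
    rw [IsFibred.fst_chart (E := E) (G := G) (π := π) j _ hw']
    congr 1
    have := IsFibred.fst_chart (E := E) (G := G) (π := π) i _ hs
    rw [(chartAt (E × G) i).right_inv hw] at this
    rw [this, (chartAt E (π i)).left_inv
      (IsFibred.mem_source (E := E) (G := G) (π := π) i _ hs)]
  have hcont : Filter.Tendsto (fun t : ℝ => a + t • ((0 : E), g)) (𝓝 0) (𝓝 a) := by
    simpa using hline.continuousAt.tendsto
  have h4 : HasDerivAt (fun _ : ℝ => chartAt E (π j) ((chartAt E (π i)).symm a.1)) 0 0 :=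
    hasDerivAt_const _ _
  have h5 := h3.congr_of_eventuallyEq (f₁ := fun _ : ℝ =>
      chartAt E (π j) ((chartAt E (π i)).symm a.1)) (by
    filter_upwards [hcont.eventually hev] with t ht
    have := hkey _ ht
    simpa using this.symm)
  simpa using h5.unique h4

theorem tcc_fst [IsManifold 𝓘(ℝ, E × G) ∞ Y] {M : Type*} [TopologicalSpace M]
    [ChartedSpace E M] (π : Y → M) [IsFibred E G π] {i j z : Y}
    (hi : z ∈ (chartAt (E × G) i).source) (hj : z ∈ (chartAt (E × G) j).source) (v : E × G) :
    (tcc E G i j z v).1 = (tcc E G i j z (v.1, 0)).1 := by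
  have : v = (v.1, 0) + (0, v.2) := by simp
  conv_lhs => rw [this, map_add, Prod.fst_add, tcc_vert π hi hj, add_zero]

theorem contDiffOn_tcc [IsManifold 𝓘(ℝ, E × G) ∞ Y] (i j : Y) :
    ContDiffOn ℝ ∞ (fun w : E × G => tcc E G i j ((chartAt (E × G) i).symm w))
      ((chartAt (E × G) i).symm.trans (chartAt (E × G) j)).source := by
  have : IsManifold 𝓘(ℝ, E × G) (∞ + 1) Y := by
    have h : (∞ + 1 : WithTop ℕ∞) = ∞ := rfl
    rw [h]; infer_instance
  have h := contDiffOn_fderiv_coord_change (I := 𝓘(ℝ, E × G)) (n := ∞) (M := Y)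
    (achart (E × G) i) (achart (E × G) j)
  simp only [mfld_simps] at h
  refine ContDiffOn.congr (by simpa [mfld_simps] using h) ?_
  intro w hw
  simp only [mfld_simps] at hw
  simp [tcc, (chartAt (E × G) i).right_inv hw.1]

theorem contDiffOn_tcc_symm [IsManifold 𝓘(ℝ, E × G) ∞ Y] (i j : Y) :
    ContDiffOn ℝ ∞ (fun w : E × G => tcc E G j i ((chartAt (E × G) i).symm w))
      ((chartAt (E × G) i).symm.trans (chartAt (E × G) j)).source := by
  have hq : ContDiffOn ℝ ∞ (fun w : E × G => chartAt (E × G) j ((chartAt (E × G) i).symm w))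
      ((chartAt (E × G) i).symm.trans (chartAt (E × G) j)).source := by
    have h := contDiffOn_ext_coord_change (I := 𝓘(ℝ, E × G)) (n := ∞) j i
    simp only [mfld_simps] at h
    simpa [mfld_simps, Function.comp_def] using h
  refine ((contDiffOn_tcc j i).comp hq ?_).congr ?_
  · intro w hw
    have hw' : w ∈ (chartAt (E × G) i).target ∧
      (chartAt (E × G) i).symm w ∈ (chartAt (E × G) j).source := by simpa [mfld_simps] using hw
    simp [hw'.2, hw'.1, (chartAt (E × G) i).map_target]
  · intro w hw
    have hw' : w ∈ (chartAt (E × G) i).target ∧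
      (chartAt (E × G) i).symm w ∈ (chartAt (E × G) j).source := by simpa [mfld_simps] using hw
    simp [hw'.2]

end Fibred

/-! ### Fibre bundles over a fibred manifold, and the manifold structure of their total spaces -/

section Core

variable (E G Y K : Type*) [NormedAddCommGroup E] [NormedSpace ℝ E]
  [NormedAddCommGroup G] [NormedSpace ℝ G] [NormedAddCommGroup K] [NormedSpace ℝ K]
  [TopologicalSpace Y] [ChartedSpace (E × G) Y]

/-- A smooth fibre bundle over `Y` with typical fibre `K`, given by its transition maps
`coordChange i j z : K → K` between the preferred charts at `i` and at `j`, at the point `z`. -/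
structure FibreCore where
  coordChange : Y → Y → Y → K → K
  coordChange_self : ∀ i z, z ∈ (chartAt (E × G) i).source → ∀ k, coordChange i i z k = k
  coordChange_comp : ∀ i j l z, z ∈ (chartAt (E × G) i).source →
    z ∈ (chartAt (E × G) j).source → z ∈ (chartAt (E × G) l).source →
    ∀ k, coordChange j l z (coordChange i j z k) = coordChange i l z k
  contDiffOn_coordChange : ∀ i j, ContDiffOn ℝ ∞
    (fun w : E × (G × K) =>
      coordChange i j ((chartAt (E × G) i).symm (w.1, w.2.1)) w.2.2)
    {w | (w.1, w.2.1) ∈ ((chartAt (E × G) i).symm.trans (chartAt (E × G) j)).source}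

variable {E G Y K}

namespace FibreCore

variable (c : FibreCore E G Y K)

/-- The total space of the bundle. As for the tangent bundle in Mathlib, the fibre over `y` is
the typical fibre, by means of the preferred chart at `y`. -/
@[ext]
structure Total (c : FibreCore E G Y K) where
  base : Y
  fib : K

/-- The chart `(x, φ, k)` of the total space induced by the preferred chart of `Y` at `i`. -/
def chart (i : Y) : PartialEquiv c.Total (E × (G × K)) where
  toFun z := ((chartAt (E × G) i z.base).1, (chartAt (E × G) i z.base).2,
    c.coordChange z.base i z.base z.fib)
  invFun w := ⟨(chartAt (E × G) i).symm (w.1, w.2.1),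
    c.coordChange i ((chartAt (E × G) i).symm (w.1, w.2.1))
      ((chartAt (E × G) i).symm (w.1, w.2.1)) w.2.2⟩
  source := {z | z.base ∈ (chartAt (E × G) i).source}
  target := {w | (w.1, w.2.1) ∈ (chartAt (E × G) i).target}
  map_source' z hz := (chartAt (E × G) i).map_source hz
  map_target' w hw := (chartAt (E × G) i).map_target hw
  left_inv' z hz := by
    have hz' : z.base ∈ (chartAt (E × G) i).source := hz
    have hb := (chartAt (E × G) i).left_inv hz'
    ext1
    · exact hb
    · simp only [Prod.mk.eta, hb]
      rw [c.coordChange_comp _ _ _ _ (mem_chart_source _ _) hz' (mem_chart_source _ _),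
        c.coordChange_self _ _ (mem_chart_source _ _)]
  right_inv' w hw := by
    have hw' : (w.1, w.2.1) ∈ (chartAt (E × G) i).target := hw
    have hs := (chartAt (E × G) i).map_target hw'
    have hb := (chartAt (E × G) i).right_inv hw'
    ext1
    · simp [hb]
    · ext1
      · simp [hb]
      · simp only
        rw [c.coordChange_comp _ _ _ _ hs (mem_chart_source _ _) hs, c.coordChange_self _ _ hs]

theorem chart_trans_source (i j : Y) : ((c.chart i).symm.trans (c.chart j)).source =
    {w | (w.1, w.2.1) ∈ ((chartAt (E × G) i).symm.trans (chartAt (E × G) j)).source} := by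
  ext w
  simp [PartialEquiv.trans_source, chart]

theorem isOpen_chart_trans_source (i j : Y) :
    IsOpen ((c.chart i).symm.trans (c.chart j)).source := by
  rw [c.chart_trans_source]
  exact ((chartAt (E × G) i).symm.trans (chartAt (E × G) j)).open_source.preimage
    (by fun_prop : Continuous fun w : E × (G × K) => (w.1, w.2.1))

theorem contDiffOn_chart_trans [IsManifold 𝓘(ℝ, E × G) ∞ Y] (i j : Y) :
    ContDiffOn ℝ ∞ ((c.chart i).symm.trans (c.chart j))
      ((c.chart i).symm.trans (c.chart j)).source := by
  rw [c.chart_trans_source]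
  have h1 : ContDiffOn ℝ ∞ (fun w : E × (G × K) =>
      chartAt (E × G) j ((chartAt (E × G) i).symm (w.1, w.2.1)))
      {w | (w.1, w.2.1) ∈ ((chartAt (E × G) i).symm.trans (chartAt (E × G) j)).source} := by
    have h := contDiffOn_ext_coord_change (I := 𝓘(ℝ, E × G)) (n := ∞) j i
    simp only [mfld_simps] at h
    exact ContDiffOn.comp (t := ((chartAt (E × G) i).symm.trans (chartAt (E × G) j)).source)
      (by simpa [mfld_simps] using h)
      (by fun_prop : ContDiff ℝ ∞ fun w : E × (G × K) => (w.1, w.2.1)).contDiffOn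
      (fun w hw => hw)
  refine ContDiffOn.congr (h1.fst.prodMk (h1.snd.prodMk (c.contDiffOn_coordChange i j))) ?_
  intro w hw
  have hw1 : (w.1, w.2.1) ∈ (chartAt (E × G) i).target ∧
      (chartAt (E × G) i).symm (w.1, w.2.1) ∈ (chartAt (E × G) j).source := by
    simpa [mfld_simps] using hw
  have hs := (chartAt (E × G) i).map_target hw1.1
  simp [chart, c.coordChange_comp _ _ _ _ hs (mem_chart_source _ _) hw1.2]

/-- The atlas of the total space. -/
def core [IsManifold 𝓘(ℝ, E × G) ∞ Y] : ChartedSpaceCore (E × (G × K)) c.Total where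
  atlas := range c.chart
  chartAt z := c.chart z.base
  mem_chart_source z := mem_chart_source (E × G) z.base
  chart_mem_atlas z := mem_range_self z.base
  open_source := by
    rintro _ _ ⟨i, rfl⟩ ⟨j, rfl⟩
    exact c.isOpen_chart_trans_source i j
  continuousOn_toFun := by
    rintro _ _ ⟨i, rfl⟩ ⟨j, rfl⟩
    exact (c.contDiffOn_chart_trans i j).continuousOn

variable [IsManifold 𝓘(ℝ, E × G) ∞ Y]

instance : TopologicalSpace c.Total := c.core.toTopologicalSpace

instance : ChartedSpace (E × (G × K)) c.Total := c.core.toChartedSpace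

theorem chartAt_toPartialEquiv (z : c.Total) :
    (chartAt (E × (G × K)) z).toPartialEquiv = c.chart z.base := rfl

instance : IsManifold 𝓘(ℝ, E × (G × K)) ∞ c.Total := by
  apply isManifold_of_contDiffOn
  intro e e' he he'
  obtain ⟨_, ⟨i, rfl⟩, h⟩ := mem_iUnion₂.1 he
  obtain rfl := mem_singleton_iff.1 h
  obtain ⟨_, ⟨j, rfl⟩, h⟩ := mem_iUnion₂.1 he'
  obtain rfl := mem_singleton_iff.1 h
  have h := c.contDiffOn_chart_trans i j
  simp only [mfld_simps]
  exact h.mono fun w hw => hw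

/-- The projection of the total space to `M`. -/
def proj {M : Type*} (π : Y → M) : c.Total → M := fun z => π z.base

instance {M : Type*} [TopologicalSpace M] [ChartedSpace E M] (π : Y → M) [IsFibred E G π] :
    IsFibred E (G × K) (c.proj π) where
  mem_source z z' h := IsFibred.mem_source (E := E) (G := G) (π := π) z.base z'.base h
  fst_chart z z' h := IsFibred.fst_chart (E := E) (G := G) (π := π) z.base z'.base h

end FibreCore

end Core

/-! ### First jets, form-valued vertical covectors -/

section Bundles

variable (E G : Type*) [NormedAddCommGroup E] [NormedSpace ℝ E]
  [NormedAddCommGroup G] [NormedSpace ℝ G]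
  {M Y : Type*} [TopologicalSpace M] [ChartedSpace E M] [TopologicalSpace Y]
  [ChartedSpace (E × G) Y] [IsManifold 𝓘(ℝ, E × G) ∞ Y]

/-- `⋀ᵏ T*_x M`. -/
abbrev Forms (k : ℕ) : Type _ := E [⋀^Fin k]→L[ℝ] ℝ

variable {E} in
/-- Pullback of `k`-forms by a linear map. -/
abbrev pullForm (k : ℕ) (L : E →L[ℝ] E) : Forms E k →L[ℝ] Forms E k :=
  ContinuousAlternatingMap.compContinuousLinearMapCLM L

variable {E} in
theorem contDiff_pullForm (k : ℕ) : ContDiff ℝ ∞ (pullForm (E := E) k) := by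
  let incl : Forms E k →L[ℝ] ContinuousMultilinearMap ℝ (fun _ : Fin k => E) ℝ :=
    ContinuousAlternatingMap.toContinuousMultilinearMapCLM ℝ
  have hcont : Continuous (ContinuousMultilinearMap.alternatization (R := ℝ) (M := E) (N := ℝ)
      (ι := Fin k)) := by
    rw [ContinuousAlternatingMap.isEmbedding_toContinuousMultilinearMap.continuous_iff]
    have : (ContinuousAlternatingMap.toContinuousMultilinearMap ∘
        (ContinuousMultilinearMap.alternatization (R := ℝ) (M := E) (N := ℝ) (ι := Fin k))) =
        fun f => ∑ σ : Equiv.Perm (Fin k), Equiv.Perm.sign σ •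
          ContinuousMultilinearMap.domDomCongrₗᵢ ℝ E ℝ σ f := by
      ext f v
      simp [ContinuousMultilinearMap.alternatization_apply_apply, Function.comp_def]
      rfl
    rw [this]
    fun_prop
  let alt : ContinuousMultilinearMap ℝ (fun _ : Fin k => E) ℝ →L[ℝ] Forms E k :=
    { toFun := fun f => ((k.factorial : ℝ)⁻¹) • ContinuousMultilinearMap.alternatization f
      map_add' := by intro f g; simp
      map_smul' := by
        intro a f; ext v
        simp [ContinuousMultilinearMap.alternatization_apply_apply, Finset.mul_sum]
        refine Finset.sum_congr rfl fun σ _ => ?_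
        rcases Int.units_eq_one_or (Equiv.Perm.sign σ) with h | h <;> simp [h] <;> ring
      cont := by exact (continuous_const_smul ((k.factorial : ℝ)⁻¹)).comp hcont }
  have hinv : ∀ f : Forms E k, alt (incl f) = f := by
    intro f; ext v
    have : ∀ σ : Equiv.Perm (Fin k), Equiv.Perm.sign σ • f (v ∘ σ) = f v := by
      intro σ
      rw [show f (v ∘ σ) = Equiv.Perm.sign σ • f v from f.toAlternatingMap.map_perm v σ,
        smul_smul, Int.units_mul_self, one_smul]
    simp [alt, incl, ContinuousMultilinearMap.alternatization_apply_apply, this,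
      Fintype.card_perm]
    rw [← mul_assoc, inv_mul_cancel₀ (by exact_mod_cast k.factorial_ne_zero), one_mul]
  have heq : pullForm (E := E) k = fun L => alt ∘L
      (ContinuousMultilinearMap.compContinuousLinearMapContinuousMultilinear ℝ
        (fun _ : Fin k => E) (fun _ : Fin k => E) ℝ (fun _ => L)) ∘L incl := by
    funext L
    ext f v
    have h1 := hinv (pullForm k L f)
    rw [← h1]
    rfl
  rw [heq]
  refine contDiff_const.clm_comp (ContDiff.clm_comp ?_ contDiff_const)
  exact (ContinuousMultilinearMap.contDiff _).comp (contDiff_pi.2 fun _ => contDiff_id)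

/-- The bundle `J¹Y → Y`. A first jet at `y` of a section of `π` is a linear map
`ξ ↦ (ξ, A ξ)`, `T_{π y} M → T_y Y`, which is inverted by `dπ`; it is given by `A : E → G`,
that is, by the jet coordinates `φ_{,μ}`. Under a change of charts with differential `L`, the graph
of `A` is mapped to its image under `L`. -/
def jetCore (π : Y → M) [IsFibred E G π] : FibreCore E G Y (E →L[ℝ] G) where
  coordChange i j z A :=
    (ContinuousLinearMap.snd ℝ E G ∘L tcc E G i j z ∘L (ContinuousLinearMap.id ℝ E).prod A) ∘L
      baseBlock (tcc E G j i z)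
  coordChange_self i z h A := by
    ext ξ
    simp [baseBlock, tcc_self h]
  coordChange_comp i j l z hi hj hl A := by
    ext ξ
    simp only [baseBlock, ContinuousLinearMap.comp_apply, ContinuousLinearMap.inl_apply,
      ContinuousLinearMap.prod_apply, ContinuousLinearMap.id_apply, ContinuousLinearMap.coe_fst',
      ContinuousLinearMap.coe_snd']
    set η := (tcc E G l j z (ξ, 0)).1 with hη
    have e1 : (tcc E G l i z (ξ, 0)).1 = (tcc E G j i z (η, 0)).1 := by
      rw [← tcc_comp hl hj hi, tcc_fst π hj hi]
    rw [e1]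
    set ζ := (tcc E G j i z (η, 0)).1 with hζ
    have e2 : (tcc E G i j z (ζ, A ζ)).1 = η := by
      rw [tcc_fst π hi hj]
      exact (tcc_fst π hi hj (tcc E G j i z (η, 0))).symm.trans
        (by rw [tcc_comp hj hi hj, tcc_self hj])
    have e3 : (η, (tcc E G i j z (ζ, A ζ)).2) = tcc E G i j z (ζ, A ζ) := by
      ext <;> simp [e2]
    rw [e3, tcc_comp hi hj hl]
  contDiffOn_coordChange i j := by
    set S := {w : E × (G × (E →L[ℝ] G)) | (w.1, w.2.1) ∈
      ((chartAt (E × G) i).symm.trans (chartAt (E × G) j)).source} with hS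
    have hp : ContDiffOn ℝ ∞ (fun w : E × (G × (E →L[ℝ] G)) => (w.1, w.2.1)) S :=
      (by fun_prop : ContDiff ℝ ∞ fun w : E × (G × (E →L[ℝ] G)) => (w.1, w.2.1)).contDiffOn
    have h1 : ContDiffOn ℝ ∞ (fun w : E × (G × (E →L[ℝ] G)) =>
        tcc E G i j ((chartAt (E × G) i).symm (w.1, w.2.1))) S :=
      (contDiffOn_tcc i j).comp hp fun w hw => hw
    have h2 : ContDiffOn ℝ ∞ (fun w : E × (G × (E →L[ℝ] G)) =>
        tcc E G j i ((chartAt (E × G) i).symm (w.1, w.2.1))) S :=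
      (contDiffOn_tcc_symm i j).comp hp fun w hw => hw
    unfold baseBlock
    have h3 : ContDiffOn ℝ ∞ (fun w : E × (G × (E →L[ℝ] G)) =>
        (ContinuousLinearMap.id ℝ E).prod w.2.2) S := by
      have : (fun w : E × (G × (E →L[ℝ] G)) => (ContinuousLinearMap.id ℝ E).prod w.2.2) =
          fun w => ContinuousLinearMap.inl ℝ E G + ContinuousLinearMap.inr ℝ E G ∘L w.2.2 := by
        funext w; ext ξ <;> simp
      rw [this]
      exact (contDiff_const.add (contDiff_const.clm_comp (by fun_prop))).contDiffOn
    exact (contDiffOn_const.clm_comp (h1.clm_comp h3)).clm_comp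
      (contDiffOn_const.clm_comp (h2.clm_comp contDiffOn_const))

/-- The first jet bundle `J¹Y` of `π : Y → M`; `j.base` is the point of `Y` and `j.fib` the tuple
of jet coordinates. -/
abbrev Jet (π : Y → M) [IsFibred E G π] : Type _ := (jetCore E G π).Total

/-- The projection `J¹Y → M`. -/
abbrev jetProj (π : Y → M) [IsFibred E G π] : Jet E G π → M := (jetCore E G π).proj π

/-- The bundle `V*Y ⊗ ⋀ᵏ T*M → Y`, whose fibre at `y` is the space of linear maps
`V_y Y → ⋀ᵏ T*_{π y} M`. -/
def dualCore (k : ℕ) (π : Y → M) [IsFibred E G π] : FibreCore E G Y (G →L[ℝ] Forms E k) where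
  coordChange i j z p :=
    pullForm k (baseBlock (tcc E G j i z)) ∘L p ∘L fibreBlock (tcc E G j i z)
  coordChange_self i z h p := by
    ext v ξ
    have h1 : baseBlock (tcc E G i i z) = ContinuousLinearMap.id ℝ E := by
      ext ξ; simp [baseBlock, tcc_self h]
    have h2 : fibreBlock (tcc E G i i z) = ContinuousLinearMap.id ℝ G := by
      ext ξ; simp [fibreBlock, tcc_self h]
    rw [h1, h2]
    simp
  coordChange_comp i j l z hi hj hl p := by
    have h1 : baseBlock (tcc E G j i z) ∘L baseBlock (tcc E G l j z) =
        baseBlock (tcc E G l i z) := by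
      ext ξ
      simp only [baseBlock, ContinuousLinearMap.comp_apply, ContinuousLinearMap.inl_apply,
        ContinuousLinearMap.coe_fst']
      rw [← tcc_fst π hj hi, tcc_comp hl hj hi]
    have h2 : fibreBlock (tcc E G j i z) ∘L fibreBlock (tcc E G l j z) =
        fibreBlock (tcc E G l i z) := by
      ext v
      simp only [fibreBlock, ContinuousLinearMap.comp_apply, ContinuousLinearMap.inr_apply,
        ContinuousLinearMap.coe_snd']
      have e : (0, (tcc E G l j z (0, v)).2) = tcc E G l j z (0, v) := by
        ext <;> simp [tcc_vert π hl hj]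
      rw [e, tcc_comp hl hj hi]
    rw [← h1, ← h2]
    ext v ξ
    simp [Function.comp_def]
  contDiffOn_coordChange i j := by
    set S := {w : E × (G × (G →L[ℝ] Forms E k)) | (w.1, w.2.1) ∈
      ((chartAt (E × G) i).symm.trans (chartAt (E × G) j)).source} with hS
    have hp : ContDiffOn ℝ ∞ (fun w : E × (G × (G →L[ℝ] Forms E k)) => (w.1, w.2.1)) S :=
      (by fun_prop : ContDiff ℝ ∞
        fun w : E × (G × (G →L[ℝ] Forms E k)) => (w.1, w.2.1)).contDiffOn
    have h2 : ContDiffOn ℝ ∞ (fun w : E × (G × (G →L[ℝ] Forms E k)) =>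
        tcc E G j i ((chartAt (E × G) i).symm (w.1, w.2.1))) S :=
      (contDiffOn_tcc_symm i j).comp hp fun w hw => hw
    unfold baseBlock fibreBlock
    refine ContDiffOn.clm_comp ?_ (ContDiffOn.clm_comp (by fun_prop) ?_)
    · exact (contDiff_pullForm k).comp_contDiffOn
        (contDiffOn_const.clm_comp (h2.clm_comp contDiffOn_const))
    · exact contDiffOn_const.clm_comp (h2.clm_comp contDiffOn_const)

/-- The total space of `V*Y ⊗ ⋀ᵏ T*M`. -/
abbrev Dual (k : ℕ) (π : Y → M) [IsFibred E G π] : Type _ := (dualCore E G k π).Total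

/-- The projection `V*Y ⊗ ⋀ᵏ T*M → M`. -/
abbrev dualProj (k : ℕ) (π : Y → M) [IsFibred E G π] : Dual E G k π → M :=
  (dualCore E G k π).proj π

end Bundles

/-! ### Vertical two-forms, degeneracy leaves and reduction -/

section Forms

variable (E G : Type*) [NormedAddCommGroup E] [NormedSpace ℝ E]
  [NormedAddCommGroup G] [NormedSpace ℝ G]
  {M Y : Type*} [TopologicalSpace M] [ChartedSpace E M] [TopologicalSpace Y]
  [ChartedSpace (E × G) Y]

/-- The vertical component of the velocity of a curve. -/
def vel (γ : ℝ → Y) (t : ℝ) : G :=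
  ((mfderiv 𝓘(ℝ, ℝ) 𝓘(ℝ, E × G) γ t : ℝ →L[ℝ] E × G) 1).2

/-- A smooth curve of `Y` which lies in the subset `S` and in one fibre of `π`. -/
structure IsVertCurve (π : Y → M) {S : Set Y} (γ : ℝ → S) : Prop where
  smooth : ContMDiff 𝓘(ℝ, ℝ) 𝓘(ℝ, E × G) ∞ (fun t => (γ t : Y))
  vertical : ∀ t, π (γ t) = π (γ 0)

/-- The vertical tangent vectors of `S` at `s`. -/
def vertTangent (π : Y → M) (S : Set Y) (s : S) : Set G :=
  {a | ∃ γ : ℝ → S, IsVertCurve E G π γ ∧ γ 0 = s ∧ vel E G (fun t => (γ t : Y)) 0 = a}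

/-- A vertical two-form on `Y` with values in the density bundle `⋀ⁿ T*M` is a function
`Y → G [⋀^Fin 2]→L[ℝ] Forms E n`. This is the degeneracy distribution of its restriction to the
submanifold `S`. -/
def degeneracy (π : Y → M) (S : Set Y) {n : ℕ} (Ω : Y → G [⋀^Fin 2]→L[ℝ] Forms E n) (s : S) :
    Set G :=
  {a | a ∈ vertTangent E G π S s ∧ ∀ b ∈ vertTangent E G π S s, Ω s ![a, b] = 0}

/-- `s` and `s'` are joined by a smooth curve tangent to the degeneracy distribution. -/
def LeafStep (π : Y → M) (S : Set Y) {n : ℕ} (Ω : Y → G [⋀^Fin 2]→L[ℝ] Forms E n)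
    (s s' : S) : Prop :=
  ∃ γ : ℝ → S, IsVertCurve E G π γ ∧
    (∀ t, vel E G (fun t => (γ t : Y)) t ∈ degeneracy E G π S Ω (γ t)) ∧ γ 0 = s ∧ γ 1 = s'

/-- The equivalence relation whose classes are the degeneracy leaves of the restriction of `Ω`
to `S`. -/
def leafSetoid (π : Y → M) (S : Set Y) {n : ℕ} (Ω : Y → G [⋀^Fin 2]→L[ℝ] Forms E n) :
    Setoid S :=
  Relation.EqvGen.setoid (LeafStep E G π S Ω)

/-- The space of degeneracy leaves of the restriction of `Ω` to `S`. -/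
def Reduced (π : Y → M) (S : Set Y) {n : ℕ} (Ω : Y → G [⋀^Fin 2]→L[ℝ] Forms E n) : Type _ :=
  Quotient (leafSetoid E G π S Ω)

variable {H Z : Type*} [NormedAddCommGroup H] [NormedSpace ℝ H] [TopologicalSpace Z]
  [ChartedSpace (E × H) Z]

variable (H) in
/-- `f : S → Z` realizes `Z`, with the two-form `Ω'`, as the reduction of `S` by the degeneracy of
`Ω`: it is a surjective submersion over `M` whose fibres are the degeneracy leaves, and `Ω'` is the
unique form on `Z` whose pullback is the restriction of `Ω` to `S`. -/
structure IsReduction (π : Y → M) (S : Set Y) {n : ℕ} (Ω : Y → G [⋀^Fin 2]→L[ℝ] Forms E n)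
    (π' : Z → M) (Ω' : Z → H [⋀^Fin 2]→L[ℝ] Forms E n) (f : S → Z) : Prop where
  over_base : ∀ s : S, π' (f s) = π s
  /-- `f` is smooth: locally it is the restriction of a smooth map. -/
  smooth : ∀ s : S, ∃ (O : Set Y) (F : Y → Z), IsOpen O ∧ (s : Y) ∈ O ∧
    ContMDiffOn 𝓘(ℝ, E × G) 𝓘(ℝ, E × H) ∞ F O ∧ ∀ s' : S, (s' : Y) ∈ O → F s' = f s'
  surjective : Function.Surjective f
  /-- `f` is a submersion: it has a smooth local section through each point of `S`. -/
  section_through : ∀ s : S, ∃ (O : Set Z) (σ : Z → Y), IsOpen O ∧ f s ∈ O ∧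
    ContMDiffOn 𝓘(ℝ, E × H) 𝓘(ℝ, E × G) ∞ σ O ∧ σ (f s) = s ∧
    ∀ z ∈ O, ∃ h : σ z ∈ S, f ⟨σ z, h⟩ = z
  fibre_eq_leaf : ∀ s s' : S, f s = f s' ↔ (leafSetoid E G π S Ω) s s'
  form : ∀ Ω'' : Z → H [⋀^Fin 2]→L[ℝ] Forms E n,
    (∀ γ₁ γ₂ : ℝ → S, IsVertCurve E G π γ₁ → IsVertCurve E G π γ₂ → γ₁ 0 = γ₂ 0 →
      Ω'' (f (γ₁ 0)) ![vel E H (f ∘ γ₁) 0, vel E H (f ∘ γ₂) 0] =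
        Ω (γ₁ 0) ![vel E G (fun t => (γ₁ t : Y)) 0, vel E G (fun t => (γ₂ t : Y)) 0]) ↔
    Ω'' = Ω'

variable [IsManifold 𝓘(ℝ, E × G) ∞ Y]

/-- The expression of a vertical two-form in the preferred chart at `i`. -/
def coordRep {n : ℕ} (Ω : Y → G [⋀^Fin 2]→L[ℝ] Forms E n) (i : Y) (w : E × G) :
    G [⋀^Fin 2]→L[ℝ] Forms E n :=
  let y := (chartAt (E × G) i).symm w
  (pullForm n (baseBlock (tcc E G i y y))).compContinuousAlternatingMap
    ((Ω y).compContinuousLinearMap (fibreBlock (tcc E G i y y)))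

/-- A vertical two-form with values in `⋀ⁿ T*M` is symplectic if it is smooth, closed with
respect to the vertical differential `δ` (the exterior derivative along the fibres of `Y → M`), and
nondegenerate on each vertical space. -/
structure IsSymplectic {n : ℕ} (Ω : Y → G [⋀^Fin 2]→L[ℝ] Forms E n) : Prop where
  smooth : ∀ i : Y, ContDiffOn ℝ ∞ (coordRep E G Ω i) (chartAt (E × G) i).target
  closed : ∀ i : Y, extDeriv (fun φ : G => coordRep E G Ω i ((chartAt (E × G) i i).1, φ))
    (chartAt (E × G) i i).2 = 0
  nondegenerate : ∀ (y : Y) (a : G), (∀ b : G, Ω y ![a, b] = 0) → a = 0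

end Forms

section TwoForm

variable {W N : Type*} [NormedAddCommGroup W] [NormedSpace ℝ W] [NormedAddCommGroup N]
  [NormedSpace ℝ N]

/-- The two-form `(a, b) ↦ β a b - β b a`. -/
def twoForm (β : W →L[ℝ] W →L[ℝ] N) : W [⋀^Fin 2]→L[ℝ] N :=
  ContinuousAlternatingMap.alternatizeUncurryFin
    ((ContinuousAlternatingMap.ofSubsingletonLIE (𝕜 := ℝ) (E := W) (F := N)
      (0 : Fin 1)).toContinuousLinearEquiv.toContinuousLinearMap ∘L β)

theorem twoForm_apply (β : W →L[ℝ] W →L[ℝ] N) (a b : W) :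
    twoForm β ![a, b] = β a b - β b a := by
  simp [twoForm, ContinuousAlternatingMap.alternatizeUncurryFin_apply, Fin.sum_univ_two,
    ContinuousAlternatingMap.ofSubsingletonLIE, Fin.removeNth, sub_eq_add_neg]

end TwoForm

section Algebra

variable (E F B N : Type*) [NormedAddCommGroup E] [NormedSpace ℝ E] [NormedAddCommGroup F]
  [NormedSpace ℝ F] [NormedAddCommGroup B] [NormedSpace ℝ B] [NormedAddCommGroup N]
  [NormedSpace ℝ N]

/-- The vertical tangent spaces of the first jet bundle of a bundle with fibre coordinates in
`F`: vectors `(δφ, δφ_{,ν})`. -/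
abbrev JetVert : Type _ := F × (E →L[ℝ] F)

/-- The bilinear map `(η₁, η₂) ↦ η₁.2 η₂.1`. -/
def pairing : (F × (F →L[ℝ] N)) →L[ℝ] (F × (F →L[ℝ] N)) →L[ℝ] N :=
  (ContinuousLinearMap.id ℝ (F →L[ℝ] N)).bilinearComp
    (ContinuousLinearMap.snd ℝ F (F →L[ℝ] N)) (ContinuousLinearMap.fst ℝ F (F →L[ℝ] N))

theorem pairing_apply (a b : F × (F →L[ℝ] N)) : pairing F N a b = a.2 b.1 := rfl

variable {B N} in
/-- For a linear map `alt : (E →L[ℝ] B) →L[ℝ] N`, the bilinear map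
`(a, b) ↦ alt (∂ (δp(a) δφ(b))) = alt (∂δp(a) δφ(b) + δp(a) ∂δφ(b))`. -/
def jetPairing (alt : (E →L[ℝ] B) →L[ℝ] N) :
    JetVert E (F × (F →L[ℝ] B)) →L[ℝ] JetVert E (F × (F →L[ℝ] B)) →L[ℝ] N :=
  ContinuousLinearMap.compL ℝ (JetVert E (F × (F →L[ℝ] B))) (E →L[ℝ] B) N alt ∘L
    (ContinuousLinearMap.bilinearComp
        (ContinuousLinearMap.flipₗᵢ ℝ E F B).toContinuousLinearEquiv.toContinuousLinearMap
        (ContinuousLinearMap.compL ℝ E (F × (F →L[ℝ] B)) (F →L[ℝ] B)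
            (ContinuousLinearMap.snd ℝ F (F →L[ℝ] B)) ∘L ContinuousLinearMap.snd ℝ _ _)
        (ContinuousLinearMap.fst ℝ F (F →L[ℝ] B) ∘L ContinuousLinearMap.fst ℝ _ _) +
      (ContinuousLinearMap.compL ℝ E F B).bilinearComp
        (ContinuousLinearMap.snd ℝ F (F →L[ℝ] B) ∘L ContinuousLinearMap.fst ℝ _ _)
        (ContinuousLinearMap.compL ℝ E (F × (F →L[ℝ] B)) F
            (ContinuousLinearMap.fst ℝ F (F →L[ℝ] B)) ∘L ContinuousLinearMap.snd ℝ _ _))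

variable {B N} in
theorem jetPairing_apply (alt : (E →L[ℝ] B) →L[ℝ] N) (a b : JetVert E (F × (F →L[ℝ] B))) :
    jetPairing E F alt a b = alt ((ContinuousLinearMap.snd ℝ F (F →L[ℝ] B) ∘L a.2).flip b.1.1 +
      a.1.2 ∘L (ContinuousLinearMap.fst ℝ F (F →L[ℝ] B) ∘L b.2)) := rfl

end Algebra

/-! ### The phase bundle, its jets, and the canonical maps and forms -/

section Field

variable (E F : Type*) [NormedAddCommGroup E] [NormedSpace ℝ E]
  [NormedAddCommGroup F] [NormedSpace ℝ F]
  {M Q : Type*} [TopologicalSpace M] [ChartedSpace E M] [TopologicalSpace Q]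
  [ChartedSpace (E × F) Q] [IsManifold 𝓘(ℝ, E × F) ∞ Q]

/-- The exterior derivative at `x` of a `k`-form on `M`, whose value at each point is given in the
preferred chart at this point. -/
def extDerivAt [IsManifold 𝓘(ℝ, E) ∞ M] {k : ℕ} (α : M → Forms E k) (x : M) : Forms E (k + 1) :=
  extDeriv (fun u : E => pullForm k
      (tangentCoordChange 𝓘(ℝ, E) x ((chartAt E x).symm u) ((chartAt E x).symm u))
      (α ((chartAt E x).symm u))) (chartAt E x x)

/-- The first jet at `x` of the section `s` of `π`. -/
def jetOf (π : Q → M) [IsFibred E F π] (s : M → Q) (x : M) : Jet E F π :=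
  ⟨s x, ContinuousLinearMap.snd ℝ E F ∘L (mfderiv 𝓘(ℝ, E) 𝓘(ℝ, E × F) s x : E →L[ℝ] E × F)⟩

/-- The fibre coordinates `p^μ` of the phase bundle `V*Q ⊗ ⋀ᵈ T*M`; here `d = dim M - 1`. -/
abbrev Mom (d : ℕ) : Type _ := F →L[ℝ] Forms E d

/-- The phase bundle `P = V*Q ⊗ ⋀ᵈ T*M`, where `d = dim M - 1`. -/
abbrev Phase (d : ℕ) (π : Q → M) [IsFibred E F π] : Type _ := Dual E F d π

/-- `J¹P`, the first jet bundle of `P → M`. A jet `ζ` has the coordinates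
`ζ.base.base` (the point of `Q`), `ζ.base.fib` (that is `p^μ`), and `ζ.fib`
(that is `φ_{,μ}` and `p^μ_{,ν}`). -/
abbrev JetPhase (d : ℕ) (π : Q → M) [IsFibred E F π] : Type _ :=
  Jet E (F × Mom E F d) (dualProj E F d π)

/-- The projection `J¹P → M`. -/
abbrev jetPhaseProj (d : ℕ) (π : Q → M) [IsFibred E F π] : JetPhase E F d π → M :=
  jetProj E (F × Mom E F d) (dualProj E F d π)

/-- The vertical tangent space of `J¹P`: vectors `((δφ, δp^μ), (δφ_{,ν}, δp^μ_{,ν}))`. -/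
abbrev JetPhaseVert (d : ℕ) : Type _ := JetVert E (F × Mom E F d)

/-- `V*(J¹Q) ⊗ ⋀ⁿ T*M`. -/
abbrev Cov (n : ℕ) (π : Q → M) [IsFibred E F π] : Type _ := Dual E (JetVert E F) n (jetProj E F π)

/-- The projection `V*(J¹Q) ⊗ ⋀ⁿ T*M → M`. -/
abbrev covProj (n : ℕ) (π : Q → M) [IsFibred E F π] : Cov E F n π → M :=
  dualProj E (JetVert E F) n (jetProj E F π)

/-- The jet prolongation `J¹P → J¹Q` of the projection `P → Q`. -/
def jetPi (d : ℕ) (π : Q → M) [IsFibred E F π] (ζ : JetPhase E F d π) : Jet E F π :=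
  ⟨ζ.base.base, ContinuousLinearMap.fst ℝ F (Mom E F d) ∘L ζ.fib⟩

/-- `(∂_ν α) ↦ dα` for a `d`-form `α`: the map `E ⊗ ⋀ᵈ → ⋀ᵈ⁺¹` of alternation. -/
abbrev altForm (d : ℕ) : (E →L[ℝ] Forms E d) →L[ℝ] Forms E (d + 1) :=
  ContinuousAlternatingMap.alternatizeUncurryFinCLM ℝ E ℝ

/-- The canonical map `Ψ : J¹P → V*(J¹Q) ⊗ ⋀ᵈ⁺¹ T*M`, in coordinates
`⟨(v, v_ν), Ψ(ζ)⟩ = (v p^μ_{,μ} + p^μ v_μ) dⁿx`. -/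
def Psi (d : ℕ) (π : Q → M) [IsFibred E F π] (ζ : JetPhase E F d π) : Cov E F (d + 1) π :=
  ⟨jetPi E F d π ζ,
    altForm E d ∘L
      ((ContinuousLinearMap.snd ℝ F (Mom E F d) ∘L ζ.fib).flip ∘L
          ContinuousLinearMap.fst ℝ F (E →L[ℝ] F) +
        ContinuousLinearMap.compL ℝ E F (Forms E d) ζ.base.fib ∘L
          ContinuousLinearMap.snd ℝ F (E →L[ℝ] F))⟩

theorem Psi_apply (d : ℕ) (π : Q → M) [IsFibred E F π] (ζ : JetPhase E F d π)
    (v : F) (v' : E →L[ℝ] F) :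
    (Psi E F d π ζ).fib (v, v') = altForm E d
      ((ContinuousLinearMap.snd ℝ F (Mom E F d) ∘L ζ.fib).flip v + ζ.base.fib ∘L v') := by
  simp [Psi]

/-- The presymplectic form `(δp^μ_{,μ} ∧ δφ + δp^μ ∧ δφ_{,μ}) ⊗ dⁿx` on `J¹P`. -/
def omegaTilde (d : ℕ) (π : Q → M) [IsFibred E F π] :
    JetPhase E F d π → JetPhaseVert E F d [⋀^Fin 2]→L[ℝ] Forms E (d + 1) :=
  fun _ => twoForm (jetPairing E F (altForm E d))

/-- The canonical form `δη ∧ δφ` on `V*Y ⊗ ⋀ⁿ T*M`, where `φ` are the fibre coordinates of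
`π : Y → M` and `η` the induced linear coordinates of the vertical covectors: the vertical
differential of the tautological form `η δφ`. -/
def canonForm (n : ℕ) (π : Q → M) [IsFibred E F π] :
    Dual E F n π → (F × (F →L[ℝ] Forms E n)) [⋀^Fin 2]→L[ℝ] Forms E n :=
  fun _ => twoForm (pairing F (Forms E n))

/-- The coordinates `(p^μ, p^μ_{,ν})` of the fibres of `J¹P → J¹Q`. -/
abbrev MomJet (d : ℕ) : Type _ := JetVert E (Mom E F d)

/-- The jet of `P` over the jet `j` of `Q` with coordinates `p^μ` and `p^μ_{,ν}`. The addition and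
scalar multiplication of these coordinates are those of the vector bundle `J¹P → J¹Q`. -/
def jetPhaseMk (d : ℕ) (π : Q → M) [IsFibred E F π] (j : Jet E F π)
    (X : MomJet E F d) : JetPhase E F d π :=
  ⟨⟨j.base, X.1⟩, j.fib.prod X.2⟩

/-! ### The constraint sub-bundle -/

section Constraint

variable (GC : Type*) [NormedAddCommGroup GC] [NormedSpace ℝ GC] {C : Type*} [TopologicalSpace C]
  [ChartedSpace (E × GC) C] [IsManifold 𝓘(ℝ, E × GC) ∞ C]

/-- `ι : C → J¹Q` exhibits the bundle `πC : C → M` as a sub-bundle of `J¹Q → M`: it is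
a smooth embedding over `M`. -/
structure IsSubbundle (π : Q → M) [IsFibred E F π] (πC : C → M) (ι : C → Jet E F π) : Prop where
  isSmoothEmbedding : Manifold.IsSmoothEmbedding 𝓘(ℝ, E × GC) 𝓘(ℝ, E × JetVert E F) ∞ ι
  over_base : ∀ c, jetProj E F π (ι c) = πC c

variable {π : Q → M} [IsFibred E F π] (πC : C → M) [IsFibred E GC πC] (ι : C → Jet E F π)

/-- The inclusion `V_c C → V_{ι c} J¹Q`. -/
def vertDeriv (c : C) : GC →L[ℝ] JetVert E F :=
  ContinuousLinearMap.snd ℝ E (JetVert E F) ∘L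
    (mfderiv 𝓘(ℝ, E × GC) 𝓘(ℝ, E × JetVert E F) ι c : E × GC →L[ℝ] E × JetVert E F) ∘L
    ContinuousLinearMap.inr ℝ E GC

/-- `J¹P|_C`, a submanifold of `J¹P`. -/
def jetPhaseOver (d : ℕ) : Set (JetPhase E F d π) := {ζ | jetPi E F d π ζ ∈ range ι}

/-- `V*(J¹Q)|_C ⊗ ⋀ⁿ T*M`, a submanifold of `V*(J¹Q) ⊗ ⋀ⁿ T*M`. -/
def covOver (n : ℕ) : Set (Cov E F n π) := {η | η.base ∈ range ι}

/-- The restriction `V*(J¹Q)|_C ⊗ ⋀ⁿ T*M → V*C ⊗ ⋀ⁿ T*M` of covectors to `VC`. -/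
def restrictCov (n : ℕ) (η : covOver E F ι n) : Dual E GC n πC :=
  ⟨η.2.choose, (η : Cov E F n π).fib ∘L vertDeriv E F GC ι η.2.choose⟩

/-- The composite `Ψ_C : J¹P|_C → V*(J¹Q)|_C ⊗ ⋀ᵈ⁺¹ T*M → V*C ⊗ ⋀ᵈ⁺¹ T*M`. -/
def PsiC (d : ℕ) (ζ : jetPhaseOver E F ι d) : Dual E GC (d + 1) πC :=
  restrictCov E F GC πC ι (d + 1) ⟨Psi E F d π ζ, ζ.2⟩

end Constraint

end Field

end

open scoped ContDiff Manifold Topology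
open Set
set_option linter.unusedSectionVars false
set_option synthInstance.maxHeartbeats 400000


noncomputable section

/-! ### Derivatives in charts -/

section Charts

variable {V W N Y : Type*} [NormedAddCommGroup V] [NormedSpace ℝ V] [NormedAddCommGroup W]
  [NormedSpace ℝ W] [TopologicalSpace N] [ChartedSpace V N]
  [TopologicalSpace Y] [ChartedSpace W Y]

theorem eventually_mem_chart_overlap (i j : Y) {z : Y} (hi : z ∈ (chartAt W i).source)
    (hj : z ∈ (chartAt W j).source) : ∀ᶠ w in 𝓝 (chartAt W i z), w ∈ (chartAt W i).target ∧
      (chartAt W i).symm w ∈ (chartAt W j).source := by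
  have : ((chartAt W i).symm.trans (chartAt W j)).source ∈ 𝓝 (chartAt W i z) := by
    apply ((chartAt W i).symm.trans (chartAt W j)).open_source.mem_nhds
    simp [hi, hj]
  filter_upwards [this] with w hw
  simpa using hw

theorem hasFDerivAt_chart_change [IsManifold 𝓘(ℝ, W) ∞ Y] {i j z : Y}
    (hi : z ∈ (chartAt W i).source) (hj : z ∈ (chartAt W j).source) :
    HasFDerivAt (chartAt W j ∘ (chartAt W i).symm) (tangentCoordChange 𝓘(ℝ, W) i j z)
      (chartAt W i z) := by
  have h0 := hasFDerivWithinAt_tangentCoordChange (I := 𝓘(ℝ, W)) (x := i) (y := j) (z := z)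
    (by simpa using ⟨hi, hj⟩)
  simpa only [mfld_simps, hasFDerivWithinAt_univ] using h0

theorem contDiffAt_chart_change [IsManifold 𝓘(ℝ, W) ∞ Y] {i j z : Y}
    (hi : z ∈ (chartAt W i).source) (hj : z ∈ (chartAt W j).source) :
    ContDiffAt ℝ ∞ (chartAt W j ∘ (chartAt W i).symm) (chartAt W i z) := by
  have h := contDiffOn_ext_coord_change (I := 𝓘(ℝ, W)) (n := ∞) j i
  simp only [mfld_simps] at h
  refine h.contDiffAt ?_
  filter_upwards [eventually_mem_chart_overlap i j hi hj] with w hw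
  simpa using hw

variable (V W) in
/-- The derivative of `f` at `x` in the preferred charts at `x` and `f x`. -/
def chartDeriv (f : N → Y) (x : N) : V →L[ℝ] W := mfderiv 𝓘(ℝ, V) 𝓘(ℝ, W) f x

/-- `mfderiv` is the derivative in the charts at `x` and at `f x`; composing with the two transition
maps and using the chain rule gives any other charts. Tangent spaces at different points are
trivialized by different charts, so derivatives along curves and sections have to be brought into
one fixed chart in this way. -/
theorem hasFDerivAt_in_charts [IsManifold 𝓘(ℝ, V) ∞ N] [IsManifold 𝓘(ℝ, W) ∞ Y] {f : N → Y}
    {k x : N} {i : Y} (hf : MDifferentiableAt 𝓘(ℝ, V) 𝓘(ℝ, W) f x)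
    (hk : x ∈ (chartAt V k).source) (hi : f x ∈ (chartAt W i).source) :
    HasFDerivAt (fun u => chartAt W i (f ((chartAt V k).symm u)))
      (tangentCoordChange 𝓘(ℝ, W) (f x) i (f x) ∘L
        chartDeriv V W f x ∘L tangentCoordChange 𝓘(ℝ, V) k x x)
      (chartAt V k x) := by
  have h1 := hf.hasMFDerivAt.2
  simp only [writtenInExtChartAt, mfld_simps] at h1
  replace h1 := hasFDerivWithinAt_univ.1 h1
  have hx := mem_chart_source V x
  have hfx := mem_chart_source W (f x)
  have h2 := hasFDerivAt_chart_change (W := V) hk hx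
  have h3 := hasFDerivAt_chart_change (W := W) hfx hi
  have e1 : (chartAt V x ∘ (chartAt V k).symm) (chartAt V k x) = chartAt V x x := by simp [hk]
  rw [← e1] at h1
  have h4 := HasFDerivAt.comp (chartAt V k x) h1 h2
  have e2 : chartAt W (f x) (f x) = ((chartAt W (f x) ∘ f ∘ (chartAt V x).symm) ∘
    (chartAt V x ∘ (chartAt V k).symm)) (chartAt V k x) := by simp [hk]
  rw [e2] at h3
  have h5 := h3.comp (chartAt V k x) h4
  refine h5.congr_of_eventuallyEq ?_
  have hc : ContinuousAt (fun u => f ((chartAt V k).symm u)) (chartAt V k x) := by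
    refine ContinuousAt.comp (f := (chartAt V k).symm) (g := f) ?_ ?_
    · simpa [hk] using hf.continuousAt
    · exact (chartAt V k).continuousAt_symm ((chartAt V k).map_source hk)
  have hev : ∀ᶠ u in 𝓝 (chartAt V k x),
      f ((chartAt V k).symm u) ∈ (chartAt W (f x)).source := by
    apply hc.eventually_mem
    simpa [hk] using (chartAt W (f x)).open_source.mem_nhds hfx
  filter_upwards [hev, eventually_mem_chart_overlap k x hk hx] with u hu hu'
  simp [hu, hu'.2]

theorem hasDerivAt_in_chart [IsManifold 𝓘(ℝ, W) ∞ Y] {γ : ℝ → Y} {t : ℝ} {i : Y}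
    (hγ : MDifferentiableAt 𝓘(ℝ, ℝ) 𝓘(ℝ, W) γ t) (hi : γ t ∈ (chartAt W i).source) :
    HasDerivAt (fun t => chartAt W i (γ t)) (tangentCoordChange 𝓘(ℝ, W) (γ t) i (γ t)
      (chartDeriv ℝ W γ t 1)) t := by
  have h := hasFDerivAt_in_charts (k := t) hγ (mem_chart_source ℝ t) hi
  simp only [chartAt_self_eq, OpenPartialHomeomorph.refl_symm,
    OpenPartialHomeomorph.refl_apply] at h
  have e : tangentCoordChange 𝓘(ℝ, ℝ) t t t (1 : ℝ) = 1 := tangentCoordChange_self (by simp)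
  have key : ∀ (A : W →L[ℝ] W) (B : ℝ →L[ℝ] W) (C : ℝ →L[ℝ] ℝ), C 1 = 1 →
      A (B 1) = (A ∘L B ∘L C) 1 := by
    intro A B C hC
    simp [hC]
  rw [key _ _ _ e]
  exact h.hasDerivAt

/-- A map which is continuous at a point and smooth in charts is smooth. -/
theorem contMDiffAt_of_charts [IsManifold 𝓘(ℝ, V) ∞ N] [IsManifold 𝓘(ℝ, W) ∞ Y] {f : N → Y}
    {fhat : V → W} {x k : N} {i : Y} (hk : x ∈ (chartAt V k).source)
    (hi : fhat (chartAt V k x) ∈ (chartAt W i).target)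
    (hfhat : ContDiffAt ℝ ∞ fhat (chartAt V k x))
    (h : ∀ᶠ x' in 𝓝 x, f x' = (chartAt W i).symm (fhat (chartAt V k x'))) :
    ContMDiffAt 𝓘(ℝ, V) 𝓘(ℝ, W) ∞ f x := by
  refine ContMDiffAt.congr_of_eventuallyEq ?_ h
  have h1 : ContMDiffAt 𝓘(ℝ, V) 𝓘(ℝ, V) ∞ (chartAt V k) x :=
    (contMDiffOn_of_mem_maximalAtlas (IsManifold.chart_mem_maximalAtlas k)).contMDiffAt
      ((chartAt V k).open_source.mem_nhds hk)
  have h2 : ContMDiffAt 𝓘(ℝ, W) 𝓘(ℝ, W) ∞ (chartAt W i).symm (fhat (chartAt V k x)) :=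
    (contMDiffOn_symm_of_mem_maximalAtlas (IsManifold.chart_mem_maximalAtlas i)).contMDiffAt
      ((chartAt W i).open_target.mem_nhds hi)
  exact h2.comp x (hfhat.contMDiffAt.comp x h1)

theorem contMDiffAt_chartAt [IsManifold 𝓘(ℝ, W) ∞ Y] {i y : Y} (h : y ∈ (chartAt W i).source) :
    ContMDiffAt 𝓘(ℝ, W) 𝓘(ℝ, W) ∞ (chartAt W i) y :=
  (contMDiffOn_of_mem_maximalAtlas (IsManifold.chart_mem_maximalAtlas i)).contMDiffAt
      ((chartAt W i).open_source.mem_nhds h)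

theorem contMDiffAt_chartAt_symm [IsManifold 𝓘(ℝ, W) ∞ Y] {i : Y} {w : W}
    (h : w ∈ (chartAt W i).target) :
    ContMDiffAt 𝓘(ℝ, W) 𝓘(ℝ, W) ∞ (chartAt W i).symm w :=
  (contMDiffOn_symm_of_mem_maximalAtlas (IsManifold.chart_mem_maximalAtlas i)).contMDiffAt
      ((chartAt W i).open_target.mem_nhds h)

/-- The expression of a smooth map in charts is smooth. -/
theorem contDiffAt_in_charts [IsManifold 𝓘(ℝ, V) ∞ N] [IsManifold 𝓘(ℝ, W) ∞ Y] {f : N → Y}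
    {k x : N} {i : Y} (hf : ContMDiffAt 𝓘(ℝ, V) 𝓘(ℝ, W) ∞ f x)
    (hk : x ∈ (chartAt V k).source) (hi : f x ∈ (chartAt W i).source) :
    ContDiffAt ℝ ∞ (fun u => chartAt W i (f ((chartAt V k).symm u))) (chartAt V k x) := by
  rw [← contMDiffAt_iff_contDiffAt]
  have e : (chartAt V k).symm (chartAt V k x) = x := (chartAt V k).left_inv hk
  have h1 := contMDiffAt_chartAt_symm (i := k) ((chartAt V k).map_source hk)
  have h2 : ContMDiffAt 𝓘(ℝ, V) 𝓘(ℝ, W) ∞ f ((chartAt V k).symm (chartAt V k x)) := by rwa [e]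
  have h3 : ContMDiffAt 𝓘(ℝ, W) 𝓘(ℝ, W) ∞ (chartAt W i)
      (f ((chartAt V k).symm (chartAt V k x))) := contMDiffAt_chartAt (by rwa [e])
  exact ContMDiffAt.comp (g := chartAt W i) (f := f ∘ (chartAt V k).symm) _ h3
    (ContMDiffAt.comp _ h2 h1)

end Charts

/-! ### Charts of fibred manifolds: block-triangular changes and vertical velocities. -/

section Fibred

variable {E G M Y : Type*} [NormedAddCommGroup E] [NormedSpace ℝ E] [NormedAddCommGroup G]
  [NormedSpace ℝ G] [TopologicalSpace M] [ChartedSpace E M]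
  [TopologicalSpace Y] [ChartedSpace (E × G) Y]
  (π : Y → M) [IsFibred E G π]

include π in
theorem chart_change_fst {i j : Y} {w : E × G} (hw : w ∈ (chartAt (E × G) i).target)
    (hw' : (chartAt (E × G) i).symm w ∈ (chartAt (E × G) j).source) :
    (chartAt (E × G) j ((chartAt (E × G) i).symm w)).1 =
      chartAt E (π j) ((chartAt E (π i)).symm w.1) := by
  have hs := (chartAt (E × G) i).map_target hw
  rw [IsFibred.fst_chart (E := E) (G := G) (π := π) j _ hw']
  congr 1
  have := IsFibred.fst_chart (E := E) (G := G) (π := π) i _ hs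
  rw [(chartAt (E × G) i).right_inv hw] at this
  rw [this, (chartAt E (π i)).left_inv (IsFibred.mem_source (E := E) (G := G) (π := π) i _ hs)]

theorem proj_chart_symm {i : Y} {w : E × G} (hw : w ∈ (chartAt (E × G) i).target) :
    π ((chartAt (E × G) i).symm w) = (chartAt E (π i)).symm w.1 := by
  have hs := (chartAt (E × G) i).map_target hw
  have := IsFibred.fst_chart (E := E) (G := G) (π := π) i _ hs
  rw [(chartAt (E × G) i).right_inv hw] at this
  rw [this, (chartAt E (π i)).left_inv (IsFibred.mem_source (E := E) (G := G) (π := π) i _ hs)]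

variable [IsManifold 𝓘(ℝ, E × G) ∞ Y]

/-- By `chart_change_fst` the base coordinates of a transition map are a transition map of `M`;
differentiate both. Form values in different charts can thus be compared by changes of charts of `M`
alone. -/
theorem fst_tcc [IsManifold 𝓘(ℝ, E) ∞ M] {i j z : Y} (hi : z ∈ (chartAt (E × G) i).source)
    (hj : z ∈ (chartAt (E × G) j).source) (v : E × G) :
    (tcc E G i j z v).1 = tangentCoordChange 𝓘(ℝ, E) (π i) (π j) (π z) v.1 := by
  have h1 := hasFDerivAt_chart_change (W := E × G) hi hj
  have h2 := hasFDerivAt_chart_change (W := E)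
    (IsFibred.mem_source (E := E) (G := G) (π := π) i _ hi)
    (IsFibred.mem_source (E := E) (G := G) (π := π) j _ hj)
  rw [← IsFibred.fst_chart (E := E) (G := G) (π := π) i _ hi] at h2
  have h3 := (ContinuousLinearMap.fst ℝ E G).hasFDerivAt.comp _ h1
  have h4 := h2.comp _ (ContinuousLinearMap.fst ℝ E G).hasFDerivAt
  have h5 := h3.unique (h4.congr_of_eventuallyEq ?_)
  · exact DFunLike.congr_fun h5 v
  · filter_upwards [eventually_mem_chart_overlap i j hi hj] with w hw
    simpa using chart_change_fst π hw.1 hw.2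

theorem baseBlock_tcc [IsManifold 𝓘(ℝ, E) ∞ M] {i j z : Y}
    (hi : z ∈ (chartAt (E × G) i).source) (hj : z ∈ (chartAt (E × G) j).source) :
    baseBlock (tcc E G i j z) = tangentCoordChange 𝓘(ℝ, E) (π i) (π j) (π z) := by
  ext ξ
  simp [baseBlock, fst_tcc π hi hj]

include π in
-- The fibre block is the derivative restricted to vertical vectors. These stay vertical under a
-- change of charts, so the cocycle identity for the full derivative restricts to the blocks.
theorem fibreBlock_tcc_comp {i j l z : Y} (hi : z ∈ (chartAt (E × G) i).source)
    (hj : z ∈ (chartAt (E × G) j).source) (hl : z ∈ (chartAt (E × G) l).source) (v : G) :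
    fibreBlock (tcc E G j l z) (fibreBlock (tcc E G i j z) v) =
      fibreBlock (tcc E G i l z) v := by
  simp only [fibreBlock, ContinuousLinearMap.comp_apply, ContinuousLinearMap.inr_apply,
    ContinuousLinearMap.coe_snd']
  have e : (0, (tcc E G i j z (0, v)).2) = tcc E G i j z (0, v) := by
    ext <;> simp [tcc_vert π hi hj]
  rw [e, tcc_comp hi hj hl]

theorem fibreBlock_tcc_self {i z : Y} (hi : z ∈ (chartAt (E × G) i).source) (v : G) :
    fibreBlock (tcc E G i i z) v = v := by
  simp [fibreBlock, tcc_self hi]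

variable {π} in
/-- The velocity of a curve in a fibre is vertical. -/
theorem mfderiv_eq_vel {γ : ℝ → Y} {t : ℝ}
    (hγ : MDifferentiableAt 𝓘(ℝ, ℝ) 𝓘(ℝ, E × G) γ t) (hv : ∀ᶠ t' in 𝓝 t, π (γ t') = π (γ t)) :
    chartDeriv ℝ (E × G) γ t 1 = (0, vel E G γ t) := by
  have h := hasDerivAt_in_chart hγ (mem_chart_source (E × G) (γ t))
  have e : tangentCoordChange 𝓘(ℝ, E × G) (γ t) (γ t) (γ t)
      (chartDeriv ℝ (E × G) γ t 1) =
      chartDeriv ℝ (E × G) γ t 1 :=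
    tangentCoordChange_self (by simp)
  rw [e] at h
  have h1 : HasDerivAt (fun t' => (chartAt (E × G) (γ t) (γ t')).1) _ t :=
    (ContinuousLinearMap.fst ℝ E G).hasFDerivAt.comp_hasDerivAt t h
  have h2 : HasDerivAt (fun t' => (chartAt (E × G) (γ t) (γ t')).1) 0 t := by
    refine (hasDerivAt_const t (chartAt E (π (γ t)) (π (γ t)))).congr_of_eventuallyEq ?_
    have := hγ.continuousAt.eventually_mem
      ((chartAt (E × G) (γ t)).open_source.mem_nhds (mem_chart_source (E × G) (γ t)))
    filter_upwards [this, hv] with t' h1 h2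
    rw [IsFibred.fst_chart (E := E) (G := G) (π := π) _ _ h1, h2]
  have h3 := h1.unique h2
  exact Prod.ext h3 rfl

variable {π} in
/-- The fibre coordinates of the velocity of a curve in a fibre, in an arbitrary chart. -/
theorem hasDerivAt_snd_chart {γ : ℝ → Y} {t : ℝ} {i : Y}
    (hγ : MDifferentiableAt 𝓘(ℝ, ℝ) 𝓘(ℝ, E × G) γ t) (hv : ∀ᶠ t' in 𝓝 t, π (γ t') = π (γ t))
    (hi : γ t ∈ (chartAt (E × G) i).source) :
    HasDerivAt (fun t => (chartAt (E × G) i (γ t)).2)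
      (fibreBlock (tcc E G (γ t) i (γ t)) (vel E G γ t)) t := by
  have h := hasDerivAt_in_chart hγ hi
  rw [mfderiv_eq_vel hγ hv] at h
  exact (ContinuousLinearMap.snd ℝ E G).hasFDerivAt.comp_hasDerivAt t h

variable {π} in
theorem vel_eq_of_hasDerivAt {γ : ℝ → Y} {t : ℝ} {g : G}
    (hγ : MDifferentiableAt 𝓘(ℝ, ℝ) 𝓘(ℝ, E × G) γ t) (hv : ∀ᶠ t' in 𝓝 t, π (γ t') = π (γ t))
    (h : HasDerivAt (fun t' => (chartAt (E × G) (γ t) (γ t')).2) g t) : vel E G γ t = g := by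
  have h1 := hasDerivAt_snd_chart hγ hv (mem_chart_source (E × G) (γ t))
  rw [fibreBlock_tcc_self (mem_chart_source (E × G) (γ t))] at h1
  exact h1.unique h

end Fibred

end

noncomputable section

/-! ### Coordinates of total spaces, jets and covectors -/

namespace FibreCore

variable {E G Y K : Type*} [NormedAddCommGroup E] [NormedSpace ℝ E]
  [NormedAddCommGroup G] [NormedSpace ℝ G] [NormedAddCommGroup K] [NormedSpace ℝ K]
  [TopologicalSpace Y] [ChartedSpace (E × G) Y] (c : FibreCore E G Y K)

/-- The fibre coordinates of `z` in the trivialization given by the chart at `i`. -/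
def coord (i : Y) (z : c.Total) : K := c.coordChange z.base i z.base z.fib

theorem coord_base (z : c.Total) : c.coord z.base z = z.fib :=
  c.coordChange_self _ _ (mem_chart_source _ _) _

/-- The change from the chart at `i` back to the chart at the base point undoes `coord`, so the
coordinates in one chart determine the fibre component. -/
theorem ext_coord {i : Y} {z z' : c.Total} (hb : z.base = z'.base)
    (hz : z.base ∈ (chartAt (E × G) i).source) (h : c.coord i z = c.coord i z') : z = z' := by
  obtain ⟨y, k⟩ := z
  obtain ⟨y', k'⟩ := z'
  obtain rfl : y = y' := hb
  have h1 := congrArg (c.coordChange i y y) h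
  simp only [coord] at h1
  rw [c.coordChange_comp _ _ _ _ (mem_chart_source _ _) hz (mem_chart_source _ _),
    c.coordChange_comp _ _ _ _ (mem_chart_source _ _) hz (mem_chart_source _ _),
    c.coordChange_self _ _ (mem_chart_source _ _),
    c.coordChange_self _ _ (mem_chart_source _ _)] at h1
  rw [h1]

/-- The point over `y` with given fibre coordinates in the chart at `i`. -/
def ofCoord (i y : Y) (k : K) : c.Total := ⟨y, c.coordChange i y y k⟩

theorem coord_ofCoord {i y : Y} (h : y ∈ (chartAt (E × G) i).source) (k : K) :
    c.coord i (c.ofCoord i y k) = k := by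
  simp only [coord, ofCoord]
  rw [c.coordChange_comp _ _ _ _ h (mem_chart_source _ _) h, c.coordChange_self _ _ h]

variable [IsManifold 𝓘(ℝ, E × G) ∞ Y]

theorem chartAt_apply (z₀ z : c.Total) : chartAt (E × (G × K)) z₀ z =
    ((chartAt (E × G) z₀.base z.base).1, (chartAt (E × G) z₀.base z.base).2,
      c.coord z₀.base z) := rfl

theorem mem_chartAt_source {z₀ z : c.Total} : z ∈ (chartAt (E × (G × K)) z₀).source ↔
    z.base ∈ (chartAt (E × G) z₀.base).source := Iff.rfl

theorem mem_chartAt_target {z₀ : c.Total} {w : E × (G × K)} :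
    w ∈ (chartAt (E × (G × K)) z₀).target ↔ (w.1, w.2.1) ∈ (chartAt (E × G) z₀.base).target :=
  Iff.rfl

theorem chartAt_symm_apply (z₀ : c.Total) (w : E × (G × K)) :
    (chartAt (E × (G × K)) z₀).symm w =
      c.ofCoord z₀.base ((chartAt (E × G) z₀.base).symm (w.1, w.2.1)) w.2.2 := rfl

theorem coord_chartAt_symm {z₀ : c.Total} {w : E × (G × K)}
    (hw : w ∈ (chartAt (E × (G × K)) z₀).target) :
    c.coord z₀.base ((chartAt (E × (G × K)) z₀).symm w) = w.2.2 := by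
  rw [chartAt_symm_apply, coord_ofCoord]
  exact (chartAt (E × G) z₀.base).map_target hw

theorem contMDiff_base : ContMDiff 𝓘(ℝ, E × (G × K)) 𝓘(ℝ, E × G) ∞ (Total.base (c := c)) := by
  intro z
  refine contMDiffAt_of_charts (k := z) (i := z.base) (fhat := fun w => (w.1, w.2.1))
    (mem_chart_source _ _) ?_ (by fun_prop) ?_
  · exact (chartAt (E × G) z.base).map_source (mem_chart_source _ _)
  · have : ∀ᶠ z' in 𝓝 z, z' ∈ (chartAt (E × (G × K)) z).source :=
      (chartAt (E × (G × K)) z).open_source.mem_nhds (mem_chart_source _ _)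
    filter_upwards [this] with z' hz'
    simp [chartAt_apply, (chartAt (E × G) z.base).left_inv hz']

/-- Smooth curves in a fibre of a bundle. -/
theorem contMDiff_fibre_curve (y : Y) {k : ℝ → K} (hk : ContDiff ℝ ∞ k) :
    ContMDiff 𝓘(ℝ, ℝ) 𝓘(ℝ, E × (G × K)) ∞ (fun t => (⟨y, k t⟩ : c.Total)) := by
  intro t
  refine contMDiffAt_of_charts (k := t) (i := ⟨y, k t⟩)
    (fhat := fun t => ((chartAt (E × G) y y).1, (chartAt (E × G) y y).2, k t))
    (mem_chart_source _ _) ?_ ?_ (Filter.Eventually.of_forall fun t' => ?_)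
  · rw [mem_chartAt_target]
    exact (chartAt (E × G) y).map_source (mem_chart_source _ _)
  · exact contDiffAt_const.prodMk (contDiffAt_const.prodMk hk.contDiffAt)
  · have := (chartAt (E × (G × K)) (⟨y, k t⟩ : c.Total)).left_inv
      (x := ⟨y, k t'⟩) (mem_chart_source (E × G) y)
    rw [← this, chartAt_apply]
    congr 1
    simp only [chartAt_self_eq, OpenPartialHomeomorph.refl_apply]
    congr 2
    exact c.coord_base ⟨y, k t'⟩

end FibreCore

section Bundles

variable {E G : Type*} [NormedAddCommGroup E] [NormedSpace ℝ E]
  [NormedAddCommGroup G] [NormedSpace ℝ G]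
  {M Y : Type*} [TopologicalSpace M] [ChartedSpace E M] [TopologicalSpace Y]
  [ChartedSpace (E × G) Y] (π : Y → M) [IsFibred E G π]

variable [IsManifold 𝓘(ℝ, E × G) ∞ Y] [IsManifold 𝓘(ℝ, E) ∞ M]

variable {π} in
-- Differentiate `π ∘ s = id` in the charts at `x` and `s x`: the base coordinates of the section
-- are the identity.
theorem fst_chartDeriv_section {s : M → Y} {x : M}
    (hs : MDifferentiableAt 𝓘(ℝ, E) 𝓘(ℝ, E × G) s x) (hπ : ∀ᶠ x' in 𝓝 x, π (s x') = x') :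
    ContinuousLinearMap.fst ℝ E G ∘L chartDeriv E (E × G) s x = ContinuousLinearMap.id ℝ E := by
  have hx : π (s x) = x := hπ.self_of_nhds
  have h := hasFDerivAt_in_charts hs (mem_chart_source E x) (mem_chart_source (E × G) (s x))
  have e : tangentCoordChange 𝓘(ℝ, E × G) (s x) (s x) (s x) ∘L chartDeriv E (E × G) s x ∘L
      tangentCoordChange 𝓘(ℝ, E) x x x = chartDeriv E (E × G) s x := by
    ext1 v
    have h1 : tangentCoordChange 𝓘(ℝ, E) x x x v = v := tangentCoordChange_self (by simp)
    rw [ContinuousLinearMap.comp_apply, ContinuousLinearMap.comp_apply, h1]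
    exact tangentCoordChange_self (by simp)
  rw [e] at h
  have h1 := (ContinuousLinearMap.fst ℝ E G).hasFDerivAt.comp _ h
  refine h1.unique ((hasFDerivAt_id _).congr_of_eventuallyEq ?_)
  have hc := (chartAt E x).continuousAt_symm (mem_chart_target E x)
  have hc' : Filter.Tendsto (chartAt E x).symm (𝓝 (chartAt E x x)) (𝓝 x) := by
    simpa using hc.tendsto
  have h2 : ∀ᶠ x' in 𝓝 x, s x' ∈ (chartAt (E × G) (s x)).source :=
    hs.continuousAt.eventually_mem ((chartAt (E × G) (s x)).open_source.mem_nhds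
      (mem_chart_source _ _))
  filter_upwards [hc'.eventually h2, hc'.eventually hπ,
    (chartAt E x).open_target.mem_nhds (mem_chart_target E x)] with u h3 h4 h5
  simp only [Function.comp_apply, ContinuousLinearMap.coe_fst', id]
  rw [IsFibred.fst_chart (E := E) (G := G) (π := π) _ _ h3, h4, hx, (chartAt E x).right_inv h5]

variable {π} in
/-- The jet coordinates of a section, in an arbitrary chart. -/
theorem hasFDerivAt_jet_coord {s : M → Y} {x : M} {i : Y}
    (hs : MDifferentiableAt 𝓘(ℝ, E) 𝓘(ℝ, E × G) s x) (hπ : ∀ᶠ x' in 𝓝 x, π (s x') = x')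
    (hi : s x ∈ (chartAt (E × G) i).source) :
    HasFDerivAt (fun u => (chartAt (E × G) i (s ((chartAt E (π i)).symm u))).2)
      ((jetCore E G π).coord i (jetOf E G π s x)) (chartAt E (π i) x) := by
  have hx : π (s x) = x := hπ.self_of_nhds
  have hxi := IsFibred.mem_source (E := E) (G := G) (π := π) i _ hi
  rw [hx] at hxi
  have h := (ContinuousLinearMap.snd ℝ E G).hasFDerivAt.comp _
    (hasFDerivAt_in_charts hs hxi hi)
  refine h.congr_fderiv (Eq.symm ?_)
  -- The coordinate change of jets acts on graphs of linear maps, and the derivative of a section is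
  -- the graph of its jet coordinates because its base component is the identity.
  have e : (ContinuousLinearMap.id ℝ E).prod (ContinuousLinearMap.snd ℝ E G ∘L
      chartDeriv E (E × G) s x) = chartDeriv E (E × G) s x := by
    rw [← fst_chartDeriv_section hs hπ]
    ext v <;> rfl
  change (ContinuousLinearMap.snd ℝ E G ∘L tcc E G (s x) i (s x) ∘L
    (ContinuousLinearMap.id ℝ E).prod (ContinuousLinearMap.snd ℝ E G ∘L
      chartDeriv E (E × G) s x)) ∘L baseBlock (tcc E G i (s x) (s x)) = _
  rw [e, baseBlock_tcc π hi (mem_chart_source _ _), hx]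
  rfl

/-- The value of a form-valued covector on a vertical vector, in an arbitrary chart. -/
theorem dual_coord_apply {k : ℕ} {i : Y} (η : Dual E G k π)
    (hi : η.base ∈ (chartAt (E × G) i).source) (v : G) :
    (dualCore E G k π).coord i η (fibreBlock (tcc E G η.base i η.base) v) =
      pullForm k (tangentCoordChange 𝓘(ℝ, E) (π i) (π η.base) (π η.base)) (η.fib v) := by
  change pullForm k (baseBlock (tcc E G i η.base η.base)) (η.fib
    (fibreBlock (tcc E G i η.base η.base) (fibreBlock (tcc E G η.base i η.base) v))) = _
  rw [fibreBlock_tcc_comp π (mem_chart_source _ _) hi (mem_chart_source _ _),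
    fibreBlock_tcc_self (mem_chart_source _ _), baseBlock_tcc π hi (mem_chart_source _ _)]

/-- The fibre block is invertible, so every vector of the chart at `i` is the image of some `v`, and
a covector is determined by its values on those images. -/
theorem dual_coord_eq {k : ℕ} {i : Y} (η : Dual E G k π)
    (hi : η.base ∈ (chartAt (E × G) i).source) {ξ : G →L[ℝ] Forms E k}
    (h : ∀ v, ξ (fibreBlock (tcc E G η.base i η.base) v) =
      pullForm k (tangentCoordChange 𝓘(ℝ, E) (π i) (π η.base) (π η.base)) (η.fib v)) :
    (dualCore E G k π).coord i η = ξ := by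
  ext1 v
  have e := fibreBlock_tcc_comp π hi (mem_chart_source (E × G) η.base) hi v
  rw [fibreBlock_tcc_self hi] at e
  rw [← e, dual_coord_apply π η hi, h]

end Bundles

end

noncomputable section

/-! ### A criterion for reductions -/

section Reduction

variable {E G H M Y Z : Type*} [NormedAddCommGroup E] [NormedSpace ℝ E]
  [NormedAddCommGroup G] [NormedSpace ℝ G] [NormedAddCommGroup H] [NormedSpace ℝ H]
  [TopologicalSpace M] [ChartedSpace E M] [TopologicalSpace Y] [ChartedSpace (E × G) Y]
  [TopologicalSpace Z] [ChartedSpace (E × H) Z]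

/-- Vertical curves are required for all real times, while a straight line in a chart leaves the
chart. A rescaled sine keeps the unit velocity at `0` and stays bounded. -/
theorem exists_bounded_reparametrization {ε : ℝ} (hε : 0 < ε) :
    ∃ ρ : ℝ → ℝ, ContDiff ℝ ∞ ρ ∧ ρ 0 = 0 ∧ HasDerivAt ρ 1 0 ∧ ∀ t, |ρ t| ≤ ε := by
  refine ⟨fun t => ε * Real.sin (ε⁻¹ * t), ?_, by simp, ?_, fun t => ?_⟩
  · fun_prop
  · have h1 : HasDerivAt (fun t : ℝ => ε⁻¹ * t) ε⁻¹ 0 := by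
      simpa using (hasDerivAt_id (0 : ℝ)).const_mul ε⁻¹
    have h2 := (h1.sin).const_mul ε
    simpa [hε.ne'] using h2
  · rw [abs_mul, abs_of_pos hε]
    exact mul_le_of_le_one_right hε.le (Real.abs_sin_le_one _)

/-- There is a vertical curve with given initial velocity in a given neighbourhood. -/
theorem exists_vertical_curve [IsManifold 𝓘(ℝ, E × H) ∞ Z] (π' : Z → M) [IsFibred E H π']
    {O : Set Z} (hO : IsOpen O) {z : Z} (hz : z ∈ O) (b : H) :
    ∃ c : ℝ → Z, ContMDiff 𝓘(ℝ, ℝ) 𝓘(ℝ, E × H) ∞ c ∧ c 0 = z ∧ (∀ t, c t ∈ O) ∧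
      (∀ t, π' (c t) = π' z) ∧ vel E H c 0 = b := by
  set e := chartAt (E × H) z with he
  have hez : e z ∈ e.target := mem_chart_target _ z
  have hline : ContDiff ℝ ∞ (fun t : ℝ => e z + t • ((0 : E), b)) := by fun_prop
  have hU : e.target ∩ e.symm ⁻¹' O ∈ 𝓝 (e z + (0 : ℝ) • ((0 : E), b)) := by
    rw [zero_smul, add_zero]
    refine (e.isOpen_inter_preimage_symm hO).mem_nhds ⟨hez, ?_⟩
    simpa [he] using hz
  have h0 := hline.continuous.continuousAt.eventually_mem hU
  obtain ⟨ε, hε, hball⟩ := Metric.eventually_nhds_iff.1 h0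
  -- The bound on `ρ` is not strict while the ball is open, hence half of `ε`.
  obtain ⟨ρ, hρ, hρ0, hρ', hρε⟩ := exists_bounded_reparametrization (half_pos hε)
  have hmem : ∀ t, e z + ρ t • ((0 : E), b) ∈ e.target ∩ e.symm ⁻¹' O := fun t => by
    apply hball
    rw [Real.dist_eq, sub_zero]
    exact (hρε t).trans_lt (half_lt_self hε)
  have hsm : ContDiff ℝ ∞ (fun t => e z + ρ t • ((0 : E), b)) := hline.comp hρ
  have hc : ContMDiff 𝓘(ℝ, ℝ) 𝓘(ℝ, E × H) ∞ (fun t => e.symm (e z + ρ t • ((0 : E), b))) :=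
    fun t => (contMDiffAt_chartAt_symm (hmem t).1).comp t hsm.contDiffAt.contMDiffAt
  have hc0 : e.symm (e z + ρ 0 • ((0 : E), b)) = z := by simp [hρ0, he]
  have hπ : ∀ t, π' (e.symm (e z + ρ t • ((0 : E), b))) = π' z := fun t => by
    have h1 := proj_chart_symm π' (hmem t).1
    have h2 := proj_chart_symm π' hez
    rw [e.left_inv (mem_chart_source _ z)] at h2
    refine h1.trans (Eq.trans ?_ h2.symm)
    simp [he]
  refine ⟨fun t => e.symm (e z + ρ t • ((0 : E), b)), hc, hc0, fun t => (hmem t).2, hπ, ?_⟩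
  refine vel_eq_of_hasDerivAt (π := π') ((hc 0).mdifferentiableAt (by simp))
    (Filter.Eventually.of_forall fun t => (hπ t).trans (hπ 0).symm) ?_
  rw [hc0]
  have h3 : ∀ t, e (e.symm (e z + ρ t • ((0 : E), b))) = e z + ρ t • ((0 : E), b) :=
    fun t => e.right_inv (hmem t).1
  simp only [← he, h3]
  have h4 : HasDerivAt (fun t => (e z).2 + ρ t • b) ((1 : ℝ) • b) 0 :=
    (hρ'.smul_const b).const_add _
  simpa using h4

/-- A vertical curve without velocity is constant. -/
theorem eq_of_vel_eq_zero [IsManifold 𝓘(ℝ, E × H) ∞ Z] (π' : Z → M) [IsFibred E H π']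
    {c : ℝ → Z} (hc : MDifferentiable 𝓘(ℝ, ℝ) 𝓘(ℝ, E × H) c) (hv : ∀ t, π' (c t) = π' (c 0))
    (h0 : ∀ t, vel E H c t = 0) (t t' : ℝ) : c t = c t' := by
  have hd : ∀ t i, c t ∈ (chartAt (E × H) i).source →
      HasDerivAt (fun t => chartAt (E × H) i (c t)) 0 t := by
    intro t i hi
    have h := hasDerivAt_in_chart (hc t) hi
    rw [mfderiv_eq_vel (π := π') (hc t)
      (Filter.Eventually.of_forall fun t' => (hv t').trans (hv t).symm), h0,
      show ((0 : E), (0 : H)) = 0 from rfl, map_zero] at h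
    exact h
  -- A single chart covers the curve only for short times, so the vanishing derivative gives local
  -- constancy; connectedness of the line does the rest.
  have hloc : IsLocallyConstant c := by
    rw [IsLocallyConstant.iff_eventually_eq]
    intro s
    have h1 := (hc s).continuousAt.eventually_mem
      ((chartAt (E × H) (c s)).open_source.mem_nhds (mem_chart_source _ _))
    obtain ⟨ε, hε, hball⟩ := Metric.eventually_nhds_iff_ball.1 h1
    filter_upwards [Metric.ball_mem_nhds s hε] with s' hs'
    have h2 := Metric.isOpen_ball.is_const_of_deriv_eq_zero
      (convex_ball s ε).isPreconnected
      (fun x hx => (hd x (c s) (hball x hx)).differentiableAt.differentiableWithinAt)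
      (fun x hx => (hd x (c s) (hball x hx)).deriv) hs' (Metric.mem_ball_self hε)
    exact (chartAt (E × H) (c s)).injOn (hball s' hs') (mem_chart_source _ _) h2
  exact hloc.apply_eq_of_preconnectedSpace t t'

/-- Tangent vectors of `S` are velocities at time `0`, whereas leaves involve velocities at all
times; translation of time reconciles the two. -/
theorem vel_shift {γ : ℝ → Z} (t : ℝ) (hγ : MDifferentiableAt 𝓘(ℝ, ℝ) 𝓘(ℝ, E × H) γ t) :
    vel E H (fun s => γ (t + s)) 0 = vel E H γ t := by
  have h1 : HasMFDerivAt 𝓘(ℝ, ℝ) 𝓘(ℝ, ℝ) (fun s : ℝ => t + s) 0 (ContinuousLinearMap.id ℝ ℝ) :=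
    ((hasFDerivAt_id (0 : ℝ)).const_add t).hasMFDerivAt
  have h0 : γ (t + 0) = γ t := by rw [add_zero]
  have h2 : HasMFDerivAt 𝓘(ℝ, ℝ) 𝓘(ℝ, E × H) γ (t + 0)
      (mfderiv 𝓘(ℝ, ℝ) 𝓘(ℝ, E × H) γ (t + 0)) := by
    rw [add_zero]; exact hγ.hasMFDerivAt
  have h3 := (h2.comp (0 : ℝ) h1).mfderiv
  have h4 : vel E H (fun s => γ (t + s)) 0 = vel E H γ (t + 0) := by
    change (chartDeriv ℝ (E × H) (fun s => γ (t + s)) 0 1).2 = (chartDeriv ℝ (E × H) γ (t + 0) 1).2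
    have h5 : chartDeriv ℝ (E × H) (fun s => γ (t + s)) 0 =
      chartDeriv ℝ (E × H) γ (t + 0) ∘L ContinuousLinearMap.id ℝ ℝ := h3
    rw [h5]; rfl
  rw [h4, add_zero]

theorem vel_const (z : Z) (t : ℝ) : vel E H (fun _ : ℝ => z) t = 0 := by
  have h : chartDeriv ℝ (E × H) (fun _ : ℝ => z) t = 0 := mfderiv_const
  change (chartDeriv ℝ (E × H) (fun _ : ℝ => z) t 1).2 = 0
  rw [h]; rfl

theorem IsVertCurve.shift {π : Y → M} {S : Set Y} {γ : ℝ → S} (h : IsVertCurve E G π γ) (t : ℝ) :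
    IsVertCurve E G π (fun s => γ (t + s)) where
  smooth := h.smooth.comp (by
    rw [contMDiff_iff_contDiff]; fun_prop : ContMDiff 𝓘(ℝ, ℝ) 𝓘(ℝ, ℝ) ∞ fun s : ℝ => t + s)
  vertical s := (h.vertical _).trans (h.vertical _).symm

theorem vert_ext {n : ℕ} {Ω Ω' : H [⋀^Fin 2]→L[ℝ] Forms E n}
    (h : ∀ a b, Ω ![a, b] = Ω' ![a, b]) : Ω = Ω' := by
  ext1 v
  have : v = ![v 0, v 1] := by
    ext i; fin_cases i <;> rfl
  rw [this, h]

variable {π : Y → M} {S : Set Y} {n : ℕ} {Ω : Y → G [⋀^Fin 2]→L[ℝ] Forms E n}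
  {π' : Z → M} {Ω' : Z → H [⋀^Fin 2]→L[ℝ] Forms E n} {f : S → Z}

/-- The composition of a locally extendible smooth map with a smooth curve is smooth. -/
theorem contMDiff_comp_curve
    (smooth : ∀ s : S, ∃ (O : Set Y) (F : Y → Z), IsOpen O ∧ (s : Y) ∈ O ∧
      ContMDiffOn 𝓘(ℝ, E × G) 𝓘(ℝ, E × H) ∞ F O ∧ ∀ s' : S, (s' : Y) ∈ O → F s' = f s')
    {γ : ℝ → S} (hγ : ContMDiff 𝓘(ℝ, ℝ) 𝓘(ℝ, E × G) ∞ (fun t => (γ t : Y))) :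
    ContMDiff 𝓘(ℝ, ℝ) 𝓘(ℝ, E × H) ∞ (f ∘ γ) := by
  intro t
  obtain ⟨O, F, hO, ht, hF, hFf⟩ := smooth (γ t)
  have h1 : ContMDiffAt 𝓘(ℝ, E × G) 𝓘(ℝ, E × H) ∞ F (γ t : Y) :=
    hF.contMDiffAt (hO.mem_nhds ht)
  refine (ContMDiffAt.comp t h1 (hγ t)).congr_of_eventuallyEq ?_
  filter_upwards [hγ.continuous.continuousAt.eventually_mem (hO.mem_nhds ht)] with t' ht'
  exact (hFf (γ t') ht').symm

/-- A surjective submersion which pulls a nondegenerate form back to the given form, and whose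
fibres are connected by curves, is a reduction. -/
theorem isReduction_of_pullback [IsManifold 𝓘(ℝ, E × H) ∞ Z] [IsFibred E H π']
    (over_base : ∀ s : S, π' (f s) = π s)
    (smooth : ∀ s : S, ∃ (O : Set Y) (F : Y → Z), IsOpen O ∧ (s : Y) ∈ O ∧
      ContMDiffOn 𝓘(ℝ, E × G) 𝓘(ℝ, E × H) ∞ F O ∧ ∀ s' : S, (s' : Y) ∈ O → F s' = f s')
    (surjective : Function.Surjective f)
    (section_through : ∀ s : S, ∃ (O : Set Z) (σ : Z → Y), IsOpen O ∧ f s ∈ O ∧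
      ContMDiffOn 𝓘(ℝ, E × H) 𝓘(ℝ, E × G) ∞ σ O ∧ σ (f s) = s ∧
      ∀ z ∈ O, ∃ h : σ z ∈ S, f ⟨σ z, h⟩ = z)
    (pullback : ∀ γ₁ γ₂ : ℝ → S, IsVertCurve E G π γ₁ → IsVertCurve E G π γ₂ → γ₁ 0 = γ₂ 0 →
      Ω' (f (γ₁ 0)) ![vel E H (f ∘ γ₁) 0, vel E H (f ∘ γ₂) 0] =
        Ω (γ₁ 0) ![vel E G (fun t => (γ₁ t : Y)) 0, vel E G (fun t => (γ₂ t : Y)) 0])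
    (nondegenerate : ∀ (z : Z) (a : H), (∀ b : H, Ω' z ![a, b] = 0) → a = 0)
    (connected : ∀ s s' : S, f s = f s' → ∃ γ : ℝ → S, IsVertCurve E G π γ ∧
      (∀ t, f (γ t) = f s) ∧ γ 0 = s ∧ γ 1 = s') :
    IsReduction E G H π S Ω π' Ω' f := by
  -- Compose a vertical curve of `Z` with initial velocity `b` with the local section through `s`.
  -- Every vertical vector of the target is thereby the image of a tangent vector of `S`.
  have lift : ∀ (s : S) (b : H), ∃ γ : ℝ → S, IsVertCurve E G π γ ∧ γ 0 = s ∧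
      vel E H (f ∘ γ) 0 = b := by
    intro s b
    obtain ⟨O, σ, hO, hs, hσ, hσs, hfσ⟩ := section_through s
    obtain ⟨c, hc, hc0, hcO, hcv, hcb⟩ := exists_vertical_curve (E := E) π' hO hs b
    choose hS hf using hfσ
    have hfc : f ∘ (fun t => (⟨σ (c t), hS _ (hcO t)⟩ : S)) = c := by
      funext t; exact hf _ (hcO t)
    refine ⟨fun t => ⟨σ (c t), hS _ (hcO t)⟩, ⟨?_, fun t => ?_⟩, ?_, ?_⟩
    · exact fun t => (hσ.contMDiffAt (hO.mem_nhds (hcO t))).comp t (hc t)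
    · rw [← over_base, ← over_base, hf _ (hcO t), hf _ (hcO 0), hcv, hcv]
    · ext1; simp [hc0, hσs]
    · rw [hfc, hcb]
  refine ⟨over_base, smooth, surjective, section_through, fun s s' => ⟨fun h => ?_, fun h => ?_⟩,
    fun Ω'' => ⟨fun h => ?_, ?_⟩⟩
  · obtain ⟨γ, hγ, hfγ, h0, h1⟩ := connected s s' h
    refine Relation.EqvGen.rel _ _ ⟨γ, hγ, fun t => ⟨?_, ?_⟩, h0, h1⟩
    · exact ⟨_, hγ.shift t, by simp,
        vel_shift t (hγ.smooth.mdifferentiable (by simp) t)⟩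
    · rintro _ ⟨γ', hγ', h0', rfl⟩
      have hp := pullback _ γ' (hγ.shift t) hγ' (by simp [h0'])
      rw [vel_shift (γ := fun t => (γ t : Y)) t (hγ.smooth.mdifferentiable (by simp) t)] at hp
      simp only [add_zero] at hp
      -- The image of the curve under `f` is constant, so one argument of the pulled back form is
      -- zero.
      rw [← hp, show f ∘ (fun s => γ (t + s)) = fun _ => f s from funext fun _ => hfγ _,
        vel_const]
      exact (Ω' (f (γ t))).map_coord_zero 0 rfl
  · induction h with
    | rel s s' h =>
      obtain ⟨γ, hγ, hdeg, rfl, rfl⟩ := h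
      have hsm : MDifferentiable 𝓘(ℝ, ℝ) 𝓘(ℝ, E × H) (f ∘ γ) :=
        (contMDiff_comp_curve smooth hγ.smooth).mdifferentiable (by simp)
      refine eq_of_vel_eq_zero π' hsm (fun t => ?_) (fun t => ?_) 0 1
      · simp only [Function.comp_apply, over_base]; exact hγ.vertical t
      -- Each test vector `b` lifts to `S`, where the velocity of `γ` is degenerate; so the velocity
      -- of `f ∘ γ` pairs to zero with all of them.
      · apply nondegenerate (f (γ t))
        intro b
        obtain ⟨γ', hγ', h0, rfl⟩ := lift (γ t) b
        have hp := pullback _ γ' (hγ.shift t) hγ' (by simp [h0])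
        rw [vel_shift (γ := fun t => (γ t : Y)) t (hγ.smooth.mdifferentiable (by simp) t),
          show f ∘ (fun s => γ (t + s)) = fun s => (f ∘ γ) (t + s) from rfl,
          vel_shift t (hsm t)] at hp
        simp only [add_zero] at hp
        rw [hp]
        exact (hdeg t).2 _ ⟨γ', hγ', h0, rfl⟩
    | refl => rfl
    | symm _ _ _ ih => exact ih.symm
    | trans _ _ _ _ _ ih₁ ih₂ => exact ih₁.trans ih₂
  -- Two vertical vectors at `z` lift to curves through the same point of `S`, so the pullback
  -- condition fixes the value of the form on them.
  · funext z
    apply vert_ext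
    intro a b
    obtain ⟨s, rfl⟩ := surjective z
    obtain ⟨γ₁, hγ₁, h1, rfl⟩ := lift s a
    obtain ⟨γ₂, hγ₂, h2, rfl⟩ := lift s b
    have e1 := h γ₁ γ₂ hγ₁ hγ₂ (h1.trans h2.symm)
    have e2 := pullback γ₁ γ₂ hγ₁ hγ₂ (h1.trans h2.symm)
    rw [h1] at e1 e2
    rw [e1, e2]
  · rintro rfl
    exact pullback

end Reduction

end

noncomputable section

/-! ### Linear algebra of forms of top degree -/

section TopForms

variable {E F : Type*} [NormedAddCommGroup E] [NormedSpace ℝ E] [FiniteDimensional ℝ E]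
  [NormedAddCommGroup F] [NormedSpace ℝ F] [FiniteDimensional ℝ F]

/-- Forms embed into multilinear maps on a finite-dimensional space. This makes linear right
inverses on form-valued covectors continuous. -/
theorem finiteDimensional_forms (k : ℕ) : FiniteDimensional ℝ (Forms E k) := by
  let T : Forms E k →ₗ[ℝ] MultilinearMap ℝ (fun _ : Fin k => E) ℝ :=
    { toFun := fun α => α.toContinuousMultilinearMap.toMultilinearMap
      map_add' := fun _ _ => rfl
      map_smul' := fun _ _ => rfl }
  refine FiniteDimensional.of_injective T fun α α' h => ?_
  ext v
  exact DFunLike.congr_fun h v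

attribute [local instance] finiteDimensional_forms

/-- The determinant in a basis is a nonzero form. Nondegeneracy of the canonical form needs nonzero
coefficients. -/
theorem nontrivial_topForms {n : ℕ} (hn : Module.finrank ℝ E = n) : Nontrivial (Forms E n) := by
  obtain ⟨b⟩ : Nonempty (Module.Basis (Fin n) ℝ E) := ⟨Module.finBasisOfFinrankEq ℝ E hn⟩
  have hcont : Continuous fun v : Fin n → E => b.det v := by
    simp only [Module.Basis.det_apply]
    refine Continuous.matrix_det (continuous_matrix fun i j => ?_)
    simp only [Module.Basis.toMatrix_apply]
    exact ((b.coord i).continuous_of_finiteDimensional).comp (continuous_apply j)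
  let α : Forms E n := { b.det with cont := hcont }
  refine ⟨α, 0, fun h => ?_⟩
  have h1 : α b = 0 := by rw [h]; rfl
  have h2 : α b = 1 := b.det_self
  exact one_ne_zero (h2.symm.trans h1)

/-- The identity `θ ∧ (v ⌟ α) = θ(v) α` for forms `α` of top degree. -/
theorem altForm_smulRight_curryLeft {d : ℕ} (hd : Module.finrank ℝ E = d + 1) (θ : E →L[ℝ] ℝ)
    (α : Forms E (d + 1)) (v : E) :
    altForm E d (θ.smulRight (α.curryLeft v)) = θ v • α := by
  ext w
  -- `θ ∧ α` has degree `d + 2`, and `d + 2` vectors in a space of dimension `d + 1` are dependent.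
  -- Expanding along the first vector `v` gives `θ(v) α - θ ∧ (v ⌟ α) = 0`.
  have h0 : altForm E (d + 1) (θ.smulRight α) (Fin.cons v w) = 0 := by
    refine AlternatingMap.map_linearDependent (altForm E (d + 1) (θ.smulRight α)).toAlternatingMap
      (Fin.cons v w) fun h => ?_
    have := h.fintype_card_le_finrank
    simp [hd] at this
  rw [ContinuousAlternatingMap.alternatizeUncurryFinCLM_apply,
    ContinuousAlternatingMap.alternatizeUncurryFin_apply, Fin.sum_univ_succ] at h0
  rw [ContinuousAlternatingMap.alternatizeUncurryFinCLM_apply,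
    ContinuousAlternatingMap.alternatizeUncurryFin_apply]
  have h1 : ∀ i : Fin (d + 1), Fin.removeNth i.succ (Fin.cons v w : Fin (d + 2) → E) =
      Fin.cons v (Fin.removeNth i w) := by
    intro i
    ext j
    refine Fin.cases ?_ (fun j => ?_) j
    · simp [Fin.removeNth]
    · simp [Fin.removeNth]
  simp only [h1, Fin.cons_zero, Fin.cons_succ, Fin.val_zero, pow_zero, one_smul, Fin.val_succ,
    pow_succ, mul_neg, mul_one, neg_smul, Finset.sum_neg_distrib,
    ContinuousLinearMap.smulRight_apply, ContinuousAlternatingMap.smul_apply] at h0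
  have h2 : Fin.removeNth 0 (Fin.cons v w : Fin (d + 2) → E) = w := by
    ext j; simp [Fin.removeNth]
  rw [h2] at h0
  simp only [ContinuousLinearMap.smulRight_apply, ContinuousAlternatingMap.smul_apply]
  rw [eq_comm, ← sub_eq_zero, ← h0, sub_eq_add_neg]
  rfl

end TopForms

/-! ### The fibrewise linear map underlying `Ψ` -/

section PsiLin

variable {E F B N : Type*} [NormedAddCommGroup E] [NormedSpace ℝ E]
  [NormedAddCommGroup F] [NormedSpace ℝ F] [NormedAddCommGroup B] [NormedSpace ℝ B]
  [NormedAddCommGroup N] [NormedSpace ℝ N]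

variable (F) in
/-- The linear map `(p, p') ↦ ((v, v') ↦ alt (p' v + p v'))`. -/
def psiLin (alt : (E →L[ℝ] B) →L[ℝ] N) :
    JetVert E (F →L[ℝ] B) →L[ℝ] (JetVert E F →L[ℝ] N) :=
  ContinuousLinearMap.compL ℝ (JetVert E F) (E →L[ℝ] B) N alt ∘L
    ((ContinuousLinearMap.compL ℝ (JetVert E F) F (E →L[ℝ] B)).flip
        (ContinuousLinearMap.fst ℝ F (E →L[ℝ] F)) ∘L
        (ContinuousLinearMap.flipₗᵢ ℝ E F B).toContinuousLinearEquiv.toContinuousLinearMap ∘L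
        ContinuousLinearMap.snd ℝ _ _ +
      (ContinuousLinearMap.compL ℝ (JetVert E F) (E →L[ℝ] F) (E →L[ℝ] B)).flip
        (ContinuousLinearMap.snd ℝ F (E →L[ℝ] F)) ∘L
        ContinuousLinearMap.compL ℝ E F B ∘L ContinuousLinearMap.fst ℝ _ _)

theorem psiLin_apply (alt : (E →L[ℝ] B) →L[ℝ] N) (X : JetVert E (F →L[ℝ] B)) (w : JetVert E F) :
    psiLin F alt X w = alt (X.2.flip w.1 + X.1 ∘L w.2) := rfl

/-- The product rule for the pairing of a covector field with a vector field. -/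
theorem hasFDerivAt_pairing {p : E → (F →L[ℝ] B)} {v : E → F} {p' : E →L[ℝ] (F →L[ℝ] B)}
    {v' : E →L[ℝ] F} {u : E} (hp : HasFDerivAt p p' u) (hv : HasFDerivAt v v' u) :
    HasFDerivAt (fun u => p u (v u)) (p'.flip (v u) + p u ∘L v') u := by
  rw [add_comm]
  exact hp.clm_apply hv

variable [FiniteDimensional ℝ E] [FiniteDimensional ℝ F]

/-- Here `ι α v` plays the role of the contraction `v ⌟ α`, and `hι` says that it is undone by
wedging with a dual covector. In a basis of `E`, the two components of the target covector are then
hit separately, one by `p` and the other by `p'`. -/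
theorem psiLin_surjective {alt : (E →L[ℝ] B) →L[ℝ] N} (ι : N →ₗ[ℝ] E →ₗ[ℝ] B)
    (hE : 0 < Module.finrank ℝ E)
    (hι : ∀ (θ : E →L[ℝ] ℝ) (α : N) (v : E), alt (θ.smulRight (ι α v)) = θ v • α) :
    Function.Surjective (psiLin F alt) := by
  intro η
  let b := Module.finBasis ℝ E
  let i₀ : Fin (Module.finrank ℝ E) := ⟨0, hE⟩
  let θ : Fin (Module.finrank ℝ E) → (E →L[ℝ] ℝ) := fun i => (b.coord i).toContinuousLinearMap
  have hθ : ∀ i j, θ i (b j) = if i = j then 1 else 0 := fun i j => by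
    simp [θ, Finsupp.single_apply, eq_comm]
  -- Applying `alt` to `θ_j ⊗ P φ` leaves, by duality of the bases, the single term `η (0, θ_j ⊗
  -- φ)`.
  let P : F →L[ℝ] B := LinearMap.toContinuousLinearMap
    { toFun := fun φ => ∑ i, ι (η (0, (θ i).smulRight φ)) (b i)
      map_add' := fun φ φ' => by
        have : ∀ i, ((0 : F), (θ i).smulRight (φ + φ')) =
            (0, (θ i).smulRight φ) + (0, (θ i).smulRight φ') := fun i => by
          ext <;> simp
        simp only [this, map_add, LinearMap.add_apply, Finset.sum_add_distrib]
      map_smul' := fun a φ => by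
        have : ∀ i, ((0 : F), (θ i).smulRight (a • φ)) = a • (0, (θ i).smulRight φ) :=
          fun i => by ext <;> simp [smul_comm a]
        simp only [this, map_smul, LinearMap.smul_apply, Finset.smul_sum, RingHom.id_apply] }
  -- Only the divergence of `p'` enters, so one coordinate direction suffices; it exists because `E`
  -- has positive dimension.
  let P' : F →L[ℝ] (E →L[ℝ] B) := LinearMap.toContinuousLinearMap
    { toFun := fun φ => (θ i₀).smulRight (ι (η (φ, 0)) (b i₀))
      map_add' := fun φ φ' => by
        have : ((φ + φ', 0) : JetVert E F) = (φ, 0) + (φ', 0) := by simp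
        rw [this, map_add]
        ext; simp
      map_smul' := fun a φ => by
        have : ((a • φ, 0) : JetVert E F) = a • (φ, 0) := by simp
        rw [this, map_smul]
        ext; simp [smul_comm a] }
  refine ⟨(P, P'.flip), ContinuousLinearMap.ext fun w => ?_⟩
  obtain ⟨v, v'⟩ := w
  rw [psiLin_apply, map_add]
  have h1 : alt (P'.flip.flip v) = η (v, 0) := by
    change alt ((θ i₀).smulRight (ι (η (v, 0)) (b i₀))) = _
    rw [hι, hθ]
    simp
  -- Splitting `v'` into maps of rank one reduces the check of `P` to the vectors for which it was
  -- built.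
  have hv' : v' = ∑ j, (θ j).smulRight (v' (b j)) := by
    ext ξ
    conv_lhs => rw [← b.sum_repr ξ, map_sum]
    simp only [map_smul, sum_apply, ContinuousLinearMap.smulRight_apply]
    rfl
  have h2 : P ∘L v' = ∑ j, ∑ i, (θ j).smulRight (ι (η (0, (θ i).smulRight (v' (b j)))) (b i)) := by
    refine ContinuousLinearMap.ext fun ξ => ?_
    conv_lhs => rw [hv']
    simp only [ContinuousLinearMap.comp_apply, sum_apply, map_sum,
      ContinuousLinearMap.smulRight_apply, map_smul]
    refine Finset.sum_congr rfl fun j _ => ?_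
    rw [← Finset.smul_sum]
    rfl
  have h3 : alt (P ∘L v') = η (0, v') := by
    rw [h2]
    simp_rw [map_sum, hι, hθ]
    have : ((0 : F), v') = ∑ j, ((0 : F), (θ j).smulRight (v' (b j))) := by
      conv_lhs => rw [hv']
      ext1
      · simp [Prod.fst_sum]
      · simp [Prod.snd_sum]
    rw [this, map_sum]
    refine Finset.sum_congr rfl fun j _ => ?_
    simp [Finset.sum_ite_eq]
  rw [h1, h3, ← map_add]
  simp

theorem exists_rightInverse_of_surjective {V W : Type*} [NormedAddCommGroup V] [NormedSpace ℝ V]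
    [NormedAddCommGroup W] [NormedSpace ℝ W] [FiniteDimensional ℝ W] (T : V →L[ℝ] W)
    (hT : Function.Surjective T) : ∃ R : W →L[ℝ] V, ∀ w, T (R w) = w := by
  obtain ⟨R, hR⟩ := T.toLinearMap.exists_rightInverse_of_surjective (LinearMap.range_eq_top.2 hT)
  exact ⟨R.toContinuousLinearMap, fun η => DFunLike.congr_fun hR η⟩

theorem exists_leftInverse_of_injective {V W : Type*} [NormedAddCommGroup V] [NormedSpace ℝ V]
    [NormedAddCommGroup W] [NormedSpace ℝ W] [FiniteDimensional ℝ W] (T : V →L[ℝ] W)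
    (hT : Function.Injective T) : ∃ R : W →L[ℝ] V, ∀ v, R (T v) = v := by
  obtain ⟨R, hR⟩ := T.toLinearMap.exists_leftInverse_of_injective (LinearMap.ker_eq_bot.2 hT)
  exact ⟨R.toContinuousLinearMap, fun η => DFunLike.congr_fun hR η⟩

theorem exists_psiLin_rightInverse [FiniteDimensional ℝ N] {alt : (E →L[ℝ] B) →L[ℝ] N}
    (ι : N →ₗ[ℝ] E →ₗ[ℝ] B) (hE : 0 < Module.finrank ℝ E)
    (hι : ∀ (θ : E →L[ℝ] ℝ) (α : N) (v : E), alt (θ.smulRight (ι α v)) = θ v • α) :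
    ∃ R : (JetVert E F →L[ℝ] N) →L[ℝ] JetVert E (F →L[ℝ] B), ∀ η, psiLin F alt (R η) = η := by
  have h := psiLin_surjective (F := F) ι hE hι
  generalize psiLin F alt = T at h ⊢
  exact exists_rightInverse_of_surjective (V := JetVert E (F →L[ℝ] B))
    (W := JetVert E F →L[ℝ] N) T h

/-- Pairing with `(0, f ⊗ n)`, for a norming functional `f` of `a.1` and a nonzero `n`, detects the
vector part; once it vanishes, pairing with `(v, 0)` reads off the covector part. -/
theorem twoForm_pairing_nondegenerate [Nontrivial N] {a : F × (F →L[ℝ] N)}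
    (h : ∀ b, twoForm (pairing F N) ![a, b] = 0) : a = 0 := by
  simp only [twoForm_apply, pairing_apply] at h
  obtain ⟨n, hn⟩ := exists_ne (0 : N)
  have h1 : a.1 = 0 := by
    by_contra h1
    obtain ⟨f, -, hf⟩ := exists_dual_vector ℝ a.1 (by simpa using h1)
    have h2 := h (0, f.smulRight n)
    have h3 : f a.1 ≠ 0 := by
      rw [hf]; simpa using h1
    simp [hn, h3] at h2
  ext1
  · exact h1
  · ext1 v
    simpa [h1] using h (v, 0)

end PsiLin

section PsiForms

variable {E F : Type*} [NormedAddCommGroup E] [NormedSpace ℝ E] [FiniteDimensional ℝ E]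
  [NormedAddCommGroup F] [NormedSpace ℝ F] [FiniteDimensional ℝ F]

theorem Psi_fib {M Q : Type*} [TopologicalSpace M] [ChartedSpace E M] [TopologicalSpace Q]
    [ChartedSpace (E × F) Q] [IsManifold 𝓘(ℝ, E × F) ∞ Q] (d : ℕ) (π : Q → M) [IsFibred E F π]
    (ζ : JetPhase E F d π) : (Psi E F d π ζ).fib =
      psiLin F (altForm E d)
        (ζ.base.fib, ContinuousLinearMap.snd ℝ F (Mom E F d) ∘L ζ.fib) := rfl

/-- Contraction of forms of top degree satisfies the identity required by `psiLin_surjective`. A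
linear right inverse, rather than bare surjectivity, is what yields smooth local sections of `Ψ`. -/
theorem exists_psiLin_altForm_rightInverse {d : ℕ} (hd : Module.finrank ℝ E = d + 1) :
    ∃ R : (JetVert E F →L[ℝ] Forms E (d + 1)) →L[ℝ] MomJet E F d,
      ∀ η, psiLin F (altForm E d) (R η) = η := by
  have := finiteDimensional_forms (E := E) (d + 1)
  exact exists_psiLin_rightInverse
    { toFun := fun α => (α.curryLeft : E →L[ℝ] Forms E d).toLinearMap
      map_add' := fun _ _ => rfl
      map_smul' := fun _ _ => rfl } (by omega) (altForm_smulRight_curryLeft hd)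

end PsiForms

end

noncomputable section

/-! ### Jets of families of sections -/

/-- The mixed second derivatives of a family of functions agree. -/
theorem exists_mixed_derivative {E F : Type*} [NormedAddCommGroup E] [NormedSpace ℝ E]
    [NormedAddCommGroup F] [NormedSpace ℝ F] {Φ : ℝ × E → F} {u₀ : E}
    (hΦ : ContDiffAt ℝ ∞ Φ (0, u₀)) :
    ∃ V' : E →L[ℝ] F,
      HasDerivAt (fun t => fderiv ℝ Φ (t, u₀) ∘L ContinuousLinearMap.inr ℝ ℝ E) V' 0 ∧
      HasFDerivAt (fun u => fderiv ℝ Φ (0, u) (1, 0)) V' u₀ := by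
  have h2 : ContDiffAt ℝ ∞ (fderiv ℝ Φ) (0, u₀) := hΦ.fderiv_right (by simp)
  have h3 : HasFDerivAt (fderiv ℝ Φ) (fderiv ℝ (fderiv ℝ Φ) (0, u₀)) (0, u₀) :=
    (h2.differentiableAt (by simp)).hasFDerivAt
  -- The same map `V'` serves for both orders of differentiation because the second derivative is
  -- symmetric.
  have hsymm : IsSymmSndFDerivAt ℝ Φ (0, u₀) := hΦ.isSymmSndFDerivAt (by
    rw [minSmoothness_of_isRCLikeNormedField]; exact WithTop.coe_le_coe.2 le_top)
  refine ⟨fderiv ℝ (fderiv ℝ Φ) (0, u₀) (1, 0) ∘L ContinuousLinearMap.inr ℝ ℝ E, ?_, ?_⟩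
  · have h4 : HasDerivAt (fun t : ℝ => (t, u₀)) ((1 : ℝ), (0 : E)) 0 :=
      (hasDerivAt_id (0 : ℝ)).prodMk (hasDerivAt_const 0 u₀)
    have h5 := h3.comp_hasDerivAt (0 : ℝ) h4
    exact (ContinuousLinearMap.precomp F (ContinuousLinearMap.inr ℝ ℝ E)).hasFDerivAt.comp_hasDerivAt
      (0 : ℝ) h5
  · have h4 : HasFDerivAt (fun u : E => ((0 : ℝ), u)) (ContinuousLinearMap.inr ℝ ℝ E) u₀ :=
      hasFDerivAt_prodMk_right 0 u₀
    have h5 := HasFDerivAt.comp (g := fderiv ℝ Φ) u₀ h3 h4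
    have h6 := h5.clm_apply (hasFDerivAt_const ((1 : ℝ), (0 : E)) u₀)
    refine h6.congr_fderiv ?_
    ext ξ
    simpa using hsymm.eq (0, ξ) (1, 0)

section Families

variable {E G M Y : Type*} [NormedAddCommGroup E] [NormedSpace ℝ E] [NormedAddCommGroup G]
  [NormedSpace ℝ G] [TopologicalSpace M] [ChartedSpace E M] [IsManifold 𝓘(ℝ, E) ∞ M]
  [TopologicalSpace Y] [ChartedSpace (E × G) Y] [IsManifold 𝓘(ℝ, E × G) ∞ Y]
  (π : Y → M) [IsFibred E G π]

theorem tendsto_chart_symm {x k : M} (hk : x ∈ (chartAt E k).source) :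
    Filter.Tendsto (chartAt E k).symm (𝓝 (chartAt E k x)) (𝓝 x) := by
  have := ((chartAt E k).continuousAt_symm ((chartAt E k).map_source hk)).tendsto
  rwa [(chartAt E k).left_inv hk] at this

variable {σ : ℝ × M → Y} {x₀ : M}
  (hσ : ContMDiffAt (𝓘(ℝ, ℝ).prod 𝓘(ℝ, E)) 𝓘(ℝ, E × G) ∞ σ (0, x₀))
  (hπ : ∀ᶠ z in 𝓝 ((0 : ℝ), x₀), π (σ z) = z.2)

include hσ hπ

/-- The fibre coordinates of a family of sections. -/
theorem contDiffAt_family_coord {i : Y} (hi : σ (0, x₀) ∈ (chartAt (E × G) i).source) :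
    ContDiffAt ℝ ∞ (fun z : ℝ × E => (chartAt (E × G) i (σ (z.1, (chartAt E (π i)).symm z.2))).2)
      (0, chartAt E (π i) x₀) := by
  have hx : π (σ (0, x₀)) = x₀ := hπ.self_of_nhds
  have hxi := IsFibred.mem_source (E := E) (G := G) (π := π) i _ hi
  rw [hx] at hxi
  have hinv : (chartAt E (π i)).symm (chartAt E (π i) x₀) = x₀ := (chartAt E (π i)).left_inv hxi
  have h1 : ContMDiffAt 𝓘(ℝ, ℝ × E) (𝓘(ℝ, ℝ).prod 𝓘(ℝ, E)) ∞
      (fun z : ℝ × E => (z.1, (chartAt E (π i)).symm z.2)) (0, chartAt E (π i) x₀) := by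
    refine ContMDiffAt.prodMk contDiff_fst.contDiffAt.contMDiffAt ?_
    exact (contMDiffAt_chartAt_symm ((chartAt E (π i)).map_source hxi)).comp
      (((0 : ℝ), chartAt E (π i) x₀) : ℝ × E) contDiff_snd.contDiffAt.contMDiffAt
  have h2 : ContMDiffAt (𝓘(ℝ, ℝ).prod 𝓘(ℝ, E)) 𝓘(ℝ, E × G) ∞ σ
      ((fun z : ℝ × E => (z.1, (chartAt E (π i)).symm z.2)) (0, chartAt E (π i) x₀)) := by
    simpa only [hinv] using hσ
  have h3 := ContMDiffAt.comp (g := σ)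
    (f := fun z : ℝ × E => (z.1, (chartAt E (π i)).symm z.2)) _ h2 h1
  have h4 := (contMDiffAt_chartAt (i := i) (y := (σ ∘ fun z : ℝ × E =>
    (z.1, (chartAt E (π i)).symm z.2)) (0, chartAt E (π i) x₀))
      (by simpa only [Function.comp_apply, hinv] using hi)).comp _ h3
  exact (contMDiffAt_iff_contDiffAt.1 h4).snd

theorem eventually_mdifferentiableAt_slice : ∀ᶠ z in 𝓝 ((0 : ℝ), x₀),
    MDifferentiableAt 𝓘(ℝ, ℝ) 𝓘(ℝ, E × G) (fun t => σ (t, z.2)) z.1 ∧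
    MDifferentiableAt 𝓘(ℝ, E) 𝓘(ℝ, E × G) (fun x => σ (z.1, x)) z.2 ∧
    (∀ᶠ t in 𝓝 z.1, π (σ (t, z.2)) = z.2) ∧ (∀ᶠ x in 𝓝 z.2, π (σ (z.1, x)) = x) := by
  -- Smoothness at a point gives a neighbourhood for each finite order but no common one; order one
  -- spreads to nearby points, and it is enough here.
  have h1 : ContMDiffAt (𝓘(ℝ, ℝ).prod 𝓘(ℝ, E)) 𝓘(ℝ, E × G) 1 σ (0, x₀) := hσ.of_le (by simp)
  have h2 := (contMDiffAt_iff_contMDiffAt_nhds (n := 1) (by simp)).1 h1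
  filter_upwards [h2, hπ.eventually_nhds] with z hz hz'
  have hd : MDifferentiableAt (𝓘(ℝ, ℝ).prod 𝓘(ℝ, E)) 𝓘(ℝ, E × G) σ (z.1, z.2) :=
    hz.mdifferentiableAt (by simp)
  refine ⟨?_, ?_, ?_, ?_⟩
  · exact hd.comp z.1 (f := fun t => (t, z.2))
      (mdifferentiableAt_id.prodMk mdifferentiableAt_const)
  · exact hd.comp z.2 (f := fun x => (z.1, x))
      (mdifferentiableAt_const.prodMk mdifferentiableAt_id)
  · have hc : Filter.Tendsto (fun t => (t, z.2)) (𝓝 z.1) (𝓝 (z.1, z.2)) :=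
      (Continuous.prodMk_left z.2).tendsto z.1
    exact hc.eventually hz'
  · have hc : Filter.Tendsto (fun x => (z.1, x)) (𝓝 z.2) (𝓝 (z.1, z.2)) :=
      (Continuous.prodMk_right z.1).tendsto z.2
    exact hc.eventually hz'

/-- For each small `t` the jet coordinates are the spatial derivative of the fibre coordinates of
the slice, that is, a partial derivative of the coordinate function of the whole family. Smooth
dependence on `t` and the variation of the jets are read off from this. -/
theorem eventually_jet_family {i : Y} (hi : σ (0, x₀) ∈ (chartAt (E × G) i).source) :
    ∀ᶠ t in 𝓝 (0 : ℝ), σ (t, x₀) ∈ (chartAt (E × G) i).source ∧ π (σ (t, x₀)) = x₀ ∧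
      (jetCore E G π).coord i (jetOf E G π (fun x => σ (t, x)) x₀) =
        fderiv ℝ (fun z : ℝ × E => (chartAt (E × G) i (σ (z.1, (chartAt E (π i)).symm z.2))).2)
          (t, chartAt E (π i) x₀) ∘L ContinuousLinearMap.inr ℝ ℝ E := by
  have hc : Filter.Tendsto (fun t : ℝ => (t, x₀)) (𝓝 0) (𝓝 (0, x₀)) :=
    (Continuous.prodMk_left x₀).tendsto 0
  have hc' : Filter.Tendsto (fun t : ℝ => (t, chartAt E (π i) x₀)) (𝓝 0)
      (𝓝 (0, chartAt E (π i) x₀)) := (Continuous.prodMk_left _).tendsto 0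
  have h1 := hc.eventually (eventually_mdifferentiableAt_slice π hσ hπ)
  have h2 : ∀ᶠ z in 𝓝 ((0 : ℝ), x₀), σ z ∈ (chartAt (E × G) i).source :=
    hσ.continuousAt.eventually_mem ((chartAt (E × G) i).open_source.mem_nhds hi)
  have h3 := (contDiffAt_family_coord π hσ hπ hi).of_le (m := 1) (by simp)
  have h4 := hc'.eventually (h3.eventually (by simp))
  filter_upwards [h1, hc.eventually h2, hc.eventually hπ, h4] with t ht1 ht2 ht3 ht4
  refine ⟨ht2, ht3, ?_⟩
  have h5 := hasFDerivAt_jet_coord (π := π) ht1.2.1 ht1.2.2.2 ht2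
  have h6 := (ht4.differentiableAt (by simp)).hasFDerivAt.comp (chartAt E (π i) x₀)
    (hasFDerivAt_prodMk_right (𝕜 := ℝ) t (chartAt E (π i) x₀))
  exact h5.unique h6

/-- The jets of a family of sections form a smooth curve. -/
theorem contMDiffAt_jet_family :
    ContMDiffAt 𝓘(ℝ, ℝ) 𝓘(ℝ, E × (G × (E →L[ℝ] G))) ∞
      (fun t => jetOf E G π (fun x => σ (t, x)) x₀) 0 := by
  set i := σ (0, x₀) with hidef
  have hi : σ (0, x₀) ∈ (chartAt (E × G) i).source := mem_chart_source _ _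
  set Φ := fun z : ℝ × E => (chartAt (E × G) i (σ (z.1, (chartAt E (π i)).symm z.2))).2 with hΦ
  have hsm := contDiffAt_family_coord π hσ hπ hi
  have hx : π i = x₀ := hπ.self_of_nhds
  have hxi : x₀ ∈ (chartAt E (π i)).source := by
    rw [hx]; exact mem_chart_source _ _
  have hev := eventually_jet_family π hσ hπ hi
  set j := jetOf E G π (fun x => σ (0, x)) x₀ with hj
  have hc : ContDiffAt ℝ ∞ (fun t : ℝ => (t, chartAt E (π i) x₀)) 0 := by fun_prop
  have hfst : ∀ y ∈ (chartAt (E × G) i).source, π y = x₀ →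
      (chartAt (E × G) i y).1 = chartAt E (π i) x₀ := fun y hy hy' => by
    rw [IsFibred.fst_chart (E := E) (G := G) (π := π) _ _ hy, hy']
  refine contMDiffAt_of_charts (k := (0 : ℝ)) (i := j) (fhat := fun t => (chartAt E (π i) x₀,
      (Φ (t, chartAt E (π i) x₀),
        fderiv ℝ Φ (t, chartAt E (π i) x₀) ∘L ContinuousLinearMap.inr ℝ ℝ E)))
    (mem_chart_source _ _) ?_ ?_ ?_
  · rw [FibreCore.mem_chartAt_target]
    change (chartAt E (π i) x₀, Φ (0, chartAt E (π i) x₀)) ∈ (chartAt (E × G) i).target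
    have : (chartAt E (π i) x₀, Φ (0, chartAt E (π i) x₀)) = chartAt (E × G) i i := by
      refine Prod.ext (hfst _ hi hx).symm ?_
      simp only [hΦ, (chartAt E (π i)).left_inv hxi]
      rfl
    rw [this]
    exact mem_chart_target _ _
  · have h1 : ContDiffAt ℝ ∞ (fderiv ℝ Φ) (0, chartAt E (π i) x₀) := hsm.fderiv_right (by simp)
    refine contDiffAt_const.prodMk (ContDiffAt.prodMk ?_ ?_)
    · exact ContDiffAt.comp (g := Φ) (0 : ℝ) hsm hc
    · exact (ContDiffAt.comp (g := fderiv ℝ Φ) (0 : ℝ) h1 hc).clm_comp contDiffAt_const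
  · filter_upwards [hev] with t ht
    have h2 := (chartAt (E × (G × (E →L[ℝ] G))) j).left_inv
      (x := jetOf E G π (fun x => σ (t, x)) x₀) ht.1
    rw [← h2, FibreCore.chartAt_apply]
    congr 1
    refine Prod.ext (hfst _ ht.1 ht.2.1) (Prod.ext ?_ ht.2.2)
    simp only [hΦ, chartAt_self_eq, OpenPartialHomeomorph.refl_apply,
      (chartAt E (π i)).left_inv hxi]
    rfl

/-- The coordinates of the variation of the jets of a family of sections. -/
theorem exists_variation_coord {i : Y} (hi : σ (0, x₀) ∈ (chartAt (E × G) i).source)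
    (jc : Jet E G π) (hjc : jc.base = i) :
    ∃ v' : E →L[ℝ] G, HasFDerivAt (fun u =>
        fderiv ℝ (fun z : ℝ × E => (chartAt (E × G) i (σ (z.1, (chartAt E (π i)).symm z.2))).2)
          (0, u) (1, 0)) v' (chartAt E (π i) x₀) ∧
      fibreBlock (tcc E (G × (E →L[ℝ] G)) (jetOf E G π (fun x => σ (0, x)) x₀) jc
          (jetOf E G π (fun x => σ (0, x)) x₀))
        (vel E (G × (E →L[ℝ] G)) (fun t => jetOf E G π (fun x => σ (t, x)) x₀) 0) =
      (fderiv ℝ (fun z : ℝ × E => (chartAt (E × G) i (σ (z.1, (chartAt E (π i)).symm z.2))).2)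
          (0, chartAt E (π i) x₀) (1, 0), v') := by
  subst hjc
  set i := jc.base with hidef
  have hx : π (σ (0, x₀)) = x₀ := hπ.self_of_nhds
  have hxi := IsFibred.mem_source (E := E) (G := G) (π := π) i _ hi
  rw [hx] at hxi
  set Φ := fun z : ℝ × E => (chartAt (E × G) i (σ (z.1, (chartAt E (π i)).symm z.2))).2 with hΦ
  have hsm := contDiffAt_family_coord π hσ hπ hi
  -- `V'` is both the time derivative of the jet coordinates and the spatial derivative of the
  -- variation. This makes the variation of the jet the jet of the variation.
  obtain ⟨V', h1, h2⟩ := exists_mixed_derivative hsm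
  refine ⟨V', h2, ?_⟩
  have hev := eventually_jet_family π hσ hπ hi
  have hcurve := (contMDiffAt_jet_family π hσ hπ).mdifferentiableAt (by simp)
  have hv : ∀ᶠ t in 𝓝 (0 : ℝ), jetProj E G π (jetOf E G π (fun x => σ (t, x)) x₀) =
      jetProj E G π (jetOf E G π (fun x => σ (0, x)) x₀) := by
    filter_upwards [hev] with t ht
    exact ht.2.1.trans hx.symm
  have h3 := hasDerivAt_snd_chart (π := jetProj E G π) (i := jc) hcurve hv hi
  refine h3.unique ?_
  have h4 : HasDerivAt (fun t : ℝ => Φ (t, chartAt E (π i) x₀))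
      (fderiv ℝ Φ (0, chartAt E (π i) x₀) (1, 0)) 0 := by
    have h5 : HasDerivAt (fun t : ℝ => (t, chartAt E (π i) x₀)) ((1 : ℝ), (0 : E)) 0 :=
      (hasDerivAt_id (0 : ℝ)).prodMk (hasDerivAt_const 0 _)
    exact (hsm.differentiableAt (by simp)).hasFDerivAt.comp_hasDerivAt (0 : ℝ) h5
  refine (h4.prodMk h1).congr_of_eventuallyEq ?_
  filter_upwards [hev] with t ht
  rw [FibreCore.chartAt_apply]
  refine Prod.ext ?_ ht.2.2
  simp only [hΦ, (chartAt E (π i)).left_inv hxi]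
  rfl

end Families

end

noncomputable section

/-! ### Realization of jets and their variations by affine families. -/

section JetFamily

variable {E G M Y : Type*} [NormedAddCommGroup E] [NormedSpace ℝ E] [NormedAddCommGroup G]
  [NormedSpace ℝ G] [TopologicalSpace M] [ChartedSpace E M] [IsManifold 𝓘(ℝ, E) ∞ M]
  [TopologicalSpace Y] [ChartedSpace (E × G) Y] [IsManifold 𝓘(ℝ, E × G) ∞ Y]
  (π : Y → M) [IsFibred E G π]

/-- Affine families of local functions. -/
def affineFamily (u₀ : E) (c : G) (A : E →L[ℝ] G) (w : G × (E →L[ℝ] G)) (z : ℝ × E) : G :=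
  c + A (z.2 - u₀) + z.1 • (w.1 + w.2 (z.2 - u₀))

theorem contDiff_affineFamily (u₀ : E) (c : G) (A : E →L[ℝ] G) (w : G × (E →L[ℝ] G)) :
    ContDiff ℝ ∞ (affineFamily u₀ c A w) := by
  unfold affineFamily
  fun_prop

theorem fderiv_affineFamily (u₀ : E) (c : G) (A : E →L[ℝ] G) (w : G × (E →L[ℝ] G)) (u : E) :
    fderiv ℝ (affineFamily u₀ c A w) (0, u) (1, 0) = w.1 + w.2 (u - u₀) := by
  have h := ((contDiff_affineFamily u₀ c A w).differentiable (by simp) (0, u)).hasFDerivAt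
  have h5 : HasDerivAt (fun t : ℝ => (t, u)) ((1 : ℝ), (0 : E)) 0 :=
    (hasDerivAt_id (0 : ℝ)).prodMk (hasDerivAt_const 0 _)
  refine (h.comp_hasDerivAt (0 : ℝ) h5).unique ?_
  have h6 : HasDerivAt (fun t : ℝ => c + A (u - u₀) + t • (w.1 + w.2 (u - u₀)))
      ((1 : ℝ) • (w.1 + w.2 (u - u₀))) 0 :=
    ((hasDerivAt_id (0 : ℝ)).smul_const _).const_add _
  rw [one_smul] at h6
  exact h6

/-- A family of local sections with a given jet and a given variation of the jet. -/
def jetFamily (j : Jet E G π) (w : G × (E →L[ℝ] G)) (z : ℝ × M) : Y :=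
  (chartAt (E × G) j.base).symm (chartAt E (π j.base) z.2,
    affineFamily (chartAt E (π j.base) (π j.base)) (chartAt (E × G) j.base j.base).2 j.fib w
      (z.1, chartAt E (π j.base) z.2))

variable (j : Jet E G π) (w : G × (E →L[ℝ] G))

/-- This is where the affine family starts: its central point lies in the target of the chart, so
nearby points do too, and the family is smooth and consists of sections there. -/
theorem jetFamily_coord_center : (chartAt E (π j.base) (π j.base),
    affineFamily (chartAt E (π j.base) (π j.base)) (chartAt (E × G) j.base j.base).2 j.fib w
      (0, chartAt E (π j.base) (π j.base))) = chartAt (E × G) j.base j.base := by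
  refine Prod.ext ?_ ?_
  · exact (IsFibred.fst_chart (E := E) (G := G) (π := π) _ _ (mem_chart_source _ _)).symm
  · simp [affineFamily]

theorem jetFamily_zero : jetFamily π j w (0, π j.base) = j.base := by
  unfold jetFamily
  rw [jetFamily_coord_center]
  exact (chartAt (E × G) j.base).left_inv (mem_chart_source _ _)

theorem contMDiffAt_jetFamily : ContMDiffAt (𝓘(ℝ, ℝ).prod 𝓘(ℝ, E)) 𝓘(ℝ, E × G) ∞
    (jetFamily π j w) (0, π j.base) := by
  have h1 : ContMDiffAt (𝓘(ℝ, ℝ).prod 𝓘(ℝ, E)) 𝓘(ℝ, E) ∞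
      (fun z : ℝ × M => chartAt E (π j.base) z.2) (0, π j.base) :=
    ContMDiffAt.comp (g := chartAt E (π j.base)) (f := Prod.snd) (0, π j.base)
      (contMDiffAt_chartAt (mem_chart_source _ _)) contMDiffAt_snd
  have h2 : ContMDiffAt (𝓘(ℝ, ℝ).prod 𝓘(ℝ, E)) 𝓘(ℝ, ℝ × E) ∞
      (fun z : ℝ × M => (z.1, chartAt E (π j.base) z.2)) (0, π j.base) := by
    rw [modelWithCornersSelf_prod, ← chartedSpaceSelf_prod]
    exact contMDiffAt_fst.prodMk h1
  have h3 : ContDiff ℝ ∞ (fun z : ℝ × E => (z.2,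
      affineFamily (chartAt E (π j.base) (π j.base)) (chartAt (E × G) j.base j.base).2 j.fib w
        z)) := contDiff_snd.prodMk (contDiff_affineFamily _ _ _ _)
  refine ContMDiffAt.comp (g := (chartAt (E × G) j.base).symm) (0, π j.base) ?_
    (ContMDiffAt.comp (0, π j.base) h3.contDiffAt.contMDiffAt h2)
  apply contMDiffAt_chartAt_symm
  rw [jetFamily_coord_center]
  exact mem_chart_target _ _

theorem eventually_jetFamily : ∀ᶠ z in 𝓝 ((0 : ℝ), chartAt E (π j.base) (π j.base)),
    z.2 ∈ (chartAt E (π j.base)).target ∧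
    (z.2, affineFamily (chartAt E (π j.base) (π j.base)) (chartAt (E × G) j.base j.base).2 j.fib w
      z) ∈ (chartAt (E × G) j.base).target := by
  have h1 : ContinuousAt (fun z : ℝ × E => (z.2,
      affineFamily (chartAt E (π j.base) (π j.base)) (chartAt (E × G) j.base j.base).2 j.fib w
        z)) (0, chartAt E (π j.base) (π j.base)) :=
    (continuous_snd.prodMk (contDiff_affineFamily _ _ _ _).continuous).continuousAt
  have h2 := h1.eventually_mem ((chartAt (E × G) j.base).open_target.mem_nhds (by
    rw [jetFamily_coord_center]; exact mem_chart_target _ _))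
  have h3 : ∀ᶠ z in 𝓝 ((0 : ℝ), chartAt E (π j.base) (π j.base)),
      z.2 ∈ (chartAt E (π j.base)).target := continuous_snd.continuousAt.eventually_mem
    ((chartAt E (π j.base)).open_target.mem_nhds (mem_chart_target _ _))
  exact h3.and h2

theorem proj_jetFamily : ∀ᶠ z in 𝓝 ((0 : ℝ), π j.base), π (jetFamily π j w z) = z.2 := by
  have hc : Filter.Tendsto (fun z : ℝ × M => (z.1, chartAt E (π j.base) z.2))
      (𝓝 (0, π j.base)) (𝓝 (0, chartAt E (π j.base) (π j.base))) := by
    refine ContinuousAt.prodMk continuousAt_fst ?_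
    exact ContinuousAt.comp (g := chartAt E (π j.base))
      ((chartAt E (π j.base)).continuousAt (mem_chart_source _ _)) continuousAt_snd
  have hs : ∀ᶠ z in 𝓝 ((0 : ℝ), π j.base), z.2 ∈ (chartAt E (π j.base)).source :=
    continuous_snd.continuousAt.eventually_mem
      ((chartAt E (π j.base)).open_source.mem_nhds (mem_chart_source _ _))
  filter_upwards [hc.eventually (eventually_jetFamily π j w), hs] with z hz hz'
  unfold jetFamily
  rw [proj_chart_symm π hz.2, (chartAt E (π j.base)).left_inv hz']

theorem jetFamily_coord : (fun z : ℝ × E => (chartAt (E × G) j.base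
      (jetFamily π j w (z.1, (chartAt E (π j.base)).symm z.2))).2) =ᶠ[
      𝓝 ((0 : ℝ), chartAt E (π j.base) (π j.base))]
    affineFamily (chartAt E (π j.base) (π j.base)) (chartAt (E × G) j.base j.base).2 j.fib w := by
  filter_upwards [eventually_jetFamily π j w] with z hz
  unfold jetFamily
  simp only [(chartAt E (π j.base)).right_inv hz.1, Prod.mk.eta]
  rw [(chartAt (E × G) j.base).right_inv hz.2]

/-- At time `0` the family is affine in the chart at `j.base`, with value the point `j.base` and
slope `j.fib`. -/
theorem jetOf_jetFamily : jetOf E G π (fun x => jetFamily π j w (0, x)) (π j.base) = j := by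
  have hz := jetFamily_zero π j w
  have h0 := (eventually_mdifferentiableAt_slice π (contMDiffAt_jetFamily π j w)
    (proj_jetFamily π j w)).self_of_nhds
  have hs : (fun x => jetFamily π j w (0, x)) (π j.base) ∈ (chartAt (E × G) j.base).source := by
    simp only [hz]; exact mem_chart_source _ _
  refine (jetCore E G π).ext_coord (i := j.base) hz hs ?_
  rw [(jetCore E G π).coord_base]
  refine (hasFDerivAt_jet_coord (π := π) h0.2.1 h0.2.2.2 hs).unique ?_
  have hc : Filter.Tendsto (fun u : E => ((0 : ℝ), u)) (𝓝 (chartAt E (π j.base) (π j.base)))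
      (𝓝 (0, chartAt E (π j.base) (π j.base))) := (Continuous.prodMk_right 0).tendsto _
  have h1 : HasFDerivAt (fun u => (chartAt (E × G) j.base j.base).2 +
      j.fib (u - chartAt E (π j.base) (π j.base))) j.fib (chartAt E (π j.base) (π j.base)) :=
    (j.fib.hasFDerivAt.comp _ ((hasFDerivAt_id _).sub_const _)).const_add _
  refine h1.congr_of_eventuallyEq ?_
  filter_upwards [hc.eventually (jetFamily_coord π j w)] with u hu
  simpa [affineFamily] using hu

/-- In coordinates the time derivative is the affine function with value `w.1` and slope `w.2`; by
`exists_variation_coord` these are the components of the velocity of the jets. -/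
theorem vel_jetFamily : vel E (G × (E →L[ℝ] G))
    (fun t => jetOf E G π (fun x => jetFamily π j w (t, x)) (π j.base)) 0 = w := by
  have hz := jetFamily_zero π j w
  have hs : jetFamily π j w (0, π j.base) ∈ (chartAt (E × G) j.base).source := by
    rw [hz]; exact mem_chart_source _ _
  obtain ⟨v', h1, h2⟩ := exists_variation_coord π (contMDiffAt_jetFamily π j w)
    (proj_jetFamily π j w) hs j rfl
  rw [jetOf_jetFamily, fibreBlock_tcc_self (mem_chart_source _ _)] at h2
  rw [h2]
  have h3 := (jetFamily_coord π j w).fderiv (𝕜 := ℝ)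
  have hc : Filter.Tendsto (fun u : E => ((0 : ℝ), u)) (𝓝 (chartAt E (π j.base) (π j.base)))
      (𝓝 (0, chartAt E (π j.base) (π j.base))) := (Continuous.prodMk_right 0).tendsto _
  refine Prod.ext ?_ ?_
  · rw [h3.self_of_nhds, fderiv_affineFamily]
    simp
  · refine h1.unique ?_
    have h4 : HasFDerivAt (fun u => w.1 + w.2 (u - chartAt E (π j.base) (π j.base))) w.2
        (chartAt E (π j.base) (π j.base)) :=
      (w.2.hasFDerivAt.comp _ ((hasFDerivAt_id _).sub_const _)).const_add _
    refine h4.congr_of_eventuallyEq ?_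
    filter_upwards [hc.eventually h3] with u hu
    rw [hu, fderiv_affineFamily]

end JetFamily

/-! ### Exterior derivative of the pairing of momenta with variations. -/

section Phase

theorem hasFDerivAt_pairing_snd {E F B : Type*} [NormedAddCommGroup E] [NormedSpace ℝ E]
    [NormedAddCommGroup F] [NormedSpace ℝ F] [NormedAddCommGroup B] [NormedSpace ℝ B]
    {f : E → F × (F →L[ℝ] B)} {v : E → F} {f' : E →L[ℝ] F × (F →L[ℝ] B)}
    {v' : E →L[ℝ] F} {u : E} (hf : HasFDerivAt f f' u) (hv : HasFDerivAt v v' u) :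
    HasFDerivAt (fun u => (f u).2 (v u))
      ((ContinuousLinearMap.snd ℝ F (F →L[ℝ] B) ∘L f').flip (v u) + (f u).2 ∘L v') u :=
  hasFDerivAt_pairing ((ContinuousLinearMap.snd ℝ F (F →L[ℝ] B)).hasFDerivAt.comp u hf) hv

variable {E F M Q : Type*} [NormedAddCommGroup E] [NormedSpace ℝ E] [NormedAddCommGroup F]
  [NormedSpace ℝ F] [TopologicalSpace M] [ChartedSpace E M] [IsManifold 𝓘(ℝ, E) ∞ M]
  [TopologicalSpace Q] [ChartedSpace (E × F) Q] [IsManifold 𝓘(ℝ, E × F) ∞ Q]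
  {d : ℕ} (π : Q → M) [IsFibred E F π]

/-- The exterior derivative of the pairing of a section of the phase bundle with a variation,
in an arbitrary chart. -/
theorem exists_hasFDerivAt_phase_pairing {x₀ : M} {p : M → Phase E F d π} {σ : ℝ × M → Q}
    (hp : MDifferentiableAt 𝓘(ℝ, E) 𝓘(ℝ, E × (F × Mom E F d)) p x₀)
    (hσ : ContMDiffAt (𝓘(ℝ, ℝ).prod 𝓘(ℝ, E)) 𝓘(ℝ, E × F) ∞ σ (0, x₀))
    (hπ : ∀ᶠ z in 𝓝 ((0 : ℝ), x₀), π (σ z) = z.2)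
    (hb : ∀ᶠ x in 𝓝 x₀, (p x).base = σ (0, x)) {k : M} (Pc : Phase E F d π) (jc : Jet E F π)
    (hi : σ (0, x₀) ∈ (chartAt (E × F) Pc.base).source) (hj : jc.base = Pc.base)
    (hk : π Pc.base = k) :
    ∃ A : E →L[ℝ] Forms E d, HasFDerivAt (fun u => pullForm d
        (tangentCoordChange 𝓘(ℝ, E) k ((chartAt E k).symm u) ((chartAt E k).symm u))
        ((p ((chartAt E k).symm u)).fib (vel E F (fun t => σ (t, (chartAt E k).symm u)) 0)))
        A (chartAt E k x₀) ∧
      altForm E d A = psiLin F (altForm E d)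
        ((dualCore E F d π).coord Pc.base (p x₀), ContinuousLinearMap.snd ℝ F (Mom E F d) ∘L
          (jetCore E (F × Mom E F d) (dualProj E F d π)).coord Pc
            (jetOf E (F × Mom E F d) (dualProj E F d π) p x₀))
        (fibreBlock (tcc E (JetVert E F) (jetOf E F π (fun x => σ (0, x)) x₀) jc
          (jetOf E F π (fun x => σ (0, x)) x₀))
          (vel E (JetVert E F) (fun t => jetOf E F π (fun x => σ (t, x)) x₀) 0)) := by
  subst hk
  set i := Pc.base with hidef
  have hx : π (σ (0, x₀)) = x₀ := hπ.self_of_nhds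
  have hxi := IsFibred.mem_source (E := E) (G := F) (π := π) i _ hi
  rw [hx] at hxi
  have htend := tendsto_chart_symm (E := E) hxi
  set κ := chartAt E (π i) with hκ
  set Φ := fun z : ℝ × E => (chartAt (E × F) i (σ (z.1, κ.symm z.2))).2 with hΦ
  have hinv : κ.symm (κ x₀) = x₀ := κ.left_inv hxi
  have hsm : ContDiffAt ℝ ∞ Φ (0, κ x₀) := contDiffAt_family_coord π hσ hπ hi
  obtain ⟨v', hv, hvar⟩ := exists_variation_coord π hσ hπ hi jc hj
  have hpπ : ∀ᶠ x in 𝓝 x₀, dualProj E F d π (p x) = x := by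
    have hc : Filter.Tendsto (fun x => ((0 : ℝ), x)) (𝓝 x₀) (𝓝 (0, x₀)) :=
      (Continuous.prodMk_right (0 : ℝ)).tendsto x₀
    filter_upwards [hb, hc.eventually hπ] with x h1 h2
    exact (congrArg π h1).trans h2
  have hpi : p x₀ ∈ (chartAt (E × (F × Mom E F d)) Pc).source := by
    rw [FibreCore.mem_chartAt_source, hb.self_of_nhds]
    exact hi
  have hjet := hasFDerivAt_jet_coord (π := dualProj E F d π) hp hpπ hpi
  have hprod := hasFDerivAt_pairing_snd hjet hv
  refine ⟨_, hprod.congr_of_eventuallyEq ?_, ?_⟩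
  · have hc : Filter.Tendsto (fun x => ((0 : ℝ), x)) (𝓝 x₀) (𝓝 (0, x₀)) :=
      (Continuous.prodMk_right (0 : ℝ)).tendsto x₀
    have hcE : Filter.Tendsto (fun u => ((0 : ℝ), u)) (𝓝 (κ x₀)) (𝓝 (0, κ x₀)) :=
      (Continuous.prodMk_right (0 : ℝ)).tendsto _
    have hslice := eventually_mdifferentiableAt_slice π hσ hπ
    have hsrc : ∀ᶠ z in 𝓝 ((0 : ℝ), x₀), σ z ∈ (chartAt (E × F) i).source :=
      hσ.continuousAt.eventually_mem ((chartAt (E × F) i).open_source.mem_nhds hi)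
    have hdiff := hcE.eventually ((hsm.of_le (m := 1) (by simp)).eventually (by simp))
    filter_upwards [htend.eventually (hc.eventually hslice), htend.eventually (hc.eventually hsrc),
      htend.eventually hb, htend.eventually (hc.eventually hπ), hdiff] with u h1 h2 h3 h4 h5
    set x := κ.symm u with hxdef
    -- At points other than `x₀` the momentum and the variation are given in charts that move with
    -- the point. Their pairing is rewritten in the fixed chart at `Pc.base`, where the product rule
    -- applies.
    have h6 := dual_coord_apply π (p x) (i := i) (by rw [h3]; exact h2)
      (vel E F (fun t => σ (t, x)) 0)
    have h7 := hasDerivAt_snd_chart (π := π) (i := i) h1.1 (by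
      filter_upwards [h1.2.2.1] with t ht
      exact ht.trans h4.symm) h2
    have h8 : HasDerivAt (fun t : ℝ => (t, u)) ((1 : ℝ), (0 : E)) 0 :=
      (hasDerivAt_id (0 : ℝ)).prodMk (hasDerivAt_const 0 _)
    have h9 := (h5.differentiableAt (by simp)).hasFDerivAt.comp_hasDerivAt (0 : ℝ) h8
    have h10 := h7.unique h9
    rw [h3, h4] at h6
    refine h6.symm.trans ?_
    exact congrArg ((dualCore E F d π).coord i (p x)) h10
  · rw [hvar, psiLin_apply]
    have hc0 : ((chartAt (E × (F × Mom E F d)) Pc) (p ((chartAt E (dualProj E F d π Pc)).symm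
        (chartAt E (dualProj E F d π Pc) x₀)))).2.2 =
        (dualCore E F d π).coord Pc.base (p x₀) := by
      rw [FibreCore.chartAt_apply]
      exact congrArg ((dualCore E F d π).coord Pc.base) (congrArg p hinv)
    rw [← hc0]
    rfl

end Phase

end

noncomputable section

/-! ### The canonical map in coordinates -/

section ExtDeriv

variable {E M : Type*} [NormedAddCommGroup E] [NormedSpace ℝ E] [TopologicalSpace M]
  [ChartedSpace E M] [IsManifold 𝓘(ℝ, E) ∞ M]

/-- The expression in the chart at `k` of a form given in the preferred charts. -/
def formInChart {n : ℕ} (α : M → Forms E n) (k : M) (u : E) : Forms E n :=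
  pullForm n (tangentCoordChange 𝓘(ℝ, E) k ((chartAt E k).symm u) ((chartAt E k).symm u))
    (α ((chartAt E k).symm u))

/-- Naturality of the exterior derivative under changes of charts. -/
theorem extDeriv_formInChart {n : ℕ} (α : M → Forms E n) {x k : M} (hk : x ∈ (chartAt E k).source)
    (h : DifferentiableAt ℝ (formInChart α x) (chartAt E x x)) :
    extDeriv (formInChart α k) (chartAt E k x) =
      pullForm (n + 1) (tangentCoordChange 𝓘(ℝ, E) k x x)
        (extDeriv (formInChart α x) (chartAt E x x)) := by
  have hx := mem_chart_source E x
  set τ := chartAt E x ∘ (chartAt E k).symm with hτ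
  have hτx : τ (chartAt E k x) = chartAt E x x := by simp [hτ, hk]
  have hd := hasFDerivAt_chart_change (W := E) hk hx
  have h1 := extDeriv_pullback (𝕜 := ℝ) (r := ∞) (x := chartAt E k x) (f := τ)
    (show DifferentiableAt ℝ (formInChart α x) (τ (chartAt E k x)) by rwa [hτx]) (contDiffAt_chart_change (W := E) hk hx)
    (by simp only [minSmoothness_of_isRCLikeNormedField]; 
        exact WithTop.coe_le_coe.2 (le_top : (2 : ℕ∞) ≤ ⊤))
  rw [hd.fderiv, hτx] at h1
  refine Eq.trans (Filter.EventuallyEq.extDeriv_eq ?_) h1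
  -- Near the point, the expression in the chart at `k` is the pullback of the expression in the
  -- chart at `x` by the transition map.
  filter_upwards [eventually_mem_chart_overlap k x hk hx] with u hu
  have hs := (chartAt E k).map_target hu.1
  have hd' := hasFDerivAt_chart_change (W := E) hs hu.2
  rw [(chartAt E k).right_inv hu.1] at hd'
  rw [hd'.fderiv]
  ext v
  simp only [formInChart, hτ, Function.comp_apply, (chartAt E x).left_inv hu.2,
    ContinuousAlternatingMap.compContinuousLinearMapCLM_apply,
    ContinuousAlternatingMap.compContinuousLinearMap_apply]
  congr 1
  funext m
  exact (tangentCoordChange_comp (by simp [hs, hu.2])).symm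

end ExtDeriv

theorem hasFDerivAt_fst_comp {E F K : Type*} [NormedAddCommGroup E] [NormedSpace ℝ E]
    [NormedAddCommGroup F] [NormedSpace ℝ F] [NormedAddCommGroup K] [NormedSpace ℝ K]
    {f : E → F × K} {f' : E →L[ℝ] F × K} {u : E} (hf : HasFDerivAt f f' u) :
    HasFDerivAt (fun u => (f u).1) (ContinuousLinearMap.fst ℝ F K ∘L f') u :=
  (ContinuousLinearMap.fst ℝ F K).hasFDerivAt.comp u hf

section Psi

variable {E F M Q : Type*} [NormedAddCommGroup E] [NormedSpace ℝ E] [NormedAddCommGroup F]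
  [NormedSpace ℝ F] [FiniteDimensional ℝ E] [FiniteDimensional ℝ F]
  [TopologicalSpace M] [ChartedSpace E M] [IsManifold 𝓘(ℝ, E) ∞ M]
  [TopologicalSpace Q] [ChartedSpace (E × F) Q] [IsManifold 𝓘(ℝ, E × F) ∞ Q]
  {d : ℕ} (π : Q → M) [IsFibred E F π]

theorem jetFamily_zero_time {G Y : Type*} [NormedAddCommGroup G] [NormedSpace ℝ G]
    [TopologicalSpace Y] [ChartedSpace (E × G) Y] [IsManifold 𝓘(ℝ, E × G) ∞ Y] (π : Y → M)
    [IsFibred E G π] (j : Jet E G π) (w : G × (E →L[ℝ] G)) (x : M) :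
    jetFamily π j w (0, x) = (chartAt (E × G) j.base).symm (chartAt E (π j.base) x,
      (chartAt (E × G) j.base j.base).2 +
        j.fib (chartAt E (π j.base) x - chartAt E (π j.base) (π j.base))) := by
  simp [jetFamily, affineFamily]

/-- At time `0` the affine family does not depend on the prescribed variation, and the chart of `P`
at `ζ.base` lies over the chart of `Q`. So a section with jet `ζ` can be combined with an arbitrary
variation of the underlying section of `Q`. -/
theorem base_jetFamily (ζ : JetPhase E F d π) (w : JetPhaseVert E F d) (w' : JetVert E F) (x : M) :
    (jetFamily (dualProj E F d π) ζ w (0, x)).base =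
      jetFamily π (jetPi E F d π ζ) w' (0, x) := by
  rw [jetFamily_zero_time, jetFamily_zero_time]
  rfl

/-- The exterior derivative is the alternation of the derivative of the pairing, which the product
rule turns into `p' v + p v'`. In the charts at `p x₀` and at the jet itself all coordinate changes
are the identity, and the defining formula of `Psi` remains. -/
theorem Psi_canonical {x₀ : M} {p : M → Phase E F d π} {σ : ℝ × M → Q}
    (hp : ContMDiffAt 𝓘(ℝ, E) 𝓘(ℝ, E × (F × Mom E F d)) ∞ p x₀)
    (hσ : ContMDiffAt (𝓘(ℝ, ℝ).prod 𝓘(ℝ, E)) 𝓘(ℝ, E × F) ∞ σ (0, x₀))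
    (hπ : ∀ᶠ z in 𝓝 ((0 : ℝ), x₀), π (σ z) = z.2)
    (hb : ∀ᶠ x in 𝓝 x₀, (p x).base = σ (0, x)) :
    (Psi E F d π (jetOf E (F × Mom E F d) (dualProj E F d π) p x₀)).fib
        (vel E (JetVert E F) (fun t => jetOf E F π (fun x => σ (t, x)) x₀) 0) =
      extDerivAt E (fun x => (p x).fib (vel E F (fun t => σ (t, x)) 0)) x₀ := by
  have hb0 : (p x₀).base = σ (0, x₀) := hb.self_of_nhds
  have hx : π (p x₀).base = x₀ := by rw [hb0]; exact hπ.self_of_nhds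
  obtain ⟨A, hA, hA'⟩ := exists_hasFDerivAt_phase_pairing π (hp.mdifferentiableAt (by simp)) hσ hπ
    hb (p x₀) (jetOf E F π (fun x => σ (0, x)) x₀) (by rw [hb0]; exact mem_chart_source _ _)
    hb0.symm hx
  have e1 : extDerivAt E (fun x => (p x).fib (vel E F (fun t => σ (t, x)) 0)) x₀ =
      altForm E d A := congrArg (altForm E d) hA.fderiv
  rw [e1, hA', fibreBlock_tcc_self (mem_chart_source _ _), Psi_fib]
  rw [(dualCore E F d π).coord_base (p x₀)]
  have e2 := (jetCore E (F × Mom E F d) (dualProj E F d π)).coord_base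
    (jetOf E (F × Mom E F d) (dualProj E F d π) p x₀)
  change (jetCore E (F × Mom E F d) (dualProj E F d π)).coord (p x₀) _ = _ at e2
  rw [e2]
  rfl

/-- The formula for `Psi` is posited only in the chart at the point itself. Its validity in nearby
charts follows from naturality of the exterior derivative of the pairing, so no second derivatives
of transition maps have to be computed. -/
theorem coord_Psi (ζ : JetPhase E F d π) (Pc : Phase E F d π) (jc : Jet E F π)
    (hj : jc.base = Pc.base) (h : ζ.base.base ∈ (chartAt (E × F) Pc.base).source) :
    (dualCore E (JetVert E F) (d + 1) (jetProj E F π)).coord jc (Psi E F d π ζ) =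
      psiLin F (altForm E d) ((dualCore E F d π).coord Pc.base ζ.base,
        ContinuousLinearMap.snd ℝ F (Mom E F d) ∘L
          (jetCore E (F × Mom E F d) (dualProj E F d π)).coord Pc ζ) := by
  refine dual_coord_eq (jetProj E F π) (Psi E F d π ζ) (i := jc)
    (show ζ.base.base ∈ (chartAt (E × F) jc.base).source by rwa [hj]) fun w => ?_
  -- Realize `ζ` as the jet of a section `p` and `w` as the variation of a family `σ` starting under
  -- `p`.
  set x₀ := π ζ.base.base with hx₀
  set p : M → Phase E F d π := fun x => jetFamily (dualProj E F d π) ζ 0 (0, x) with hpdef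
  set σ : ℝ × M → Q := jetFamily π (jetPi E F d π ζ) w with hσdef
  have hσ : ContMDiffAt (𝓘(ℝ, ℝ).prod 𝓘(ℝ, E)) 𝓘(ℝ, E × F) ∞ σ (0, x₀) :=
    contMDiffAt_jetFamily π (jetPi E F d π ζ) w
  have hπ : ∀ᶠ z in 𝓝 ((0 : ℝ), x₀), π (σ z) = z.2 := proj_jetFamily π (jetPi E F d π ζ) w
  have hp : MDifferentiableAt 𝓘(ℝ, E) 𝓘(ℝ, E × (F × Mom E F d)) p x₀ :=
    (eventually_mdifferentiableAt_slice (dualProj E F d π)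
      (contMDiffAt_jetFamily (dualProj E F d π) ζ 0)
      (proj_jetFamily (dualProj E F d π) ζ 0)).self_of_nhds.2.1
  have hb : ∀ᶠ x in 𝓝 x₀, (p x).base = σ (0, x) := Filter.Eventually.of_forall fun x =>
    base_jetFamily π ζ 0 w x
  have hjp : jetOf E (F × Mom E F d) (dualProj E F d π) p x₀ = ζ :=
    jetOf_jetFamily (dualProj E F d π) ζ 0
  have hjσ : jetOf E F π (fun x => σ (0, x)) x₀ = jetPi E F d π ζ :=
    jetOf_jetFamily π (jetPi E F d π ζ) w
  have hvel : vel E (JetVert E F) (fun t => jetOf E F π (fun x => σ (t, x)) x₀) 0 = w :=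
    vel_jetFamily π (jetPi E F d π ζ) w
  have hσ0 : σ (0, x₀) = ζ.base.base := jetFamily_zero π (jetPi E F d π ζ) w
  have hp0 : p x₀ = ζ.base := jetFamily_zero (dualProj E F d π) ζ 0
  -- The derivative of one and the same pairing, first in the chart at `Pc` and then in the chart at
  -- `ζ.base`; comparing the two gives the transformation law.
  obtain ⟨A, hA, hA'⟩ := exists_hasFDerivAt_phase_pairing π hp hσ hπ hb Pc jc
    (by rwa [hσ0]) hj rfl
  obtain ⟨B, hB, hB'⟩ := exists_hasFDerivAt_phase_pairing π hp hσ hπ hb ζ.base (jetPi E F d π ζ)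
    (by rw [hσ0]; exact mem_chart_source _ _) rfl rfl
  have hxk : x₀ ∈ (chartAt E (π Pc.base)).source :=
    IsFibred.mem_source (E := E) (G := F) (π := π) _ _ h
  have key := extDeriv_formInChart (fun x => (p x).fib (vel E F (fun t => σ (t, x)) 0)) hxk
    hB.differentiableAt
  have e1 : extDeriv (formInChart (fun x => (p x).fib (vel E F (fun t => σ (t, x)) 0))
      (π Pc.base)) (chartAt E (π Pc.base) x₀) = altForm E d A := congrArg (altForm E d) hA.fderiv
  have e2 : extDeriv (formInChart (fun x => (p x).fib (vel E F (fun t => σ (t, x)) 0)) x₀)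
      (chartAt E x₀ x₀) = altForm E d B := congrArg (altForm E d) hB.fderiv
  rw [e1, e2, hA', hB', hjp, hjσ, hvel, hp0, fibreBlock_tcc_self (mem_chart_source _ _)] at key
  rw [(dualCore E F d π).coord_base ζ.base,
    (jetCore E (F × Mom E F d) (dualProj E F d π)).coord_base ζ] at key
  rw [Psi_fib]
  have e3 : π jc.base = π Pc.base := by rw [hj]
  change _ = pullForm (d + 1) (tangentCoordChange 𝓘(ℝ, E) (π jc.base) x₀ x₀) _
  rw [e3]
  exact key

/-- The jet prolongation of the projection of the phase bundle, in coordinates. -/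
theorem coord_jetPi (ζ : JetPhase E F d π) (Pc : Phase E F d π)
    (h : ζ.base.base ∈ (chartAt (E × F) Pc.base).source) :
    (jetCore E F π).coord Pc.base (jetPi E F d π ζ) = ContinuousLinearMap.fst ℝ F (Mom E F d) ∘L
      (jetCore E (F × Mom E F d) (dualProj E F d π)).coord Pc ζ := by
  set x₀ := π ζ.base.base with hx₀
  set p : M → Phase E F d π := fun x => jetFamily (dualProj E F d π) ζ 0 (0, x) with hpdef
  set s : M → Q := fun x => jetFamily π (jetPi E F d π ζ) 0 (0, x) with hsdef
  have hslice := (eventually_mdifferentiableAt_slice (dualProj E F d π)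
      (contMDiffAt_jetFamily (dualProj E F d π) ζ 0)
      (proj_jetFamily (dualProj E F d π) ζ 0)).self_of_nhds
  have hslice' := (eventually_mdifferentiableAt_slice π
      (contMDiffAt_jetFamily π (jetPi E F d π ζ) 0)
      (proj_jetFamily π (jetPi E F d π ζ) 0)).self_of_nhds
  have hb : ∀ x, (p x).base = s x := fun x =>
    base_jetFamily π ζ 0 0 x
  have hjp : jetOf E (F × Mom E F d) (dualProj E F d π) p x₀ = ζ :=
    jetOf_jetFamily (dualProj E F d π) ζ 0
  have hjs : jetOf E F π s x₀ = jetPi E F d π ζ := jetOf_jetFamily π (jetPi E F d π ζ) 0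
  have hp0 : p x₀ = ζ.base := jetFamily_zero (dualProj E F d π) ζ 0
  have hs0 : s x₀ = ζ.base.base := jetFamily_zero π (jetPi E F d π ζ) 0
  have h1 := hasFDerivAt_jet_coord (π := dualProj E F d π) (i := Pc) hslice.2.1 hslice.2.2.2
    (show p x₀ ∈ _ by rw [hp0]; exact h)
  have h2 := hasFDerivAt_jet_coord (π := π) (i := Pc.base) hslice'.2.1 hslice'.2.2.2
    (show s x₀ ∈ _ by rw [hs0]; exact h)
  change HasFDerivAt _ ((jetCore E (F × Mom E F d) (dualProj E F d π)).coord Pc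
    (jetOf E (F × Mom E F d) (dualProj E F d π) p x₀)) _ at h1
  change HasFDerivAt _ ((jetCore E F π).coord Pc.base (jetOf E F π s x₀)) _ at h2
  rw [hjp] at h1
  rw [hjs] at h2
  have h3 := hasFDerivAt_fst_comp h1
  refine h2.unique (h3.congr_of_eventuallyEq (Filter.Eventually.of_forall fun u => ?_))
  exact congrArg (fun q => (chartAt (E × F) Pc.base q).2) (hb _).symm

end Psi

end

noncomputable section

/-! ### The unconstrained reduction -/

section Smooth

variable {E V W J K : Type*} [NormedAddCommGroup E] [NormedSpace ℝ E] [NormedAddCommGroup V]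
  [NormedSpace ℝ V] [NormedAddCommGroup W] [NormedSpace ℝ W] [NormedAddCommGroup J]
  [NormedSpace ℝ J] [NormedAddCommGroup K] [NormedSpace ℝ K]

theorem contDiff_fst_clm_snd (L : V →L[ℝ] W) :
    ContDiff ℝ ∞ (fun w : E × V => (w.1, L w.2)) :=
  contDiff_fst.prodMk (L.contDiff.comp contDiff_snd)

theorem contDiff_prod_affine (L : W →L[ℝ] J × (E →L[ℝ] K)) (w₀ : W) (p : J) (p' : E →L[ℝ] K)
    {F : Type*} [NormedAddCommGroup F] [NormedSpace ℝ F] :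
    ContDiff ℝ ∞ (fun w : E × ((F × (E →L[ℝ] F)) × W) => (w.1,
      ((w.2.1.1, p + (L (w.2.2 - w₀)).1),
        ContinuousLinearMap.inl ℝ F K ∘L w.2.1.2 +
          ContinuousLinearMap.inr ℝ F K ∘L (p' + (L (w.2.2 - w₀)).2)))) := by
  have h : ContDiff ℝ ∞ (fun w : E × ((F × (E →L[ℝ] F)) × W) => L (w.2.2 - w₀)) :=
    L.contDiff.comp (by fun_prop)
  refine contDiff_fst.prodMk (ContDiff.prodMk (ContDiff.prodMk (by fun_prop) ?_) ?_)
  · exact contDiff_const.add h.fst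
  · exact (contDiff_const.clm_comp (by fun_prop)).add
      (contDiff_const.clm_comp (contDiff_const.add h.snd))

/-- The coordinates of a jet with values in a product. -/
def jetProdCoord {F : Type*} [NormedAddCommGroup F] [NormedSpace ℝ F] (x : E) (φ : F)
    (A : E →L[ℝ] F) (X : K × (E →L[ℝ] K)) : E × ((F × K) × (E →L[ℝ] F × K)) :=
  (x, ((φ, X.1), A.prod X.2))

theorem contDiffAt_jetProdCoord {F : Type*} [NormedAddCommGroup F] [NormedSpace ℝ F]
    {X : ℝ → K × (E →L[ℝ] K)} {t : ℝ} (hX : ContDiffAt ℝ ∞ X t) (x : E) (φ : F)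
    (A : E →L[ℝ] F) : ContDiffAt ℝ ∞ (fun t => jetProdCoord x φ A (X t)) t := by
  refine contDiffAt_const.prodMk ((contDiffAt_const.prodMk hX.fst).prodMk ?_)
  have h : (fun t => A.prod (X t).2) = fun t =>
      ContinuousLinearMap.inl ℝ F K ∘L A + ContinuousLinearMap.inr ℝ F K ∘L (X t).2 := by
    funext t
    ext ξ <;> simp
  rw [h]
  exact contDiffAt_const.add (contDiffAt_const.clm_comp hX.snd)

end Smooth

/-! ### The linear model of `Ψ` on vertical coordinates. -/

section Linear

variable {E F B N : Type*} [NormedAddCommGroup E] [NormedSpace ℝ E]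
  [NormedAddCommGroup F] [NormedSpace ℝ F] [NormedAddCommGroup B] [NormedSpace ℝ B]
  [NormedAddCommGroup N] [NormedSpace ℝ N] (alt : (E →L[ℝ] B) →L[ℝ] N)

/-- The coordinate expression of the canonical map on vertical coordinates. -/
def psiVert : JetVert E (F × (F →L[ℝ] B)) →L[ℝ] JetVert E F × (JetVert E F →L[ℝ] N) :=
  ((ContinuousLinearMap.fst ℝ F (F →L[ℝ] B) ∘L ContinuousLinearMap.fst ℝ _ _).prod
    (ContinuousLinearMap.compL ℝ E (F × (F →L[ℝ] B)) F (ContinuousLinearMap.fst ℝ F (F →L[ℝ] B)) ∘L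
      ContinuousLinearMap.snd ℝ _ _)).prod
  (psiLin F alt ∘L
    (ContinuousLinearMap.snd ℝ F (F →L[ℝ] B) ∘L ContinuousLinearMap.fst ℝ _ _).prod
    (ContinuousLinearMap.compL ℝ E (F × (F →L[ℝ] B)) (F →L[ℝ] B)
      (ContinuousLinearMap.snd ℝ F (F →L[ℝ] B)) ∘L ContinuousLinearMap.snd ℝ _ _))

theorem psiVert_apply (X : JetVert E (F × (F →L[ℝ] B))) : psiVert alt X =
    ((X.1.1, ContinuousLinearMap.fst ℝ F (F →L[ℝ] B) ∘L X.2),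
      psiLin F alt (X.1.2, ContinuousLinearMap.snd ℝ F (F →L[ℝ] B) ∘L X.2)) := rfl

theorem contDiff_psiVert : ContDiff ℝ ∞ (fun w : E × JetVert E (F × (F →L[ℝ] B)) =>
    (w.1, psiVert alt w.2)) :=
  contDiff_fst_clm_snd (V := JetVert E (F × (F →L[ℝ] B)))
    (W := JetVert E F × (JetVert E F →L[ℝ] N)) (psiVert alt)

/-- Evaluating the covector part of `psiVert alt a` on the vector part of `psiVert alt b` is
`jetPairing` by unfolding. This is the statement that the presymplectic form is the pullback of the
canonical one. -/
theorem twoForm_pairing_psiVert (a b : JetVert E (F × (F →L[ℝ] B))) :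
    twoForm (pairing (JetVert E F) N) ![psiVert alt a, psiVert alt b] =
      twoForm (jetPairing E F alt) ![a, b] := by
  rw [twoForm_apply, twoForm_apply]
  rfl

/-- A right inverse of `psiVert` through a given point. -/
def psiVertSection (R : (JetVert E F →L[ℝ] N) →L[ℝ] JetVert E (F →L[ℝ] B))
    (X : JetVert E (F × (F →L[ℝ] B))) (y : JetVert E F × (JetVert E F →L[ℝ] N)) :
    JetVert E (F × (F →L[ℝ] B)) :=
  ((y.1.1, X.1.2 + (R (y.2 - (psiVert alt X).2)).1),
    ContinuousLinearMap.inl ℝ F (F →L[ℝ] B) ∘L y.1.2 + ContinuousLinearMap.inr ℝ F (F →L[ℝ] B) ∘L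
      (ContinuousLinearMap.snd ℝ F (F →L[ℝ] B) ∘L X.2 + (R (y.2 - (psiVert alt X).2)).2))

variable {R : (JetVert E F →L[ℝ] N) →L[ℝ] JetVert E (F →L[ℝ] B)}

theorem psiVert_psiVertSection (hR : ∀ η, psiLin F alt (R η) = η)
    (X : JetVert E (F × (F →L[ℝ] B))) (y : JetVert E F × (JetVert E F →L[ℝ] N)) :
    psiVert alt (psiVertSection alt R X y) = y := by
  rw [psiVert_apply]
  refine Prod.ext (Prod.ext rfl ?_) ?_
  · ext ξ
    simp [psiVertSection]
  · have h : ((psiVertSection alt R X y).1.2, ContinuousLinearMap.snd ℝ F (F →L[ℝ] B) ∘L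
        (psiVertSection alt R X y).2) = (X.1.2, ContinuousLinearMap.snd ℝ F (F →L[ℝ] B) ∘L X.2) +
        R (y.2 - (psiVert alt X).2) := by
      refine Prod.ext rfl ?_
      ext ξ
      simp [psiVertSection]
    simp only [h, map_add, hR, psiVert_apply]
    abel

theorem psiVertSection_psiVert (X : JetVert E (F × (F →L[ℝ] B))) :
    psiVertSection alt R X (psiVert alt X) = X := by
  unfold psiVertSection
  rw [sub_self, map_zero]
  refine Prod.ext (Prod.ext rfl ?_) ?_
  · simp
  · refine ContinuousLinearMap.ext fun ξ => Prod.ext ?_ ?_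
    · simp [psiVert_apply]
    · simp

theorem contDiff_psiVertSection (X : JetVert E (F × (F →L[ℝ] B))) :
    ContDiff ℝ ∞ (fun w : E × (JetVert E F × (JetVert E F →L[ℝ] N)) =>
      (w.1, psiVertSection alt R X w.2)) :=
by
  have h := contDiff_prod_affine (E := E) (W := JetVert E F →L[ℝ] N) (J := F →L[ℝ] B)
    (K := F →L[ℝ] B) (F := F) (L := R) (psiVert alt X).2 X.1.2
    (ContinuousLinearMap.snd ℝ F (F →L[ℝ] B) ∘L X.2)
  exact h

end Linear

section Vel

variable {E G H M Y Z : Type*} [NormedAddCommGroup E] [NormedSpace ℝ E]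
  [NormedAddCommGroup G] [NormedSpace ℝ G] [NormedAddCommGroup H] [NormedSpace ℝ H]
  [TopologicalSpace M] [ChartedSpace E M] [TopologicalSpace Y] [ChartedSpace (E × G) Y]
  [IsManifold 𝓘(ℝ, E × G) ∞ Y]
  [TopologicalSpace Z] [ChartedSpace (E × H) Z] [IsManifold 𝓘(ℝ, E × H) ∞ Z]
  {π : Y → M} [IsFibred E G π] {π' : Z → M} [IsFibred E H π']

/-- The velocities of vertical curves which are related in charts by a map `g`. -/
theorem fibreBlock_vel_of_charts {γ : ℝ → Y} {δ : ℝ → Z} {t : ℝ} {i : Y} {k : Z}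
    (hγ : MDifferentiableAt 𝓘(ℝ, ℝ) 𝓘(ℝ, E × G) γ t) (hv : ∀ᶠ t' in 𝓝 t, π (γ t') = π (γ t))
    (hδ : MDifferentiableAt 𝓘(ℝ, ℝ) 𝓘(ℝ, E × H) δ t) (hv' : ∀ᶠ t' in 𝓝 t, π' (δ t') = π' (δ t))
    (hi : γ t ∈ (chartAt (E × G) i).source) (hk : δ t ∈ (chartAt (E × H) k).source)
    {g : G → H} {g' : G →L[ℝ] H} (hg : HasFDerivAt g g' (chartAt (E × G) i (γ t)).2)
    (h : ∀ᶠ t' in 𝓝 t, (chartAt (E × H) k (δ t')).2 = g (chartAt (E × G) i (γ t')).2) :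
    fibreBlock (tcc E H (δ t) k (δ t)) (vel E H δ t) =
      g' (fibreBlock (tcc E G (γ t) i (γ t)) (vel E G γ t)) :=
  (hasDerivAt_snd_chart hδ hv' hk).unique
    ((hg.comp_hasDerivAt t (hasDerivAt_snd_chart hγ hv hi)).congr_of_eventuallyEq h)

end Vel

section Psi

variable {E F M Q : Type*} [NormedAddCommGroup E] [NormedSpace ℝ E] [NormedAddCommGroup F]
  [NormedSpace ℝ F] [FiniteDimensional ℝ E] [FiniteDimensional ℝ F]
  [TopologicalSpace M] [ChartedSpace E M] [IsManifold 𝓘(ℝ, E) ∞ M]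
  [TopologicalSpace Q] [ChartedSpace (E × F) Q] [IsManifold 𝓘(ℝ, E × F) ∞ Q]
  {d : ℕ} (π : Q → M) [IsFibred E F π]

/-- In the charts at `ζ₀` and at its image the map is one fixed linear map of the vertical
coordinates. Smoothness, velocities and local sections of `Ψ` are all deduced from this. -/
theorem chartAt_Psi (ζ₀ ζ : JetPhase E F d π)
    (h : ζ.base.base ∈ (chartAt (E × F) ζ₀.base.base).source) :
    chartAt (E × (JetVert E F × (JetVert E F →L[ℝ] Forms E (d + 1)))) (Psi E F d π ζ₀)
        (Psi E F d π ζ) =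
      ((chartAt (E × JetPhaseVert E F d) ζ₀ ζ).1,
        psiVert (altForm E d) (chartAt (E × JetPhaseVert E F d) ζ₀ ζ).2) := by
  have e₁ := coord_jetPi π ζ ζ₀.base h
  have e₂ := coord_Psi π ζ ζ₀.base (jetPi E F d π ζ₀) rfl h
  exact Prod.ext rfl (Prod.ext (Prod.ext rfl e₁) e₂)

theorem exists_eq_jetPhaseMk (ζ : JetPhase E F d π) :
    ∃ X, ζ = jetPhaseMk E F d π (jetPi E F d π ζ) X :=
  ⟨(ζ.base.fib, ContinuousLinearMap.snd ℝ F (Mom E F d) ∘L ζ.fib), rfl⟩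

theorem contMDiff_jetPhaseMk (j : Jet E F π) {X : ℝ → MomJet E F d}
    (hX : ContDiff ℝ ∞ X) : ContMDiff 𝓘(ℝ, ℝ) 𝓘(ℝ, E × JetPhaseVert E F d) ∞
      (fun t => jetPhaseMk E F d π j (X t)) := by
  intro t
  set q := j.base
  refine contMDiffAt_of_charts (W := E × JetPhaseVert E F d) (k := t) (i := jetPhaseMk E F d π j (X t))
    (fhat := fun t => jetProdCoord (chartAt (E × F) q q).1 (chartAt (E × F) q q).2 j.fib (X t))
    (mem_chart_source _ _) ?_ ?_ (Filter.Eventually.of_forall fun t' => ?_)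
  · rw [FibreCore.mem_chartAt_target]
    exact (chartAt (E × F) q).map_source (mem_chart_source _ _)
  · exact contDiffAt_jetProdCoord hX.contDiffAt _ _ _
  · have := (chartAt (E × JetPhaseVert E F d) (jetPhaseMk E F d π j (X t))).left_inv
      (x := jetPhaseMk E F d π j (X t')) (mem_chart_source (E × F) q)
    rw [← this]
    refine congrArg (chartAt (E × JetPhaseVert E F d) (jetPhaseMk E F d π j (X t))).symm ?_
    have e₁ := (dualCore E F d π).coord_base ⟨q, (X t').1⟩
    have e₂ := (jetCore E (F × Mom E F d) (dualProj E F d π)).coord_base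
      (jetPhaseMk E F d π j (X t'))
    refine Prod.ext rfl (Prod.ext (Prod.ext rfl e₁) e₂)

theorem contMDiff_Psi : ContMDiff 𝓘(ℝ, E × JetPhaseVert E F d)
    𝓘(ℝ, E × (JetVert E F × (JetVert E F →L[ℝ] Forms E (d + 1)))) ∞ (Psi E F d π) := by
  intro ζ₀
  have e := chartAt_Psi π ζ₀ ζ₀ (mem_chart_source _ _)
  refine contMDiffAt_of_charts (k := ζ₀) (i := Psi E F d π ζ₀)
    (fhat := fun w => (w.1, psiVert (altForm E d) w.2)) (mem_chart_source _ _) ?_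
    (contDiff_psiVert _).contDiffAt ?_
  · exact e ▸ mem_chart_target _ _
  · filter_upwards [(chartAt (E × JetPhaseVert E F d) ζ₀).open_source.mem_nhds
      (mem_chart_source _ _)] with ζ hζ
    rw [← chartAt_Psi π ζ₀ ζ hζ]
    exact ((chartAt _ (Psi E F d π ζ₀)).left_inv hζ).symm

end Psi

end

noncomputable section

section LineCurve

variable {V W : Type*} [NormedAddCommGroup V] [NormedSpace ℝ V] [NormedAddCommGroup W]
  [NormedSpace ℝ W]

/-- The line through two points. -/
def lineCurve (X X' : V) (t : ℝ) : V := X + t • (X' - X)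

theorem lineCurve_zero (X X' : V) : lineCurve X X' 0 = X := by simp [lineCurve]

theorem lineCurve_one (X X' : V) : lineCurve X X' 1 = X' := by simp [lineCurve]

theorem lineCurve_self (X : V) (t : ℝ) : lineCurve X X t = X := by simp [lineCurve]

theorem contDiff_lineCurve (X X' : V) : ContDiff ℝ ∞ (lineCurve X X') := by
  unfold lineCurve
  fun_prop

theorem map_lineCurve (L : V →L[ℝ] W) (X X' : V) (t : ℝ) :
    L (lineCurve X X' t) = lineCurve (L X) (L X') t := by simp [lineCurve]

theorem lineCurve_comp {U : Type*} [NormedAddCommGroup U] [NormedSpace ℝ U] (X X' : V →L[ℝ] W)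
    (L : U →L[ℝ] V) (t : ℝ) : lineCurve X X' t ∘L L = lineCurve (X ∘L L) (X' ∘L L) t := by
  ext; simp [lineCurve]

theorem hasFDerivAt_clm (L : V →L[ℝ] W) (x : V) : HasFDerivAt L L x := L.hasFDerivAt

end LineCurve

theorem hasFDerivAt_psiVert {E F B N : Type*} [NormedAddCommGroup E] [NormedSpace ℝ E]
    [NormedAddCommGroup F] [NormedSpace ℝ F] [NormedAddCommGroup B] [NormedSpace ℝ B]
    [NormedAddCommGroup N] [NormedSpace ℝ N] (alt : (E →L[ℝ] B) →L[ℝ] N)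
    (X : JetVert E (F × (F →L[ℝ] B))) : HasFDerivAt (psiVert alt) (psiVert alt) X :=
  hasFDerivAt_clm (V := JetVert E (F × (F →L[ℝ] B)))
    (W := JetVert E F × (JetVert E F →L[ℝ] N)) (psiVert alt) X

theorem psiLin_lineCurve {E F B N : Type*} [NormedAddCommGroup E] [NormedSpace ℝ E]
    [NormedAddCommGroup F] [NormedSpace ℝ F] [NormedAddCommGroup B] [NormedSpace ℝ B]
    [NormedAddCommGroup N] [NormedSpace ℝ N] (alt : (E →L[ℝ] B) →L[ℝ] N)
    (X X' : JetVert E (F →L[ℝ] B)) (t : ℝ) :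
    psiLin F alt (lineCurve X X' t) = lineCurve (psiLin F alt X) (psiLin F alt X') t :=
  map_lineCurve (V := JetVert E (F →L[ℝ] B)) (W := JetVert E F →L[ℝ] N) (psiLin F alt) X X' t

/-! ### Local sections, velocities and the reduction by `Ψ`. -/

section PsiReduction

variable {E F M Q : Type*} [NormedAddCommGroup E] [NormedSpace ℝ E] [NormedAddCommGroup F]
  [NormedSpace ℝ F] [FiniteDimensional ℝ E] [FiniteDimensional ℝ F]
  [TopologicalSpace M] [ChartedSpace E M] [IsManifold 𝓘(ℝ, E) ∞ M]
  [TopologicalSpace Q] [ChartedSpace (E × F) Q] [IsManifold 𝓘(ℝ, E × F) ∞ Q]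
  {d : ℕ} (π : Q → M) [IsFibred E F π]

theorem canonForm_nondegenerate {G Y : Type*} [NormedAddCommGroup G] [NormedSpace ℝ G] [FiniteDimensional ℝ G]
    [TopologicalSpace Y] [ChartedSpace (E × G) Y] [IsManifold 𝓘(ℝ, E × G) ∞ Y] {n : ℕ}
    (hn : Module.finrank ℝ E = n) (π : Y → M) [IsFibred E G π] (z : Dual E G n π)
    (a : G × (G →L[ℝ] Forms E n)) (h : ∀ b, canonForm E G n π z ![a, b] = 0) : a = 0 := by
  have := nontrivial_topForms hn
  exact twoForm_pairing_nondegenerate h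

/-- In charts, take the linear right inverse translated so that it passes through `ζ₀`; it is
defined on the whole chart domain. -/
theorem exists_section_Psi (hd : Module.finrank ℝ E = d + 1) (ζ₀ : JetPhase E F d π) :
    ∃ (O : Set (Cov E F (d + 1) π)) (σ : Cov E F (d + 1) π → JetPhase E F d π),
      IsOpen O ∧ Psi E F d π ζ₀ ∈ O ∧
      ContMDiffOn 𝓘(ℝ, E × (JetVert E F × (JetVert E F →L[ℝ] Forms E (d + 1))))
        𝓘(ℝ, E × JetPhaseVert E F d) ∞ σ O ∧ σ (Psi E F d π ζ₀) = ζ₀ ∧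
      ∀ z ∈ O, Psi E F d π (σ z) = z := by
  obtain ⟨R, hR⟩ := exists_psiLin_altForm_rightInverse (F := F) hd
  set χ := chartAt (E × (JetVert E F × (JetVert E F →L[ℝ] Forms E (d + 1)))) (Psi E F d π ζ₀)
    with hχ
  set κ := chartAt (E × JetPhaseVert E F d) ζ₀ with hκ
  have hs₀ : ζ₀ ∈ κ.source := mem_chart_source _ _
  -- Membership in either chart target constrains only the coordinates of `Q`, which the section
  -- leaves unchanged.
  have ht : ∀ z ∈ χ.source, ((χ z).1, psiVertSection (altForm E d) R (κ ζ₀).2 (χ z).2) ∈ κ.target :=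
    fun z hz => χ.map_source hz
  refine ⟨χ.source, fun z => κ.symm ((χ z).1, psiVertSection (altForm E d) R (κ ζ₀).2 (χ z).2),
    χ.open_source, mem_chart_source _ _, fun z hz => ?_, ?_, fun z hz => ?_⟩
  · refine ContMDiffAt.contMDiffWithinAt ?_
    exact contMDiffAt_of_charts (W := E × JetPhaseVert E F d) (k := Psi E F d π ζ₀) (i := ζ₀)
      (fhat := fun w => (w.1, psiVertSection (altForm E d) R (κ ζ₀).2 w.2)) hz (ht z hz)
      (contDiff_psiVertSection _ _).contDiffAt (Filter.Eventually.of_forall fun _ => rfl)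
  · have h1 := chartAt_Psi π ζ₀ ζ₀ (mem_chart_source _ _)
    change χ _ = ((κ ζ₀).1, psiVert _ (κ ζ₀).2) at h1
    simp only [h1, psiVertSection_psiVert]
    exact κ.left_inv hs₀
  · have h2 := κ.map_target (ht z hz)
    have h1 := chartAt_Psi π ζ₀ _ h2
    change χ _ = ((κ _).1, psiVert _ (κ _).2) at h1
    rw [κ.right_inv (ht z hz), psiVert_psiVertSection _ hR] at h1
    exact χ.injOn h2 hz h1

theorem vel_Psi {γ : ℝ → JetPhase E F d π}
    (hγ : ContMDiff 𝓘(ℝ, ℝ) 𝓘(ℝ, E × JetPhaseVert E F d) ∞ γ)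
    (hv : ∀ t, jetPhaseProj E F d π (γ t) = jetPhaseProj E F d π (γ 0)) :
    vel E (JetVert E F × (JetVert E F →L[ℝ] Forms E (d + 1))) (fun t => Psi E F d π (γ t)) 0 =
      psiVert (altForm E d) (vel E (JetPhaseVert E F d) γ 0) := by
  have hs : ContMDiff 𝓘(ℝ, ℝ) 𝓘(ℝ, E × (JetVert E F × (JetVert E F →L[ℝ] Forms E (d + 1)))) ∞
    (fun t => Psi E F d π (γ t)) := (contMDiff_Psi π).comp hγ
  have h := fibreBlock_vel_of_charts (π := jetPhaseProj E F d π) (π' := covProj E F (d + 1) π)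
    (γ := γ) (δ := fun t => Psi E F d π (γ t)) (t := 0) (i := γ 0) (k := Psi E F d π (γ 0))
    ((hγ 0).mdifferentiableAt (by simp)) (Filter.Eventually.of_forall hv)
    ((hs 0).mdifferentiableAt (by simp)) (Filter.Eventually.of_forall hv)
    (mem_chart_source _ _) (mem_chart_source _ _)
    (hasFDerivAt_psiVert (altForm E d) _) (by
      filter_upwards [hγ.continuous.continuousAt.eventually_mem
        ((chartAt (E × JetPhaseVert E F d) (γ 0)).open_source.mem_nhds (mem_chart_source _ _))]
        with t ht
      exact congrArg Prod.snd (chartAt_Psi π (γ 0) (γ t) ht))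
  rwa [fibreBlock_tcc_self (mem_chart_source _ _), fibreBlock_tcc_self (mem_chart_source _ _)] at h

/-- Two points of `J¹P` over the same jet are joined by a curve along which the image under `Ψ`
is changed along a segment. -/
theorem exists_curve_jetPhase (ζ ζ' : JetPhase E F d π)
    (h : jetPi E F d π ζ = jetPi E F d π ζ') : ∃ γ : ℝ → JetPhase E F d π,
      ContMDiff 𝓘(ℝ, ℝ) 𝓘(ℝ, E × JetPhaseVert E F d) ∞ γ ∧ γ 0 = ζ ∧ γ 1 = ζ' ∧
      (∀ t, jetPi E F d π (γ t) = jetPi E F d π ζ) ∧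
      ∀ t, (Psi E F d π (γ t)).fib =
        lineCurve (Psi E F d π ζ).fib (Psi E F d π ζ').fib t := by
  obtain ⟨X, hX⟩ := exists_eq_jetPhaseMk π ζ
  obtain ⟨X', hX'⟩ := exists_eq_jetPhaseMk π ζ'
  rw [← h] at hX'
  generalize jetPi E F d π ζ = j at *
  subst hX hX'
  refine ⟨fun t => jetPhaseMk E F d π j (lineCurve X X' t),
    contMDiff_jetPhaseMk π j (contDiff_lineCurve X X'), congrArg _ (lineCurve_zero X X'),
    congrArg _ (lineCurve_one X X'), fun t => rfl, fun t => ?_⟩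
  exact psiLin_lineCurve (altForm E d) X X' t

theorem isReduction_Psi (hd : Module.finrank ℝ E = d + 1) :
    IsReduction E (JetPhaseVert E F d) (JetVert E F × (JetVert E F →L[ℝ] Forms E (d + 1)))
      (jetPhaseProj E F d π) univ (omegaTilde E F d π)
      (covProj E F (d + 1) π) (canonForm E (JetVert E F) (d + 1) (jetProj E F π))
      (fun ζ => Psi E F d π ζ) := by
  refine isReduction_of_pullback (fun _ => rfl) (fun s => ⟨univ, Psi E F d π, isOpen_univ,
    mem_univ _, (contMDiff_Psi π).contMDiffOn, fun _ _ => rfl⟩) (fun z => ?_) (fun s => ?_)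
    (fun γ₁ γ₂ h₁ h₂ _ => ?_) (canonForm_nondegenerate hd (jetProj E F π)) (fun s s' h => ?_)
  · obtain ⟨R, hR⟩ := exists_psiLin_altForm_rightInverse (F := F) hd
    exact ⟨⟨jetPhaseMk E F d π z.base (R z.fib), mem_univ _⟩,
      FibreCore.Total.ext rfl (hR z.fib)⟩
  · obtain ⟨O, σ, hO, hs, hσ, hσs, hf⟩ := exists_section_Psi π hd (s : JetPhase E F d π)
    exact ⟨O, σ, hO, hs, hσ, hσs, fun z hz => ⟨mem_univ _, hf z hz⟩⟩
  · have e₁ := vel_Psi π h₁.smooth h₁.vertical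
    have e₂ := vel_Psi π h₂.smooth h₂.vertical
    refine Eq.trans ?_ (twoForm_pairing_psiVert (altForm E d) _ _)
    rw [← e₁, ← e₂]
    rfl
  · obtain ⟨γ, hγ, h0, h1, hj, hγf⟩ := exists_curve_jetPhase π (s : JetPhase E F d π) s'
      (congrArg FibreCore.Total.base h)
    have hf : (Psi E F d π (s : JetPhase E F d π)).fib = (Psi E F d π (s' : JetPhase E F d π)).fib := by
      have h' : Psi E F d π (s : JetPhase E F d π) = Psi E F d π (s' : JetPhase E F d π) := h
      rw [h']
    refine ⟨fun t => ⟨γ t, mem_univ _⟩, ⟨hγ, fun t => ?_⟩, fun t => ?_, Subtype.ext h0,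
      Subtype.ext h1⟩
    · exact congrArg (jetProj E F π) ((hj t).trans (hj 0).symm)
    · refine FibreCore.Total.ext (hj t) ((hγf t).trans ?_)
      rw [hf]
      exact lineCurve_self _ t

end PsiReduction

end

noncomputable section

/-! ### Embedded sub-bundles -/

section Retraction

variable {V W C J : Type*} [NormedAddCommGroup V] [NormedSpace ℝ V] [NormedAddCommGroup W]
  [NormedSpace ℝ W] [TopologicalSpace C] [ChartedSpace V C] [IsManifold 𝓘(ℝ, V) ∞ C]
  [TopologicalSpace J] [ChartedSpace W J] [IsManifold 𝓘(ℝ, W) ∞ J]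

/-- In adapted charts an immersion is `u ↦ (u, 0)`, so the projection to the first factor recovers
the point from its image. -/
theorem exists_immersion_charts {ι : C → J} {c₀ : C}
    (h : Manifold.IsImmersionAt 𝓘(ℝ, V) 𝓘(ℝ, W) ∞ ι c₀) :
    ∃ (φ : OpenPartialHomeomorph C V) (ψ : OpenPartialHomeomorph J W) (p : W → V),
      φ ∈ IsManifold.maximalAtlas 𝓘(ℝ, V) ∞ C ∧ ψ ∈ IsManifold.maximalAtlas 𝓘(ℝ, W) ∞ J ∧
      ContDiff ℝ ∞ p ∧ c₀ ∈ φ.source ∧ ∀ c ∈ φ.source, ι c ∈ ψ.source ∧ p (ψ (ι c)) = φ c := by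
  refine ⟨h.domChart, h.codChart, fun w => (h.equiv.symm w).1, h.domChart_mem_maximalAtlas,
    h.codChart_mem_maximalAtlas, contDiff_fst.comp h.equiv.symm.contDiff,
    h.mem_domChart_source, fun c hc => ⟨h.source_subset_preimage_source hc, ?_⟩⟩
  have h0 : h.domChart c ∈ (h.domChart.extend 𝓘(ℝ, V)).target := by
    rw [OpenPartialHomeomorph.extend_target]
    simpa using h.domChart.map_source hc
  have h1 := h.writtenInCharts h0
  simp only [Function.comp_apply, OpenPartialHomeomorph.extend_coe,
    OpenPartialHomeomorph.extend_coe_symm, modelWithCornersSelf_coe, id_eq,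
    modelWithCornersSelf_coe_symm, h.domChart.left_inv hc] at h1
  rw [h1]
  exact congrArg Prod.fst (h.equiv.symm_apply_apply _)

/-- A smooth embedding has smooth local left inverses. -/
theorem exists_local_leftInverse {ι : C → J}
    (hι : Manifold.IsSmoothEmbedding 𝓘(ℝ, V) 𝓘(ℝ, W) ∞ ι) (c₀ : C) {U : Set C} (hU : IsOpen U)
    (hc₀ : c₀ ∈ U) : ∃ (O : Set J) (F : J → C), IsOpen O ∧ ι c₀ ∈ O ∧
      ContMDiffOn 𝓘(ℝ, W) 𝓘(ℝ, V) ∞ F O ∧ MapsTo F O U ∧ ∀ c, ι c ∈ O → F (ι c) = c := by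
  obtain ⟨φ, ψ, p, hφ, hψ, hpd, hφs, hφψ⟩ :=
    exists_immersion_charts (hι.isImmersion.isImmersionAt c₀)
  -- The topology of `C` is induced by `ι`, so an open set of the ambient space cuts out exactly the
  -- chosen neighbourhood. This excludes other parts of `C` that come back near `ι c₀`.
  obtain ⟨O₂, hO₂, hιO₂⟩ := hι.isEmbedding.isOpen_iff.1 (φ.open_source.inter hU)
  have hmem : ∀ c, ι c ∈ O₂ ↔ c ∈ φ.source ∩ U := fun c => by rw [← hιO₂]; rfl
  have hφU := φ.isOpen_inter_preimage_symm hU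
  have hO₁ : IsOpen (ψ.source ∩ ψ ⁻¹' (p ⁻¹' (φ.target ∩ φ.symm ⁻¹' U))) :=
    ψ.isOpen_inter_preimage (hφU.preimage hpd.continuous)
  refine ⟨_, fun y => φ.symm (p (ψ y)), hO₁.inter hO₂, ⟨⟨(hφψ _ hφs).1, ?_⟩, ?_⟩, ?_, ?_, ?_⟩
  · have h2 := (hφψ _ hφs).2
    simp only [mem_preimage, h2]
    exact ⟨φ.map_source hφs, by simpa [φ.left_inv hφs] using hc₀⟩
  · rw [hmem]
    exact ⟨hφs, hc₀⟩
  · rintro y ⟨⟨hy, hy'⟩, -⟩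
    have h1 : ContMDiffAt 𝓘(ℝ, W) 𝓘(ℝ, W) ∞ ψ y :=
      (contMDiffOn_of_mem_maximalAtlas hψ).contMDiffAt
        (ψ.open_source.mem_nhds hy)
    have h2 : ContMDiffAt 𝓘(ℝ, V) 𝓘(ℝ, V) ∞ φ.symm (p (ψ y)) :=
      (contMDiffOn_symm_of_mem_maximalAtlas hφ).contMDiffAt
        (φ.open_target.mem_nhds hy'.1)
    exact (h2.comp y (hpd.contDiffAt.contMDiffAt.comp y h1)).contMDiffWithinAt
  · rintro y ⟨⟨-, hy⟩, -⟩
    exact hy.2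
  · rintro c ⟨-, hc⟩
    have hc' := ((hmem c).1 hc).1
    simp only [(hφψ c hc').2, φ.left_inv hc']

end Retraction

section Vertical

variable {E G V M C J : Type*} [NormedAddCommGroup E] [NormedSpace ℝ E] [NormedAddCommGroup G]
  [NormedSpace ℝ G] [NormedAddCommGroup V] [NormedSpace ℝ V]
  [TopologicalSpace M] [ChartedSpace E M] [IsManifold 𝓘(ℝ, E) ∞ M]
  [TopologicalSpace C] [ChartedSpace (E × G) C] [IsManifold 𝓘(ℝ, E × G) ∞ C]
  [TopologicalSpace J] [ChartedSpace (E × V) J] [IsManifold 𝓘(ℝ, E × V) ∞ J]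
  {πC : C → M} [IsFibred E G πC] {π : J → M} [IsFibred E V π]

variable (E G V) in
/-- The vertical derivative of a map over `M`. -/
def vertDerivOf (ι : C → J) (c : C) : G →L[ℝ] V :=
  ContinuousLinearMap.snd ℝ E V ∘L chartDeriv (E × G) (E × V) ι c ∘L ContinuousLinearMap.inr ℝ E G

variable (E G V) in
/-- The expression of a map in the charts at a point and at its image. -/
def embCoord (ι : C → J) (c₀ : C) (w : E × G) : E × V :=
  chartAt (E × V) (ι c₀) (ι ((chartAt (E × G) c₀).symm w))

variable (E G V) in
/-- The vertical derivative of the expression of a map in charts. -/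
def embVert (ι : C → J) (c₀ : C) (w : E × G) : G →L[ℝ] V :=
  ContinuousLinearMap.snd ℝ E V ∘L fderiv ℝ (embCoord E G V ι c₀) w ∘L
    ContinuousLinearMap.inr ℝ E G

variable {ι : C → J} (hι : ContMDiff 𝓘(ℝ, E × G) 𝓘(ℝ, E × V) ∞ ι) (hb : ∀ c, π (ι c) = πC c)
  {c₀ c : C} (hc : c ∈ (chartAt (E × G) c₀).source) (hc' : ι c ∈ (chartAt (E × V) (ι c₀)).source)

theorem embCoord_chartAt (hc : c ∈ (chartAt (E × G) c₀).source) :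
    embCoord E G V ι c₀ (chartAt (E × G) c₀ c) = chartAt (E × V) (ι c₀) (ι c) := by
  rw [embCoord, (chartAt (E × G) c₀).left_inv hc]

include hb in
theorem fst_chartAt_comp (hc : c ∈ (chartAt (E × G) c₀).source)
    (hc' : ι c ∈ (chartAt (E × V) (ι c₀)).source) :
    (chartAt (E × V) (ι c₀) (ι c)).1 = (chartAt (E × G) c₀ c).1 := by
  rw [IsFibred.fst_chart (E := E) (G := V) (π := π) _ _ hc',
    IsFibred.fst_chart (E := E) (G := G) (π := πC) _ _ hc, hb, hb]

include hι

theorem eventually_mem_embCoord (hc : c ∈ (chartAt (E × G) c₀).source) {O : Set J}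
    (hO : IsOpen O) (hc' : ι c ∈ O) :
    ∀ᶠ w in 𝓝 (chartAt (E × G) c₀ c), w ∈ (chartAt (E × G) c₀).target ∧
      ι ((chartAt (E × G) c₀).symm w) ∈ O := by
  have h1 := tendsto_chart_symm (E := E × G) hc
  filter_upwards [(chartAt (E × G) c₀).open_target.mem_nhds ((chartAt (E × G) c₀).map_source hc),
    h1.eventually (hι.continuous.continuousAt.eventually_mem (hO.mem_nhds hc'))] with w h2 h3
  exact ⟨h2, h3⟩

theorem contDiffAt_embCoord (hc : c ∈ (chartAt (E × G) c₀).source)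
    (hc' : ι c ∈ (chartAt (E × V) (ι c₀)).source) :
    ContDiffAt ℝ ∞ (embCoord E G V ι c₀) (chartAt (E × G) c₀ c) :=
  contDiffAt_in_charts (hι c) hc hc'

theorem contDiffAt_embVert (hc : c ∈ (chartAt (E × G) c₀).source)
    (hc' : ι c ∈ (chartAt (E × V) (ι c₀)).source) :
    ContDiffAt ℝ ∞ (embVert E G V ι c₀) (chartAt (E × G) c₀ c) :=
  contDiffAt_const.clm_comp
    (((contDiffAt_embCoord hι hc hc').fderiv_right (by simp)).clm_comp contDiffAt_const)

include hb

/-- A map over `M` preserves base coordinates in these charts, so its derivative maps vertical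
vectors to vertical vectors. -/
theorem fderiv_embCoord_vert (hc : c ∈ (chartAt (E × G) c₀).source)
    (hc' : ι c ∈ (chartAt (E × V) (ι c₀)).source) (g : G) :
    fderiv ℝ (embCoord E G V ι c₀) (chartAt (E × G) c₀ c) (0, g) =
      (0, embVert E G V ι c₀ (chartAt (E × G) c₀ c) g) := by
  refine Prod.ext ?_ rfl
  have h1 := ((contDiffAt_embCoord hι hc hc').differentiableAt (by simp)).hasFDerivAt
  have h2 := hasFDerivAt_fst_comp h1
  have h3 := h2.unique ((hasFDerivAt_fst (𝕜 := ℝ) (E := E) (F := G)).congr_of_eventuallyEq (by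
    filter_upwards [eventually_mem_embCoord hι hc (chartAt (E × V) (ι c₀)).open_source hc']
      with w hw
    have h4 := fst_chartAt_comp (πC := πC) (π := π) hb ((chartAt (E × G) c₀).map_target hw.1) hw.2
    rwa [(chartAt (E × G) c₀).right_inv hw.1] at h4))
  exact DFunLike.congr_fun h3 (0, g)

theorem fderiv_embCoord (hc : c ∈ (chartAt (E × G) c₀).source)
    (hc' : ι c ∈ (chartAt (E × V) (ι c₀)).source) (v : E × G) :
    fderiv ℝ (embCoord E G V ι c₀) (chartAt (E × G) c₀ c) (tcc E G c c₀ c v) =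
      tcc E V (ι c) (ι c₀) (ι c) (chartDeriv (E × G) (E × V) ι c v) := by
  have h1 := hasFDerivAt_in_charts ((hι c).mdifferentiableAt (by simp)) hc hc'
  have h2 : fderiv ℝ (embCoord E G V ι c₀) (chartAt (E × G) c₀ c) = _ := h1.fderiv
  rw [h2]
  have h3 : tcc E G c₀ c c (tcc E G c c₀ c v) = v := by
    rw [tcc_comp (mem_chart_source _ _) hc (mem_chart_source _ _), tcc_self (mem_chart_source _ _)]
  exact congrArg (fun v => tcc E V (ι c) (ι c₀) (ι c) (chartDeriv (E × G) (E × V) ι c v)) h3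

theorem embVert_center (c : C) :
    embVert E G V ι c (chartAt (E × G) c c) = vertDerivOf E G V ι c := by
  ext g
  have h := fderiv_embCoord hι hb (mem_chart_source _ c) (mem_chart_source _ (ι c)) (0, g)
  rw [tcc_self (mem_chart_source _ _), tcc_self (mem_chart_source _ _)] at h
  exact congrArg Prod.snd h

/-- This is the chain rule for the changes of charts at `c` and `ι c`, restricted to vertical
vectors. It is what makes restriction of covectors a precomposition in every chart. -/
theorem embVert_fibreBlock (hc : c ∈ (chartAt (E × G) c₀).source)
    (hc' : ι c ∈ (chartAt (E × V) (ι c₀)).source) (g : G) :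
    embVert E G V ι c₀ (chartAt (E × G) c₀ c) (fibreBlock (tcc E G c c₀ c) g) =
      fibreBlock (tcc E V (ι c) (ι c₀) (ι c)) (vertDerivOf E G V ι c g) := by
  have h0 := fderiv_embCoord hι hb (mem_chart_source _ c) (mem_chart_source _ (ι c)) (0, g)
  rw [tcc_self (mem_chart_source _ _), tcc_self (mem_chart_source _ _),
    fderiv_embCoord_vert hι hb (mem_chart_source _ c) (mem_chart_source _ (ι c)),
    embVert_center hι hb] at h0
  have h1 := fderiv_embCoord hι hb hc hc' (0, g)
  have h2 : tcc E G c c₀ c (0, g) = (0, fibreBlock (tcc E G c c₀ c) g) :=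
    Prod.ext (tcc_vert πC (mem_chart_source _ _) hc g) rfl
  rw [h2, fderiv_embCoord_vert hι hb hc hc', ← h0] at h1
  have h3 := congrArg Prod.snd h1
  exact h3

omit hι in
/-- Near a point of a sub-bundle there are a smooth retraction and smooth left inverses of the
vertical derivatives. -/
theorem exists_local_retraction (hι : Manifold.IsSmoothEmbedding 𝓘(ℝ, E × G) 𝓘(ℝ, E × V) ∞ ι)
    (c₀ : C) : ∃ (O : Set J) (F : J → C) (B : E × G → V →L[ℝ] G), IsOpen O ∧ ι c₀ ∈ O ∧
      O ⊆ (chartAt (E × V) (ι c₀)).source ∧ ContMDiffOn 𝓘(ℝ, E × V) 𝓘(ℝ, E × G) ∞ F O ∧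
      MapsTo F O ((chartAt (E × G) c₀).source ∩ ι ⁻¹' (chartAt (E × V) (ι c₀)).source) ∧
      (∀ c, ι c ∈ O → F (ι c) = c) ∧
      ∀ c, ι c ∈ O → ContDiffAt ℝ ∞ B (chartAt (E × G) c₀ c) ∧
        ∀ g, B (chartAt (E × G) c₀ c) (embVert E G V ι c₀ (chartAt (E × G) c₀ c) g) = g := by
  have hs := hι.contMDiff
  obtain ⟨O, F, hO, hcO, hF, hFU, hFι⟩ := exists_local_leftInverse hι c₀
    ((chartAt (E × G) c₀).open_source.inter
      ((chartAt (E × V) (ι c₀)).open_source.preimage hs.continuous))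
    ⟨mem_chart_source _ _, mem_chart_source _ _⟩
  set Fhat : E × V → E × G :=
    fun u => chartAt (E × G) c₀ (F ((chartAt (E × V) (ι c₀)).symm u)) with hFhat
  -- The left inverses are the vertical blocks of the derivative of the retraction, taken at the
  -- image of the embedding.
  refine ⟨O ∩ (chartAt (E × V) (ι c₀)).source, F, fun w => ContinuousLinearMap.snd ℝ E G ∘L
    fderiv ℝ Fhat (embCoord E G V ι c₀ w) ∘L ContinuousLinearMap.inr ℝ E V,
    hO.inter (chartAt (E × V) (ι c₀)).open_source, ⟨hcO, mem_chart_source _ _⟩,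
    inter_subset_right, hF.mono inter_subset_left, hFU.mono_left inter_subset_left,
    fun c hc => hFι c hc.1, fun c hc => ?_⟩
  have hFc := hFι c hc.1
  have hcs : c ∈ (chartAt (E × G) c₀).source := by
    have := (hFU hc.1).1
    rwa [hFc] at this
  have h1 : ContDiffAt ℝ ∞ Fhat (embCoord E G V ι c₀ (chartAt (E × G) c₀ c)) := by
    rw [embCoord_chartAt hcs]
    exact contDiffAt_in_charts (hF.contMDiffAt (hO.mem_nhds hc.1)) hc.2 (by rwa [hFc])
  have h2 := contDiffAt_embCoord hs hcs hc.2
  refine ⟨?_, fun g => ?_⟩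
  · have h3 : ContDiffAt ℝ ∞ (fderiv ℝ Fhat) (embCoord E G V ι c₀ (chartAt (E × G) c₀ c)) :=
      h1.fderiv_right (by simp)
    exact contDiffAt_const.clm_comp
      ((ContDiffAt.comp (g := fderiv ℝ Fhat) _ h3 h2).clm_comp contDiffAt_const)
  -- Differentiate `F ∘ ι = id` in charts and apply the result to a vertical vector.
  · have h4 := ((h1.differentiableAt (by simp)).hasFDerivAt.comp _
      (h2.differentiableAt (by simp)).hasFDerivAt).unique
      ((hasFDerivAt_id (chartAt (E × G) c₀ c)).congr_of_eventuallyEq (by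
        filter_upwards [eventually_mem_embCoord hs hcs
          (hO.inter (chartAt (E × V) (ι c₀)).open_source) hc] with w hw
        simp only [Function.comp_apply, hFhat, embCoord,
          (chartAt (E × V) (ι c₀)).left_inv hw.2.2, hFι _ hw.2.1,
          (chartAt (E × G) c₀).right_inv hw.1, id]))
    have h5 := DFunLike.congr_fun h4 (0, g)
    rw [ContinuousLinearMap.comp_apply, fderiv_embCoord_vert hs hb hcs hc.2] at h5
    exact congrArg Prod.snd h5

omit hι in
theorem vertDerivOf_injective (hι : Manifold.IsSmoothEmbedding 𝓘(ℝ, E × G) 𝓘(ℝ, E × V) ∞ ι)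
    (c : C) : Function.Injective (vertDerivOf E G V ι c) := by
  obtain ⟨O, F, B, -, hcO, -, -, -, -, hB⟩ := exists_local_retraction hb hι c
  rw [← embVert_center hι.contMDiff hb]
  exact Function.LeftInverse.injective (hB c hcO).2

end Vertical

end

noncomputable section

/-! ### Restriction of covectors to a sub-bundle -/

section RestrictCoord

variable {E G V N : Type*} [NormedAddCommGroup E] [NormedSpace ℝ E] [NormedAddCommGroup G]
  [NormedSpace ℝ G] [NormedAddCommGroup V] [NormedSpace ℝ V] [NormedAddCommGroup N]
  [NormedSpace ℝ N]

/-- The restriction of covectors in coordinates. -/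
def restrictCoord (f : E × V → E × G) (A : E × G → G →L[ℝ] V) (w : E × (V × (V →L[ℝ] N))) :
    E × (G × (G →L[ℝ] N)) :=
  ((f (w.1, w.2.1)).1, (f (w.1, w.2.1)).2, w.2.2 ∘L A (f (w.1, w.2.1)))

theorem contDiffAt_restrictCoord {f : E × V → E × G} {A : E × G → G →L[ℝ] V}
    {w : E × (V × (V →L[ℝ] N))} (hf : ContDiffAt ℝ ∞ f (w.1, w.2.1))
    (hA : ContDiffAt ℝ ∞ A (f (w.1, w.2.1))) : ContDiffAt ℝ ∞ (restrictCoord f A) w := by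
  have h1 : ContDiffAt ℝ ∞ (fun w : E × (V × (V →L[ℝ] N)) => f (w.1, w.2.1)) w :=
    ContDiffAt.comp (g := f) (f := fun w : E × (V × (V →L[ℝ] N)) => (w.1, w.2.1)) w hf
      (by fun_prop)
  have h2 : ContDiffAt ℝ ∞ (fun w : E × (V × (V →L[ℝ] N)) => A (f (w.1, w.2.1))) w :=
    ContDiffAt.comp (g := A) (f := fun w : E × (V × (V →L[ℝ] N)) => f (w.1, w.2.1)) w hA h1
  exact h1.fst.prodMk (h1.snd.prodMk (ContDiffAt.clm_comp (by fun_prop) h2))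

/-- A right inverse of the restriction of covectors, in coordinates. -/
def extendCoord (f : E × G → E × V) (A : E × G → G →L[ℝ] V) (B : E × G → V →L[ℝ] G)
    (X : V →L[ℝ] N) (w : E × (G × (G →L[ℝ] N))) : E × (V × (V →L[ℝ] N)) :=
  ((f (w.1, w.2.1)).1, (f (w.1, w.2.1)).2,
    X + (w.2.2 - X ∘L A (w.1, w.2.1)) ∘L B (w.1, w.2.1))

theorem contDiffAt_extendCoord {f : E × G → E × V} {A : E × G → G →L[ℝ] V}
    {B : E × G → V →L[ℝ] G} (X : V →L[ℝ] N)
    {w : E × (G × (G →L[ℝ] N))} (hf : ContDiffAt ℝ ∞ f (w.1, w.2.1))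
    (hA : ContDiffAt ℝ ∞ A (w.1, w.2.1)) (hB : ContDiffAt ℝ ∞ B (w.1, w.2.1)) :
    ContDiffAt ℝ ∞ (extendCoord f A B X) w := by
  have h : ContDiffAt ℝ ∞ (fun w : E × (G × (G →L[ℝ] N)) => (w.1, w.2.1)) w := by fun_prop
  have h1 : ContDiffAt ℝ ∞ (fun w : E × (G × (G →L[ℝ] N)) => f (w.1, w.2.1)) w :=
    ContDiffAt.comp (g := f) w hf h
  have h2 : ContDiffAt ℝ ∞ (fun w : E × (G × (G →L[ℝ] N)) => A (w.1, w.2.1)) w :=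
    ContDiffAt.comp (g := A) w hA h
  have h3 : ContDiffAt ℝ ∞ (fun w : E × (G × (G →L[ℝ] N)) => B (w.1, w.2.1)) w :=
    ContDiffAt.comp (g := B) w hB h
  refine h1.fst.prodMk (h1.snd.prodMk (contDiffAt_const.add (ContDiffAt.clm_comp ?_ h3)))
  exact ContDiffAt.sub (by fun_prop) (contDiffAt_const.clm_comp h2)

/-- Adding the correction `(ξ - X ∘ A) ∘ B` to `X` gives an extension of `ξ`. It returns `X` itself
when `ξ` is the restriction of `X`, so the resulting section passes through a prescribed covector.
-/
theorem extend_comp_of_leftInverse {A : G →L[ℝ] V} {B : V →L[ℝ] G} (h : ∀ g, B (A g) = g)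
    (X : V →L[ℝ] N) (ξ : G →L[ℝ] N) : (X + (ξ - X ∘L A) ∘L B) ∘L A = ξ := by
  ext g
  simp [h]

theorem extend_restrict (A : G →L[ℝ] V) (B : V →L[ℝ] G) (X : V →L[ℝ] N) :
    X + (X ∘L A - X ∘L A) ∘L B = X := by simp

end RestrictCoord

section Restrict

variable {E G V M C J : Type*} [NormedAddCommGroup E] [NormedSpace ℝ E] [NormedAddCommGroup G]
  [NormedSpace ℝ G] [NormedAddCommGroup V] [NormedSpace ℝ V]
  [TopologicalSpace M] [ChartedSpace E M] [IsManifold 𝓘(ℝ, E) ∞ M]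
  [TopologicalSpace C] [ChartedSpace (E × G) C] [IsManifold 𝓘(ℝ, E × G) ∞ C]
  [TopologicalSpace J] [ChartedSpace (E × V) J] [IsManifold 𝓘(ℝ, E × V) ∞ J]
  (πC : C → M) [IsFibred E G πC] (π : J → M) [IsFibred E V π] (ι : C → J) (n : ℕ)

variable (E V) in
/-- The covectors over a sub-bundle. -/
def dualOver : Set (Dual E V n π) := {η | η.base ∈ range ι}

variable (E G V) in
/-- The restriction of covectors to a sub-bundle. -/
def restrictDual (η : dualOver E V π ι n) : Dual E G n πC :=
  ⟨η.2.choose, (η : Dual E V n π).fib ∘L vertDerivOf E G V ι η.2.choose⟩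

variable {πC π ι n}

theorem exists_eq_of_mem_dualOver (s : dualOver E V π ι n) :
    ∃ (c : C) (X : V →L[ℝ] Forms E n), s = ⟨⟨ι c, X⟩, c, rfl⟩ := by
  obtain ⟨c, hc⟩ := s.2
  exact ⟨c, (s : Dual E V n π).fib, Subtype.ext (FibreCore.Total.ext hc.symm rfl)⟩

theorem base_restrictDual (η : dualOver E V π ι n) :
    ι (restrictDual E G V πC π ι n η).base = (η : Dual E V n π).base := η.2.choose_spec

/-- The point of `C` in the definition is an arbitrary choice; injectivity of `ι` makes it the only
possible one. -/
theorem restrictDual_eq (hinj : Function.Injective ι) {η : dualOver E V π ι n} {c : C}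
    (h : (η : Dual E V n π).base = ι c) :
    restrictDual E G V πC π ι n η = ⟨c, (η : Dual E V n π).fib ∘L vertDerivOf E G V ι c⟩ := by
  have h1 : η.2.choose = c := hinj (η.2.choose_spec.trans h)
  unfold restrictDual
  rw [h1]

variable (hι : ContMDiff 𝓘(ℝ, E × G) 𝓘(ℝ, E × V) ∞ ι) (hinj : Function.Injective ι)
  (hb : ∀ c, π (ι c) = πC c)

include hι hinj hb

theorem coord_restrictDual {c₀ c : C} {η : dualOver E V π ι n} (h : (η : Dual E V n π).base = ι c)
    (hc : c ∈ (chartAt (E × G) c₀).source) (hc' : ι c ∈ (chartAt (E × V) (ι c₀)).source) :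
    (dualCore E G n πC).coord c₀ (restrictDual E G V πC π ι n η) =
      (dualCore E V n π).coord (ι c₀) η ∘L embVert E G V ι c₀ (chartAt (E × G) c₀ c) := by
  rw [restrictDual_eq hinj h]
  refine dual_coord_eq πC _ hc fun g => ?_
  rw [ContinuousLinearMap.comp_apply]
  change (dualCore E V n π).coord (ι c₀) η (embVert E G V ι c₀ (chartAt (E × G) c₀ c)
    (fibreBlock (tcc E G c c₀ c) g)) = _
  rw [embVert_fibreBlock hι hb hc hc']
  have h1 := dual_coord_apply π (η : Dual E V n π) (i := ι c₀) (by rwa [h])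
    (vertDerivOf E G V ι c g)
  rw [h, hb, hb] at h1
  exact h1

theorem chartAt_restrictDual {c₀ c : C} (X : V →L[ℝ] Forms E n) (Y : G →L[ℝ] Forms E n)
    {η : dualOver E V π ι n} (h : (η : Dual E V n π).base = ι c)
    (hc : c ∈ (chartAt (E × G) c₀).source) (hc' : ι c ∈ (chartAt (E × V) (ι c₀)).source) :
    chartAt (E × (G × (G →L[ℝ] Forms E n))) (⟨c₀, Y⟩ : Dual E G n πC) (restrictDual E G V πC π ι n η) =
      ((chartAt (E × G) c₀ c).1, (chartAt (E × G) c₀ c).2,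
        (chartAt (E × (V × (V →L[ℝ] Forms E n))) (⟨ι c₀, X⟩ : Dual E V n π) η).2.2 ∘L
          embVert E G V ι c₀ (chartAt (E × G) c₀ c)) := by
  have h1 := coord_restrictDual (n := n) (πC := πC) hι hinj hb h hc hc'
  have h2 : (restrictDual E G V πC π ι n η).base = c := by rw [restrictDual_eq hinj h]
  rw [FibreCore.chartAt_apply, h2]
  exact Prod.ext rfl (Prod.ext rfl h1)

/-- The extension to covectors off the sub-bundle retracts the base point to `C` and precomposes the
coordinates of the covector with the vertical derivative of `ι` at the retracted point. -/
theorem smooth_restrictDual (hemb : Manifold.IsSmoothEmbedding 𝓘(ℝ, E × G) 𝓘(ℝ, E × V) ∞ ι)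
    (s : dualOver E V π ι n) :
    ∃ (O : Set (Dual E V n π)) (F : Dual E V n π → Dual E G n πC), IsOpen O ∧
      (s : Dual E V n π) ∈ O ∧ ContMDiffOn 𝓘(ℝ, E × (V × (V →L[ℝ] Forms E n)))
        𝓘(ℝ, E × (G × (G →L[ℝ] Forms E n))) ∞ F O ∧
      ∀ s' : dualOver E V π ι n, (s' : Dual E V n π) ∈ O →
        F s' = restrictDual E G V πC π ι n s' := by
  obtain ⟨c₀, X, rfl⟩ := exists_eq_of_mem_dualOver s
  obtain ⟨O, F, B, hO, hcO, hOs, hF, hFO, hFι, -⟩ := exists_local_retraction hb hemb c₀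
  set Fhat : E × V → E × G :=
    fun u => chartAt (E × G) c₀ (F ((chartAt (E × V) (ι c₀)).symm u)) with hFhat
  -- Charts of a total space depend only on the base point of their centre, so the covector placed
  -- here is immaterial.
  set z₀ : Dual E G n πC := ⟨c₀, 0⟩ with hz₀
  set s₀ : Dual E V n π := ⟨ι c₀, X⟩ with hs₀
  have hFc : ∀ y ∈ O, Fhat (chartAt (E × V) (ι c₀) y) = chartAt (E × G) c₀ (F y) := fun y hy => by
    simp only [hFhat, (chartAt (E × V) (ι c₀)).left_inv (hOs hy)]
  refine ⟨FibreCore.Total.base ⁻¹' O, fun η =>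
      (chartAt (E × (G × (G →L[ℝ] Forms E n))) z₀).symm
    (restrictCoord Fhat (embVert E G V ι c₀) (chartAt (E × (V × (V →L[ℝ] Forms E n))) s₀ η)),
    hO.preimage (FibreCore.contMDiff_base _).continuous, hcO, fun η hη => ?_, fun η hη => ?_⟩
  · refine ContMDiffAt.contMDiffWithinAt ?_
    have hη' : η.base ∈ O := hη
    refine contMDiffAt_of_charts (k := s₀) (i := z₀)
      (fhat := restrictCoord Fhat (embVert E G V ι c₀)) (hOs hη) ?_ ?_
      (Filter.Eventually.of_forall fun _ => rfl)
    · change Fhat (chartAt (E × V) (ι c₀) η.base) ∈ (chartAt (E × G) c₀).target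
      rw [hFc _ hη']
      exact (chartAt (E × G) c₀).map_source (hFO hη').1
    · refine contDiffAt_restrictCoord ?_ ?_
      · exact contDiffAt_in_charts (hF.contMDiffAt (hO.mem_nhds hη')) (hOs hη') (hFO hη').1
      · change ContDiffAt ℝ ∞ (embVert E G V ι c₀) (Fhat (chartAt (E × V) (ι c₀) η.base))
        rw [hFc _ hη']
        exact contDiffAt_embVert hι (hFO hη').1 (hFO hη').2
  · obtain ⟨c, X', rfl⟩ := exists_eq_of_mem_dualOver η
    have hc : ι c ∈ O := hη
    have hcs := (hFO hc).1
    rw [hFι c hc] at hcs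
    have h1 := chartAt_restrictDual (πC := πC) hι hinj hb (c₀ := c₀) X 0
      (η := ⟨⟨ι c, X'⟩, c, rfl⟩) rfl hcs (hOs hc)
    have h2 : restrictDual E G V πC π ι n ⟨⟨ι c, X'⟩, c, rfl⟩ ∈
        (chartAt (E × (G × (G →L[ℝ] Forms E n))) z₀).source := by
      rw [restrictDual_eq (η := ⟨⟨ι c, X'⟩, c, rfl⟩) hinj rfl]
      exact hcs
    refine Eq.trans (congrArg _ ?_) ((chartAt _ z₀).left_inv h2)
    rw [h1]
    have h3 := hFc _ hc
    rw [hFι c hc] at h3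
    change ((Fhat (chartAt (E × V) (ι c₀) (ι c))).1, (Fhat (chartAt (E × V) (ι c₀) (ι c))).2,
      _ ∘L embVert E G V ι c₀ (Fhat (chartAt (E × V) (ι c₀) (ι c)))) = _
    rw [h3]

/-- A covector on `VC` is extended to the ambient vertical space by means of the smooth left
inverses `B`, corrected so that the section passes through `s`. -/
theorem section_restrictDual (hemb : Manifold.IsSmoothEmbedding 𝓘(ℝ, E × G) 𝓘(ℝ, E × V) ∞ ι)
    (s : dualOver E V π ι n) :
    ∃ (O : Set (Dual E G n πC)) (σ : Dual E G n πC → Dual E V n π), IsOpen O ∧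
      restrictDual E G V πC π ι n s ∈ O ∧
      ContMDiffOn 𝓘(ℝ, E × (G × (G →L[ℝ] Forms E n))) 𝓘(ℝ, E × (V × (V →L[ℝ] Forms E n))) ∞ σ O ∧
      σ (restrictDual E G V πC π ι n s) = s ∧
      ∀ z ∈ O, ∃ h : σ z ∈ dualOver E V π ι n, restrictDual E G V πC π ι n ⟨σ z, h⟩ = z := by
  obtain ⟨c₀, X, rfl⟩ := exists_eq_of_mem_dualOver s
  obtain ⟨O, F, B, hO, hcO, hOs, hF, hFO, hFι, hB⟩ := exists_local_retraction hb hemb c₀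
  set z₀ : Dual E G n πC := ⟨c₀, 0⟩ with hz₀
  set s₀ : Dual E V n π := ⟨ι c₀, X⟩ with hs₀
  have hU : IsOpen (ι ⁻¹' O) := hO.preimage hι.continuous
  have hcs : ∀ c, ι c ∈ O → c ∈ (chartAt (E × G) c₀).source := fun c hc => by
    have := (hFO hc).1
    rwa [hFι c hc] at this
  set σhat : E × (G × (G →L[ℝ] Forms E n)) → E × (V × (V →L[ℝ] Forms E n)) :=
    extendCoord (embCoord E G V ι c₀) (embVert E G V ι c₀) B X with hσhat
  have hrs : restrictDual E G V πC π ι n ⟨s₀, c₀, rfl⟩ = ⟨c₀, X ∘L vertDerivOf E G V ι c₀⟩ :=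
    restrictDual_eq (η := ⟨s₀, c₀, rfl⟩) hinj rfl
  have hσt : ∀ z : Dual E G n πC, ι z.base ∈ O → σhat (chartAt _ z₀ z) =
      ((chartAt (E × V) (ι c₀) (ι z.base)).1, (chartAt (E × V) (ι c₀) (ι z.base)).2,
        X + ((dualCore E G n πC).coord c₀ z - X ∘L embVert E G V ι c₀ (chartAt (E × G) c₀ z.base))
          ∘L B (chartAt (E × G) c₀ z.base)) := fun z hz => by
    have h1 := embCoord_chartAt (V := V) (ι := ι) (hcs _ hz)
    rw [← h1]
    rfl
  have hmem : ∀ z : Dual E G n πC, ι z.base ∈ O →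
      σhat (chartAt _ z₀ z) ∈ (chartAt (E × (V × (V →L[ℝ] Forms E n))) s₀).target := fun z hz => by
    rw [hσt z hz]
    exact (chartAt (E × V) (ι c₀)).map_source (hOs hz)
  have hbase : ∀ z : Dual E G n πC, ι z.base ∈ O →
      ((chartAt _ s₀).symm (σhat (chartAt _ z₀ z))).base = ι z.base := fun z hz => by
    rw [hσt z hz]
    exact (chartAt (E × V) (ι c₀)).left_inv (hOs hz)
  refine ⟨FibreCore.Total.base ⁻¹' (ι ⁻¹' O), fun z => (chartAt _ s₀).symm (σhat (chartAt _ z₀ z)),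
    hU.preimage (FibreCore.contMDiff_base _).continuous, ?_, fun z hz => ?_, ?_, fun z hz => ?_⟩
  · rw [mem_preimage, hrs]
    exact hcO
  · refine ContMDiffAt.contMDiffWithinAt ?_
    have hz' : ι z.base ∈ O := hz
    refine contMDiffAt_of_charts (k := z₀) (i := s₀) (fhat := σhat) (hcs _ hz') (hmem z hz') ?_
      (Filter.Eventually.of_forall fun _ => rfl)
    refine contDiffAt_extendCoord X ?_ ?_ ?_
    · exact contDiffAt_embCoord hι (hcs _ hz') (hOs hz')
    · exact contDiffAt_embVert hι (hcs _ hz') (hOs hz')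
    · exact (hB _ hz').1
  · have h1 : ι (restrictDual E G V πC π ι n ⟨s₀, c₀, rfl⟩).base ∈ O := by
      rw [hrs]; exact hcO
    refine Eq.trans (congrArg _ ?_) ((chartAt _ s₀).left_inv (mem_chart_source _ s₀))
    rw [hσt _ h1]
    have h2 := coord_restrictDual (n := n) (πC := πC) hι hinj hb (c₀ := c₀) (c := c₀)
      (η := ⟨s₀, c₀, rfl⟩) rfl (mem_chart_source _ _) (mem_chart_source _ _)
    rw [h2, hrs]
    have h3 : (dualCore E V n π).coord (ι c₀) s₀ = X := (dualCore E V n π).coord_base s₀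
    simp only [h3]
    rw [extend_restrict]
    exact Prod.ext rfl (Prod.ext rfl h3.symm)
  · have hz' : ι z.base ∈ O := hz
    refine ⟨⟨z.base, (hbase z hz').symm⟩, ?_⟩
    refine (dualCore E G n πC).ext_coord (i := c₀) (hinj ?_) ?_ ?_
    · exact (base_restrictDual (πC := πC) (ι := ι) _).trans (hbase z hz')
    · rw [restrictDual_eq hinj (hbase z hz')]
      exact hcs _ hz'
    · rw [coord_restrictDual hι hinj hb (hbase z hz') (hcs _ hz') (hOs hz')]
      have h2 := (dualCore E V n π).coord_chartAt_symm (z₀ := s₀) (hmem z hz')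
      change (dualCore E V n π).coord (ι c₀) _ = _ at h2
      rw [h2, hσt z hz']
      exact extend_comp_of_leftInverse (hB _ hz').2 _ _

end Restrict

end

noncomputable section

/-! ### Pullback of the canonical form under restriction of covectors. -/

section RestrictReduction

/-- Differentiate the two relations that tie a covector to its restriction: the base points
correspond under `f`, and the covector is precomposed with the vertical derivative of `f`. The
product rule in the second relation yields the term with the second derivative of `f`, the only
obstruction to a direct comparison of the forms. -/
theorem deriv_restrictCoord {E G V N : Type*} [NormedAddCommGroup E] [NormedSpace ℝ E]
    [NormedAddCommGroup G] [NormedSpace ℝ G] [NormedAddCommGroup V] [NormedSpace ℝ V]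
    [NormedAddCommGroup N] [NormedSpace ℝ N] {f : E × G → E × V} {x₀ : E}
    {u : ℝ → G × (G →L[ℝ] N)} {y : ℝ → V × (V →L[ℝ] N)} {u' : G × (G →L[ℝ] N)}
    {y' : V × (V →L[ℝ] N)} (hf : ContDiffAt ℝ ∞ f (x₀, (u 0).1)) (hu : HasDerivAt u u' 0)
    (hy : HasDerivAt y y' 0) (h : ∀ᶠ t in 𝓝 0, (y t).1 = (f (x₀, (u t).1)).2)
    (h' : ∀ᶠ t in 𝓝 0, (u t).2 = (y t).2 ∘L (ContinuousLinearMap.snd ℝ E V ∘L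
      fderiv ℝ f (x₀, (u t).1) ∘L ContinuousLinearMap.inr ℝ E G)) :
    y'.1 = (fderiv ℝ f (x₀, (u 0).1) (0, u'.1)).2 ∧
    ∀ g, u'.2 g = y'.2 (fderiv ℝ f (x₀, (u 0).1) (0, g)).2 +
      (y 0).2 (fderiv ℝ (fderiv ℝ f) (x₀, (u 0).1) (0, u'.1) (0, g)).2 := by
  have hu₁ : HasDerivAt (fun t => (u t).1) u'.1 0 :=
    (ContinuousLinearMap.fst ℝ G (G →L[ℝ] N)).hasFDerivAt.comp_hasDerivAt (0 : ℝ) hu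
  have hu₂ : HasDerivAt (fun t => (u t).2) u'.2 0 :=
    (ContinuousLinearMap.snd ℝ G (G →L[ℝ] N)).hasFDerivAt.comp_hasDerivAt (0 : ℝ) hu
  have hy₁ : HasDerivAt (fun t => (y t).1) y'.1 0 :=
    (ContinuousLinearMap.fst ℝ V (V →L[ℝ] N)).hasFDerivAt.comp_hasDerivAt (0 : ℝ) hy
  have hy₂ : HasDerivAt (fun t => (y t).2) y'.2 0 :=
    (ContinuousLinearMap.snd ℝ V (V →L[ℝ] N)).hasFDerivAt.comp_hasDerivAt (0 : ℝ) hy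
  have hc : HasDerivAt (fun t => (x₀, (u t).1)) ((0 : E), u'.1) 0 :=
    (hasDerivAt_const 0 x₀).prodMk hu₁
  have h1 := (hf.differentiableAt (by simp)).hasFDerivAt.comp_hasDerivAt (0 : ℝ) hc
  have hf' : ContDiffAt ℝ ∞ (fderiv ℝ f) (x₀, (u 0).1) := hf.fderiv_right (by simp)
  have h2 := (hf'.differentiableAt (by simp)).hasFDerivAt.comp_hasDerivAt (0 : ℝ) hc
  refine ⟨?_, fun g => ?_⟩
  · have h3 := (ContinuousLinearMap.snd ℝ E V).hasFDerivAt.comp_hasDerivAt (0 : ℝ) h1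
    exact hy₁.unique (h3.congr_of_eventuallyEq h)
  · have h3 : HasDerivAt (fun t => (u t).2 g) (u'.2 g) 0 := by
      simpa using hu₂.clm_apply (hasDerivAt_const 0 g)
    have h4 : HasDerivAt (fun t => fderiv ℝ f (x₀, (u t).1) (0, g))
        (fderiv ℝ (fderiv ℝ f) (x₀, (u 0).1) (0, u'.1) (0, g)) 0 := by
      simpa using h2.clm_apply (hasDerivAt_const 0 ((0 : E), g))
    have h5 := (ContinuousLinearMap.snd ℝ E V).hasFDerivAt.comp_hasDerivAt (0 : ℝ) h4
    refine h3.unique ((hy₂.clm_apply h5).congr_of_eventuallyEq ?_)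
    filter_upwards [h'] with t ht
    rw [ht]
    rfl

variable {E G V M C J : Type*} [NormedAddCommGroup E] [NormedSpace ℝ E] [NormedAddCommGroup G]
  [NormedSpace ℝ G] [NormedAddCommGroup V] [NormedSpace ℝ V]
  [TopologicalSpace M] [ChartedSpace E M] [IsManifold 𝓘(ℝ, E) ∞ M]
  [TopologicalSpace C] [ChartedSpace (E × G) C] [IsManifold 𝓘(ℝ, E × G) ∞ C]
  [TopologicalSpace J] [ChartedSpace (E × V) J] [IsManifold 𝓘(ℝ, E × V) ∞ J]
  {πC : C → M} [IsFibred E G πC] {π : J → M} [IsFibred E V π] {ι : C → J} {n : ℕ}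
  (hb : ∀ c, π (ι c) = πC c) (hemb : Manifold.IsSmoothEmbedding 𝓘(ℝ, E × G) 𝓘(ℝ, E × V) ∞ ι)

include hb hemb

theorem vel_restrictDual {γ : ℝ → dualOver E V π ι n}
    (hγ : IsVertCurve E (V × (V →L[ℝ] Forms E n)) (dualProj E V n π) γ) {c₀ : C}
    {X : V →L[ℝ] Forms E n} (h0 : γ 0 = ⟨⟨ι c₀, X⟩, c₀, rfl⟩) :
    (vel E (V × (V →L[ℝ] Forms E n)) (fun t => (γ t : Dual E V n π)) 0).1 =
      (fderiv ℝ (embCoord E G V ι c₀) (chartAt (E × G) c₀ c₀) (0, (vel E (G × (G →L[ℝ] Forms E n))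
        (restrictDual E G V πC π ι n ∘ γ) 0).1)).2 ∧
    ∀ g, (vel E (G × (G →L[ℝ] Forms E n)) (restrictDual E G V πC π ι n ∘ γ) 0).2 g =
      (vel E (V × (V →L[ℝ] Forms E n)) (fun t => (γ t : Dual E V n π)) 0).2
        (fderiv ℝ (embCoord E G V ι c₀) (chartAt (E × G) c₀ c₀) (0, g)).2 +
      X (fderiv ℝ (fderiv ℝ (embCoord E G V ι c₀)) (chartAt (E × G) c₀ c₀)
        (0, (vel E (G × (G →L[ℝ] Forms E n)) (restrictDual E G V πC π ι n ∘ γ) 0).1) (0, g)).2 := by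
  have hι := hemb.contMDiff
  have hinj := hemb.isEmbedding.injective
  set δ := restrictDual E G V πC π ι n ∘ γ with hδ
  set s₀ : Dual E V n π := ⟨ι c₀, X⟩ with hs₀
  have hγ0 : (γ 0 : Dual E V n π) = s₀ := congrArg Subtype.val h0
  set z₀ : Dual E G n πC := ⟨c₀, X ∘L vertDerivOf E G V ι c₀⟩ with hz₀
  have hδ0 : δ 0 = z₀ := by
    rw [hδ, Function.comp_apply, h0]
    exact restrictDual_eq (η := ⟨s₀, c₀, rfl⟩) hinj rfl
  have hδs : ContMDiff 𝓘(ℝ, ℝ) 𝓘(ℝ, E × (G × (G →L[ℝ] Forms E n))) ∞ δ :=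
    contMDiff_comp_curve (f := restrictDual E G V πC π ι n)
      (smooth_restrictDual hι hinj hb hemb) hγ.smooth
  have hδb : ∀ t, ι (δ t).base = (γ t : Dual E V n π).base := fun t => base_restrictDual (γ t)
  have hδπ : ∀ t, πC (δ t).base = π (γ t : Dual E V n π).base := fun t => by rw [← hδb, hb]
  have hγv : ∀ t, π (γ t : Dual E V n π).base = π (γ 0 : Dual E V n π).base := hγ.vertical
  have hδv : ∀ t, dualProj E G n πC (δ t) = dualProj E G n πC (δ 0) := fun t => by
    change πC (δ t).base = πC (δ 0).base
    rw [hδπ, hδπ, hγv]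
  have e₁ := hasDerivAt_snd_chart (π := dualProj E G n πC) (i := z₀)
    ((hδs 0).mdifferentiableAt (by simp)) (Filter.Eventually.of_forall hδv)
    (by rw [hδ0]; exact mem_chart_source _ _)
  rw [hδ0, fibreBlock_tcc_self (mem_chart_source _ _)] at e₁
  have e₂ := hasDerivAt_snd_chart (π := dualProj E V n π) (i := s₀)
    ((hγ.smooth 0).mdifferentiableAt (by simp)) (Filter.Eventually.of_forall hγ.vertical)
    (by rw [hγ0]; exact mem_chart_source _ _)
  rw [hγ0, fibreBlock_tcc_self (mem_chart_source _ _)] at e₂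
  set b := vel E (G × (G →L[ℝ] Forms E n)) δ 0
  set a := vel E (V × (V →L[ℝ] Forms E n)) (fun t => (γ t : Dual E V n π)) 0
  have hw₀ : ((chartAt (E × G) c₀ c₀).1,
      (chartAt (E × (G × (G →L[ℝ] Forms E n))) z₀ (δ 0)).2.1) = chartAt (E × G) c₀ c₀ := by
    rw [hδ0]; rfl
  have hev : ∀ᶠ t in 𝓝 (0 : ℝ), (δ t).base ∈ (chartAt (E × G) c₀).source ∧
      ι (δ t).base ∈ (chartAt (E × V) (ι c₀)).source := by
    have h1 := hδs.continuous.continuousAt.eventually_mem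
      ((chartAt (E × (G × (G →L[ℝ] Forms E n))) z₀).open_source.mem_nhds
        (show δ 0 ∈ _ by rw [hδ0]; exact mem_chart_source _ _))
    have h2 := hγ.smooth.continuous.continuousAt.eventually_mem
      ((chartAt (E × (V × (V →L[ℝ] Forms E n))) s₀).open_source.mem_nhds
        (show (γ 0 : Dual E V n π) ∈ _ by rw [hγ0]; exact mem_chart_source _ _))
    filter_upwards [h1, h2] with t ht1 ht2
    refine ⟨ht1, ?_⟩
    rw [hδb]
    exact ht2
  have hu : ∀ᶠ t in 𝓝 (0 : ℝ), ((chartAt (E × G) c₀ c₀).1,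
      (chartAt (E × (G × (G →L[ℝ] Forms E n))) z₀ (δ t)).2.1) =
      chartAt (E × G) c₀ (δ t).base := by
    filter_upwards [hev] with t ht
    refine Prod.ext ?_ rfl
    rw [IsFibred.fst_chart (E := E) (G := G) (π := πC) _ _ ht.1,
      IsFibred.fst_chart (E := E) (G := G) (π := πC) c₀ c₀ (mem_chart_source _ _)]
    have := hδv t
    rw [hδ0] at this
    exact congrArg _ this.symm
  have hcd : ContDiffAt ℝ ∞ (embCoord E G V ι c₀) ((chartAt (E × G) c₀ c₀).1,
      (chartAt (E × (G × (G →L[ℝ] Forms E n))) z₀ (δ 0)).2.1) := by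
    rw [hw₀]
    exact contDiffAt_embCoord hι (mem_chart_source _ _) (mem_chart_source _ _)
  have key := deriv_restrictCoord (f := embCoord E G V ι c₀)
    hcd e₁ e₂
    (by
      filter_upwards [hu, hev] with t ht ht'
      rw [ht, embCoord_chartAt ht'.1, hδb]
      rfl)
    (by
      filter_upwards [hu, hev] with t ht ht'
      rw [ht]
      have h1 := chartAt_restrictDual (πC := πC) hι hinj hb (c₀ := c₀) X
        (X ∘L vertDerivOf E G V ι c₀) (η := γ t) (hδb t).symm ht'.1 ht'.2
      exact congrArg (fun w : E × (G × (G →L[ℝ] Forms E n)) => w.2.2) h1)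
  simp only [hw₀, hγ0] at key
  have hX : (chartAt (E × (V × (V →L[ℝ] Forms E n))) s₀ s₀).2.2 = X :=
    (dualCore E V n π).coord_base s₀
  rw [hX] at key
  exact key

theorem isReduction_restrictDual [FiniteDimensional ℝ E] [FiniteDimensional ℝ G]
    [FiniteDimensional ℝ V] (hn : Module.finrank ℝ E = n) :
    IsReduction E (V × (V →L[ℝ] Forms E n)) (G × (G →L[ℝ] Forms E n)) (dualProj E V n π)
      (dualOver E V π ι n) (canonForm E V n π) (dualProj E G n πC) (canonForm E G n πC)
      (restrictDual E G V πC π ι n) := by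
  have hι := hemb.contMDiff
  have hinj := hemb.isEmbedding.injective
  refine isReduction_of_pullback (fun s => ?_) (smooth_restrictDual hι hinj hb hemb) (fun z => ?_)
    (section_restrictDual hι hinj hb hemb) (fun γ₁ γ₂ h₁ h₂ h₁₂ => ?_)
    (canonForm_nondegenerate hn πC) (fun s s' h => ?_)
  · change πC (restrictDual E G V πC π ι n s).base = π (s : Dual E V n π).base
    rw [← base_restrictDual (G := G) (πC := πC) s, hb]
  -- The vertical derivative is injective, and composing a covector with a left inverse extends it.
  · obtain ⟨L, hL⟩ := exists_leftInverse_of_injective _ (vertDerivOf_injective hb hemb z.base)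
    refine ⟨⟨⟨ι z.base, z.fib ∘L L⟩, z.base, rfl⟩, ?_⟩
    rw [restrictDual_eq (η := ⟨⟨ι z.base, z.fib ∘L L⟩, z.base, rfl⟩) hinj rfl]
    refine FibreCore.Total.ext rfl ?_
    ext1 g
    simp [hL]
  · obtain ⟨c₀, X, h0⟩ := exists_eq_of_mem_dualOver (γ₁ 0)
    obtain ⟨e₁, e₁'⟩ := vel_restrictDual hb hemb h₁ h0
    obtain ⟨e₂, e₂'⟩ := vel_restrictDual hb hemb h₂ (h₁₂.symm.trans h0)
    -- The two terms with second derivatives occur with opposite signs in the two-form, with the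
    -- velocities exchanged; symmetry cancels them.
    have hsymm : IsSymmSndFDerivAt ℝ (embCoord E G V ι c₀) (chartAt (E × G) c₀ c₀) :=
      (contDiffAt_embCoord hι (mem_chart_source _ _) (mem_chart_source _ _)).isSymmSndFDerivAt
        (by simp only [minSmoothness_of_isRCLikeNormedField]
            exact WithTop.coe_le_coe.2 (le_top : (2 : ℕ∞) ≤ ⊤))
    change twoForm _ _ = twoForm _ _
    rw [twoForm_apply, twoForm_apply, pairing_apply, pairing_apply, pairing_apply, pairing_apply,
      e₁', e₂', e₁, e₂, hsymm.eq]
    abel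
  · obtain ⟨c, X, rfl⟩ := exists_eq_of_mem_dualOver s
    obtain ⟨c', X', rfl⟩ := exists_eq_of_mem_dualOver s'
    rw [restrictDual_eq (η := ⟨⟨ι c, X⟩, c, rfl⟩) hinj rfl,
      restrictDual_eq (η := ⟨⟨ι c', X'⟩, c', rfl⟩) hinj rfl] at h
    obtain rfl : c = c' := congrArg FibreCore.Total.base h
    have hX : X ∘L vertDerivOf E G V ι c = X' ∘L vertDerivOf E G V ι c := by
      injection h
    -- Covectors over `c` with a given restriction form an affine space, so the segment between two
    -- of them stays in the fibre.
    refine ⟨fun t => ⟨⟨ι c, lineCurve X X' t⟩, c, rfl⟩, ⟨?_, fun _ => rfl⟩, fun t => ?_, ?_, ?_⟩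
    · exact (dualCore E V n π).contMDiff_fibre_curve (ι c) (contDiff_lineCurve X X')
    · rw [restrictDual_eq (η := ⟨⟨ι c, lineCurve X X' t⟩, c, rfl⟩) hinj rfl,
        restrictDual_eq (η := ⟨⟨ι c, X⟩, c, rfl⟩) hinj rfl, lineCurve_comp, ← hX, lineCurve_self]
    · exact Subtype.ext (FibreCore.Total.ext rfl (lineCurve_zero X X'))
    · exact Subtype.ext (FibreCore.Total.ext rfl (lineCurve_one X X'))

end RestrictReduction

end

noncomputable section

/-! ### The constrained reductions -/

section Constrained

variable {E F GC M Q C : Type*}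
  [NormedAddCommGroup E] [NormedSpace ℝ E] [FiniteDimensional ℝ E]
  [NormedAddCommGroup F] [NormedSpace ℝ F] [FiniteDimensional ℝ F]
  [NormedAddCommGroup GC] [NormedSpace ℝ GC] [FiniteDimensional ℝ GC]
  [TopologicalSpace M] [ChartedSpace E M] [IsManifold 𝓘(ℝ, E) ∞ M]
  [TopologicalSpace Q] [ChartedSpace (E × F) Q] [IsManifold 𝓘(ℝ, E × F) ∞ Q]
  [TopologicalSpace C] [ChartedSpace (E × GC) C] [IsManifold 𝓘(ℝ, E × GC) ∞ C]
  {d : ℕ} {π : Q → M} [IsFibred E F π] {πC : C → M} [IsFibred E GC πC]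
  {ι : C → Jet E F π}

theorem isReduction_restrictCov {n : ℕ} (hn : Module.finrank ℝ E = n)
    (hι : IsSubbundle E F GC π πC ι) :
    IsReduction E (JetVert E F × (JetVert E F →L[ℝ] Forms E n)) (GC × (GC →L[ℝ] Forms E n))
      (covProj E F n π) (covOver E F ι n) (canonForm E (JetVert E F) n (jetProj E F π))
      (dualProj E GC n πC) (canonForm E GC n πC) (restrictCov E F GC πC ι n) :=
  isReduction_restrictDual (π := jetProj E F π) hι.over_base hι.isSmoothEmbedding hn

/-- Surjectivity, smoothness, sections and the form identity are obtained by composing those of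
`Psi` and of the restriction. Only the connectedness of the fibres is argued directly. -/
theorem isReduction_PsiC (hd : Module.finrank ℝ E = d + 1) (hι : IsSubbundle E F GC π πC ι) :
    IsReduction E (JetPhaseVert E F d) (GC × (GC →L[ℝ] Forms E (d + 1)))
      (jetPhaseProj E F d π) (jetPhaseOver E F ι d) (omegaTilde E F d π)
      (dualProj E GC (d + 1) πC) (canonForm E GC (d + 1) πC) (PsiC E F GC πC ι d) := by
  have hr := isReduction_restrictCov (πC := πC) hd hι
  have hinj := hι.isSmoothEmbedding.isEmbedding.injective
  have hΨ := contMDiff_Psi (E := E) (F := F) (d := d) π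
  refine isReduction_of_pullback (fun s => hr.over_base ⟨Psi E F d π s, s.2⟩) (fun s => ?_)
    (fun z => ?_) (fun s => ?_) (fun γ₁ γ₂ h₁ h₂ h₁₂ => ?_) (canonForm_nondegenerate hd πC)
    (fun s s' h => ?_)
  · obtain ⟨O, f, hO, hs, hf, hfr⟩ := hr.smooth ⟨Psi E F d π s, s.2⟩
    exact ⟨Psi E F d π ⁻¹' O, f ∘ Psi E F d π, hO.preimage hΨ.continuous, hs,
      hf.comp hΨ.contMDiffOn (fun _ h => h), fun s' hs' => hfr ⟨Psi E F d π s', s'.2⟩ hs'⟩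
  · obtain ⟨η, hη⟩ := hr.surjective z
    obtain ⟨ζ, hζ⟩ := (isReduction_Psi π hd).surjective (η : Cov E F (d + 1) π)
    have hζ' : Psi E F d π (ζ : JetPhase E F d π) = (η : Cov E F (d + 1) π) := hζ
    have hS : jetPi E F d π (ζ : JetPhase E F d π) ∈ range ι := by
      have h1 : jetPi E F d π (ζ : JetPhase E F d π) = (η : Cov E F (d + 1) π).base :=
        congrArg FibreCore.Total.base hζ'
      rw [h1]
      exact η.2
    refine ⟨⟨ζ, hS⟩, Eq.trans ?_ hη⟩
    exact congrArg (restrictCov E F GC πC ι (d + 1)) (Subtype.ext hζ')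
  · obtain ⟨O, σ, hO, hs, hσ, hσs, hσr⟩ := hr.section_through ⟨Psi E F d π s, s.2⟩
    obtain ⟨O₂, τ, hO₂, hs₂, hτ, hτs, hτΨ⟩ := exists_section_Psi π hd (s : JetPhase E F d π)
    -- The section of `Ψ` is only local, so the domain is cut down to the points which the first
    -- section sends into its domain.
    refine ⟨O ∩ σ ⁻¹' O₂, τ ∘ σ, hσ.continuousOn.isOpen_inter_preimage hO hO₂,
      ⟨hs, ?_⟩, hτ.comp (hσ.mono inter_subset_left) (fun _ h => h.2), ?_, fun z hz => ?_⟩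
    · change σ (restrictCov E F GC πC ι (d + 1) ⟨Psi E F d π s, s.2⟩) ∈ O₂
      rw [hσs]
      exact hs₂
    · change τ (σ (restrictCov E F GC πC ι (d + 1) ⟨Psi E F d π s, s.2⟩)) = s
      rw [hσs]
      exact hτs
    · obtain ⟨h, hz'⟩ := hσr z hz.1
      have h1 : Psi E F d π (τ (σ z)) = σ z := hτΨ _ hz.2
      have h2 : (Psi E F d π (τ (σ z))).base ∈ range ι := by
        rw [h1]
        exact h
      refine ⟨h2, Eq.trans ?_ hz'⟩
      exact congrArg (restrictCov E F GC πC ι (d + 1)) (Subtype.ext h1)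
  -- `Ψ` maps vertical curves over `C` to vertical curves of covectors over `C`. The form identity
  -- of the restriction applies to these images, and the one of `Ψ` then returns to `J¹P`.
  · have hc : ∀ γ : ℝ → jetPhaseOver E F ι d, IsVertCurve E (JetPhaseVert E F d)
        (jetPhaseProj E F d π) γ → IsVertCurve E (JetVert E F × (JetVert E F →L[ℝ] Forms E (d + 1)))
        (covProj E F (d + 1) π) (S := covOver E F ι (d + 1))
        (fun t => ⟨Psi E F d π (γ t), (γ t).2⟩) := fun γ h => ⟨hΨ.comp h.smooth, h.vertical⟩
    have h0 := (hr.form _).2 rfl _ _ (hc γ₁ h₁) (hc γ₂ h₂)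
      (Subtype.ext (congrArg (fun s : jetPhaseOver E F ι d => Psi E F d π s) h₁₂))
    refine h0.trans ?_
    have e₁ := vel_Psi π h₁.smooth h₁.vertical
    have e₂ := vel_Psi π h₂.smooth h₂.vertical
    refine Eq.trans ?_ (twoForm_pairing_psiVert (altForm E d) _ _)
    rw [← e₁, ← e₂]
    rfl
  · have hb : ∀ s : jetPhaseOver E F ι d, ι (PsiC E F GC πC ι d s).base =
        jetPi E F d π (s : JetPhase E F d π) := fun s => s.2.choose_spec
    have hP : ∀ (s : jetPhaseOver E F ι d) (c : C), jetPi E F d π (s : JetPhase E F d π) = ι c →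
        PsiC E F GC πC ι d s =
          ⟨c, (Psi E F d π (s : JetPhase E F d π)).fib ∘L vertDeriv E F GC ι c⟩ := fun s c hc =>
      restrictDual_eq (E := E) (G := GC) (V := JetVert E F) (π := jetProj E F π) (πC := πC) hinj
        (η := ⟨Psi E F d π s, s.2⟩) hc
    obtain ⟨γ, hγ, h0, h1, hj, hγf⟩ := exists_curve_jetPhase π (s : JetPhase E F d π) s' (by
      rw [← hb, ← hb, h])
    obtain ⟨c, hc⟩ := s.2
    have hc' : jetPi E F d π (s' : JetPhase E F d π) = ι c := by
      rw [← hb, ← h, hb]; exact hc.symm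
    have h2 : (⟨c, _⟩ : Dual E GC (d + 1) πC) = ⟨c, _⟩ :=
      (hP s c hc.symm).symm.trans (h.trans (hP s' c hc'))
    have h3 : (Psi E F d π (s : JetPhase E F d π)).fib ∘L vertDeriv E F GC ι c =
      (Psi E F d π (s' : JetPhase E F d π)).fib ∘L vertDeriv E F GC ι c := by
      injection h2
    -- Along this curve the image under `Ψ` runs through the segment between two covectors with the
    -- same restriction, so the restriction does not change.
    refine ⟨fun t => ⟨γ t, ⟨c, hc.trans (hj t).symm⟩⟩, ⟨hγ, fun t => ?_⟩, fun t => ?_, Subtype.ext h0,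
      Subtype.ext h1⟩
    · exact congrArg (jetProj E F π) ((hj t).trans (hj 0).symm)
    · rw [hP s c hc.symm, hP _ c ((hj t).trans hc.symm)]
      refine FibreCore.Total.ext rfl ?_
      change (Psi E F d π (γ t)).fib ∘L _ = (Psi E F d π (s : JetPhase E F d π)).fib ∘L _
      rw [hγf, lineCurve_comp, ← h3]
      exact lineCurve_self _ t

end Constrained

end

noncomputable section

/-! ### The canonical form is symplectic -/

section Symplectic

theorem hasDerivAt_prod_clm_comp {G N N' : Type*} [NormedAddCommGroup G] [NormedSpace ℝ G]
    [NormedAddCommGroup N] [NormedSpace ℝ N] [NormedAddCommGroup N'] [NormedSpace ℝ N']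
    (P : N →L[ℝ] N') {u : ℝ → G × (G →L[ℝ] N)} {u' : G × (G →L[ℝ] N)} {t : ℝ}
    (hu : HasDerivAt u u' t) :
    HasDerivAt (fun t => ((u t).1, P ∘L (u t).2)) (u'.1, P ∘L u'.2) t :=
  ((ContinuousLinearMap.fst ℝ G (G →L[ℝ] N)).hasFDerivAt.comp_hasDerivAt t hu).prodMk
    ((ContinuousLinearMap.compL ℝ G N N' P ∘L
      ContinuousLinearMap.snd ℝ G (G →L[ℝ] N)).hasFDerivAt.comp_hasDerivAt t hu)

theorem extDeriv_eq_zero_of_eventually_const {V N : Type*} [NormedAddCommGroup V] [NormedSpace ℝ V]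
    [NormedAddCommGroup N] [NormedSpace ℝ N] {k : ℕ} {f : V → V [⋀^Fin k]→L[ℝ] N}
    {c : V [⋀^Fin k]→L[ℝ] N} {x : V} (h : f =ᶠ[𝓝 x] fun _ => c) : extDeriv f x = 0 := by
  rw [h.extDeriv_eq, extDeriv, fderiv_fun_const]
  exact map_zero (ContinuousAlternatingMap.alternatizeUncurryFinCLM ℝ V N (n := k))

variable {E G M Y : Type*} [NormedAddCommGroup E] [NormedSpace ℝ E] [NormedAddCommGroup G]
  [NormedSpace ℝ G] [TopologicalSpace M] [ChartedSpace E M] [IsManifold 𝓘(ℝ, E) ∞ M]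
  [TopologicalSpace Y] [ChartedSpace (E × G) Y] [IsManifold 𝓘(ℝ, E × G) ∞ Y]
  (π : Y → M) [IsFibred E G π] {n : ℕ}

/-- The change of the covector coordinates between two charts. -/
theorem pullForm_coord {i j : Y} (η : Dual E G n π) (hi : η.base ∈ (chartAt (E × G) i).source)
    (hj : η.base ∈ (chartAt (E × G) j).source) :
    pullForm n (tangentCoordChange 𝓘(ℝ, E) (π i) (π j) (π η.base)) ∘L
        (dualCore E G n π).coord j η =
      (dualCore E G n π).coord i η ∘L fibreBlock (tcc E G j i η.base) := by
  have hself := (dualCore E G n π).coordChange_comp η.base i j η.base (mem_chart_source _ _) hi hj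
    η.fib
  have hs := (dualCore E G n π).coordChange_comp η.base j i η.base (mem_chart_source _ _) hj hi
    η.fib
  change (dualCore E G n π).coordChange j i η.base ((dualCore E G n π).coord j η) =
    (dualCore E G n π).coord i η at hs
  change pullForm n (baseBlock (tcc E G i j η.base)) ∘L (dualCore E G n π).coord j η ∘L
    fibreBlock (tcc E G i j η.base) = _ at hs
  rw [baseBlock_tcc π hi hj] at hs
  rw [← hs]
  ext1 v
  simp only [ContinuousLinearMap.comp_apply]
  rw [fibreBlock_tcc_comp π hj hi hj, fibreBlock_tcc_self hj]

/-- The velocity of a vertical curve of covectors in two charts. -/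
theorem vel_dual_charts {γ : ℝ → Dual E G n π} {i : Dual E G n π}
    (hγ : ContMDiff 𝓘(ℝ, ℝ) 𝓘(ℝ, E × (G × (G →L[ℝ] Forms E n))) ∞ γ)
    (hv : ∀ t, π (γ t).base = π (γ 0).base)
    (hi : (γ 0).base ∈ (chartAt (E × G) i.base).source) {a b : G × (G →L[ℝ] Forms E n)}
    (hb : vel E (G × (G →L[ℝ] Forms E n)) γ 0 = b)
    (ha : fibreBlock (tcc E (G × (G →L[ℝ] Forms E n)) (γ 0) i (γ 0)) b = a) :
    let y := (γ 0).base
    let f := chartAt (E × G) i.base ∘ (chartAt (E × G) y).symm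
    a.1 = (fderiv ℝ f (chartAt (E × G) y y) (0, b.1)).2 ∧
    ∀ g, pullForm n (tangentCoordChange 𝓘(ℝ, E) (π i.base) (π y) (π y)) (b.2 g) =
      a.2 (fderiv ℝ f (chartAt (E × G) y y) (0, g)).2 +
        ((dualCore E G n π).coord i.base (γ 0))
          (fderiv ℝ (fderiv ℝ f) (chartAt (E × G) y y) (0, b.1) (0, g)).2 := by
  intro y f
  have hys := mem_chart_source (E × G) y
  have e₁ := hasDerivAt_snd_chart (π := dualProj E G n π) (i := γ 0)
    ((hγ 0).mdifferentiableAt (by simp)) (Filter.Eventually.of_forall hv) (mem_chart_source _ _)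
  rw [fibreBlock_tcc_self (mem_chart_source _ _), hb] at e₁
  have e₂ := hasDerivAt_snd_chart (π := dualProj E G n π) (i := i)
    ((hγ 0).mdifferentiableAt (by simp)) (Filter.Eventually.of_forall hv) hi
  rw [hb, ha] at e₂
  -- The change of base coordinates depends only on the point of `M`, which is constant along a
  -- vertical curve; so `P` is a fixed linear map.
  set P := pullForm n (tangentCoordChange 𝓘(ℝ, E) (π i.base) (π y) (π y)) with hP
  have e₁' := hasDerivAt_prod_clm_comp P e₁
  have hw : ∀ t, (γ t).base ∈ (chartAt (E × G) y).source → ((chartAt (E × G) y y).1,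
      (chartAt (E × G) y (γ t).base).2) = chartAt (E × G) y (γ t).base := fun t ht => by
    refine Prod.ext ?_ rfl
    rw [IsFibred.fst_chart (E := E) (G := G) (π := π) _ _ ht,
      IsFibred.fst_chart (E := E) (G := G) (π := π) _ _ hys]
    exact congrArg _ (hv t).symm
  have hev : ∀ᶠ t in 𝓝 (0 : ℝ), (γ t).base ∈ (chartAt (E × G) y).source ∧
      (γ t).base ∈ (chartAt (E × G) i.base).source := by
    have hc : ContinuousAt (fun t => (γ t).base) 0 :=
      ((FibreCore.contMDiff_base _).continuous.comp hγ.continuous).continuousAt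
    have h1 := hc.eventually_mem ((chartAt (E × G) y).open_source.mem_nhds hys)
    have h2 := hc.eventually_mem ((chartAt (E × G) i.base).open_source.mem_nhds hi)
    filter_upwards [h1, h2] with t ht1 ht2
    exact ⟨ht1, ht2⟩
  -- A change of charts acts on covectors like restriction along the transition map, so the
  -- computation made for the embedding applies again.
  have key := deriv_restrictCoord (f := f) (x₀ := (chartAt (E × G) y y).1)
    (u := fun t => ((chartAt (E × (G × (G →L[ℝ] Forms E n))) (γ 0) (γ t)).2.1,
      P ∘L (chartAt (E × (G × (G →L[ℝ] Forms E n))) (γ 0) (γ t)).2.2))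
    (y := fun t => (chartAt (E × (G × (G →L[ℝ] Forms E n))) i (γ t)).2)
    (u' := (b.1, P ∘L b.2)) (y' := a)
    (show ContDiffAt ℝ ∞ f (chartAt (E × G) y y) from
      contDiffAt_chart_change (W := E × G) hys hi) e₁' e₂
    (by
      filter_upwards [hev] with t ht
      change _ = (f ((chartAt (E × G) y y).1, (chartAt (E × G) y (γ t).base).2)).2
      rw [hw t ht.1]
      change _ = (chartAt (E × G) i.base ((chartAt (E × G) y).symm _)).2
      rw [(chartAt (E × G) y).left_inv ht.1]
      rfl)
    (by
      filter_upwards [hev] with t ht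
      have h1 := pullForm_coord π (γ t) ht.2 ht.1
      rw [hv t] at h1
      change P ∘L (dualCore E G n π).coord y (γ t) = (dualCore E G n π).coord i.base (γ t) ∘L
        (ContinuousLinearMap.snd ℝ E G ∘L fderiv ℝ f ((chartAt (E × G) y y).1,
          (chartAt (E × G) y (γ t).base).2) ∘L ContinuousLinearMap.inr ℝ E G)
      rw [hw t ht.1, (hasFDerivAt_chart_change (W := E × G) ht.1 ht.2).fderiv]
      exact h1)
  exact key

theorem FibreCore.fibreBlock_tcc_inverse (π : Y → M) [IsFibred E G π] {K : Type*}
    [NormedAddCommGroup K] [NormedSpace ℝ K] (c : FibreCore E G Y K) {i y : c.Total}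
    (h : y.base ∈ (chartAt (E × G) i.base).source) (a : G × K) :
    fibreBlock (tcc E (G × K) y i y) (fibreBlock (tcc E (G × K) i y y) a) = a := by
  have hi : y ∈ (chartAt (E × (G × K)) i).source := h
  rw [fibreBlock_tcc_comp (c.proj π) hi (mem_chart_source _ _) hi, fibreBlock_tcc_self hi]

theorem FibreCore.baseBlock_tcc (π : Y → M) [IsFibred E G π] {K : Type*}
    [NormedAddCommGroup K] [NormedSpace ℝ K] (c : FibreCore E G Y K) {i y : c.Total}
    (h : y.base ∈ (chartAt (E × G) i.base).source) :
    baseBlock (tcc E (G × K) i y y) =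
      tangentCoordChange 𝓘(ℝ, E) (π i.base) (π y.base) (π y.base) :=
  _root_.baseBlock_tcc (c.proj π) (i := i) (j := y) h (mem_chart_source _ _)

/-- The velocity of a vertical curve of covectors through `y` in two charts. -/
theorem vel_dual_charts_of_eq {γ : ℝ → Dual E G n π} {i y : Dual E G n π}
    (hγ : ContMDiff 𝓘(ℝ, ℝ) 𝓘(ℝ, E × (G × (G →L[ℝ] Forms E n))) ∞ γ) (hy : γ 0 = y)
    (hv : ∀ t, dualProj E G n π (γ t) = dualProj E G n π y)
    (hi : y.base ∈ (chartAt (E × G) i.base).source) {a b : G × (G →L[ℝ] Forms E n)}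
    (hb : vel E (G × (G →L[ℝ] Forms E n)) γ 0 = b)
    (ha : fibreBlock (tcc E (G × (G →L[ℝ] Forms E n)) y i y) b = a) :
    a.1 = (fderiv ℝ (chartAt (E × G) i.base ∘ (chartAt (E × G) y.base).symm)
      (chartAt (E × G) y.base y.base) (0, b.1)).2 ∧
    ∀ g, pullForm n (tangentCoordChange 𝓘(ℝ, E) (π i.base) (π y.base) (π y.base)) (b.2 g) =
      a.2 (fderiv ℝ (chartAt (E × G) i.base ∘ (chartAt (E × G) y.base).symm)
        (chartAt (E × G) y.base y.base) (0, g)).2 +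
        ((dualCore E G n π).coord i.base y)
          (fderiv ℝ (fderiv ℝ (chartAt (E × G) i.base ∘ (chartAt (E × G) y.base).symm))
            (chartAt (E × G) y.base y.base) (0, b.1) (0, g)).2 := by
  subst hy
  exact vel_dual_charts π hγ hv hi hb ha

/-- `D` and `S` stand for the first and second vertical derivatives of a transition map.
Antisymmetrization removes the terms with `S`, and the terms with `D` match. -/
theorem map_twoForm_pairing {V N : Type*} [NormedAddCommGroup V] [NormedSpace ℝ V]
    [NormedAddCommGroup N] [NormedSpace ℝ N] (P : N →L[ℝ] N) (D : V → V) (S : V → V → V)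
    (hS : ∀ v w, S v w = S w v) (η : V →L[ℝ] N) {a b a' b' : V × (V →L[ℝ] N)}
    (ha : a.1 = D a'.1 ∧ ∀ g, P (a'.2 g) = a.2 (D g) + η (S a'.1 g))
    (hb : b.1 = D b'.1 ∧ ∀ g, P (b'.2 g) = b.2 (D g) + η (S b'.1 g)) :
    P (twoForm (pairing V N) ![a', b']) = twoForm (pairing V N) ![a, b] := by
  rw [twoForm_apply, twoForm_apply, pairing_apply, pairing_apply, pairing_apply, pairing_apply,
    map_sub, ha.2, hb.2, ha.1, hb.1, hS b'.1]
  abel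

/-- The canonical two-form is invariant under the changes of charts. -/
theorem pullForm_canonForm (i y : Dual E G n π)
    (hs : y.base ∈ (chartAt (E × G) i.base).source)
    (a b : G × (G →L[ℝ] Forms E n)) :
    pullForm n (baseBlock (tcc E (G × (G →L[ℝ] Forms E n)) i y y))
      (twoForm (pairing G (Forms E n)) ![fibreBlock (tcc E (G × (G →L[ℝ] Forms E n)) i y y) a,
        fibreBlock (tcc E (G × (G →L[ℝ] Forms E n)) i y y) b]) =
      twoForm (pairing G (Forms E n)) ![a, b] := by
  have hyy := mem_chart_source (E × G) y.base
  have hsymm : IsSymmSndFDerivAt ℝ (chartAt (E × G) i.base ∘ (chartAt (E × G) y.base).symm)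
      (chartAt (E × G) y.base y.base) :=
    (contDiffAt_chart_change (W := E × G) hyy hs).isSymmSndFDerivAt
      (by simp only [minSmoothness_of_isRCLikeNormedField]
          exact WithTop.coe_le_coe.2 (le_top : (2 : ℕ∞) ≤ ⊤))
  have hcurve : ∀ a : G × (G →L[ℝ] Forms E n), ∃ γ : ℝ → Dual E G n π,
      ContMDiff 𝓘(ℝ, ℝ) 𝓘(ℝ, E × (G × (G →L[ℝ] Forms E n))) ∞ γ ∧ γ 0 = y ∧
      (∀ t, γ t ∈ univ) ∧ (∀ t, dualProj E G n π (γ t) = dualProj E G n π y) ∧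
      vel E (G × (G →L[ℝ] Forms E n)) γ 0 = a :=
    fun a => exists_vertical_curve (dualProj E G n π) isOpen_univ (mem_univ y) a
  have hT : ∀ a, fibreBlock (tcc E (G × (G →L[ℝ] Forms E n)) y i y)
      (fibreBlock (tcc E (G × (G →L[ℝ] Forms E n)) i y y) a) = a := fun a =>
    (dualCore E G n π).fibreBlock_tcc_inverse π hs a
  have hB : baseBlock (tcc E (G × (G →L[ℝ] Forms E n)) i y y) =
      tangentCoordChange 𝓘(ℝ, E) (π i.base) (π y.base) (π y.base) :=
    (dualCore E G n π).baseBlock_tcc π hs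
  rw [hB]
  -- The transformation law of vertical vectors is available for velocities, so both vectors are
  -- realized by curves through `y`.
  obtain ⟨γ₁, h₁, h₁0, -, h₁v, h₁a⟩ := hcurve (fibreBlock (tcc E (G × (G →L[ℝ] Forms E n)) i y y) a)
  obtain ⟨γ₂, h₂, h₂0, -, h₂v, h₂a⟩ := hcurve (fibreBlock (tcc E (G × (G →L[ℝ] Forms E n)) i y y) b)
  have k₁ := vel_dual_charts_of_eq π (i := i) h₁ h₁0 h₁v hs h₁a (hT a)
  have k₂ := vel_dual_charts_of_eq π (i := i) h₂ h₂0 h₂v hs h₂a (hT b)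
  exact map_twoForm_pairing _
    (fun v => (fderiv ℝ (chartAt (E × G) i.base ∘ (chartAt (E × G) y.base).symm)
      (chartAt (E × G) y.base y.base) (0, v)).2)
    (fun v w => (fderiv ℝ (fderiv ℝ (chartAt (E × G) i.base ∘ (chartAt (E × G) y.base).symm))
      (chartAt (E × G) y.base y.base) (0, v) (0, w)).2)
    (fun v w => congrArg Prod.snd (hsymm.eq _ _)) _ k₁ k₂

/-- By invariance under changes of charts the coefficients are constant in each chart; smoothness
and closedness both follow at once. -/
theorem coordRep_canonForm (i : Dual E G n π) {w : E × (G × (G →L[ℝ] Forms E n))}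
    (hw : w ∈ (chartAt (E × (G × (G →L[ℝ] Forms E n))) i).target) :
    coordRep E (G × (G →L[ℝ] Forms E n)) (canonForm E G n π) i w =
      twoForm (pairing G (Forms E n)) := by
  apply vert_ext
  intro a b
  have h := pullForm_canonForm π i ((chartAt (E × (G × (G →L[ℝ] Forms E n))) i).symm w)
    ((chartAt (E × G) i.base).map_target hw) a b
  refine Eq.trans ?_ h
  change pullForm n _ (twoForm (pairing G (Forms E n)) (_ ∘ ![a, b])) = _
  congr 2
  funext m
  fin_cases m <;> rfl

/-- The canonical two-form is symplectic. -/
theorem isSymplectic_canonForm [FiniteDimensional ℝ E] [FiniteDimensional ℝ G]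
    (hn : Module.finrank ℝ E = n) :
    IsSymplectic E (G × (G →L[ℝ] Forms E n)) (canonForm E G n π) := by
  refine ⟨fun i => ?_, fun i => ?_, canonForm_nondegenerate hn π⟩
  · exact (contDiffOn_const (c := twoForm (pairing G (Forms E n)))).congr
      (fun w hw => coordRep_canonForm π i hw)
  · refine extDeriv_eq_zero_of_eventually_const (c := twoForm (pairing G (Forms E n))) ?_
    have hc : ContinuousAt (fun φ : G × (G →L[ℝ] Forms E n) =>
        ((chartAt (E × (G × (G →L[ℝ] Forms E n))) i i).1, φ))
        (chartAt (E × (G × (G →L[ℝ] Forms E n))) i i).2 := by fun_prop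
    filter_upwards [hc.eventually_mem ((chartAt (E × (G × (G →L[ℝ] Forms E n))) i).open_target.mem_nhds
      (mem_chart_target _ _))] with φ hφ
    exact coordRep_canonForm π i hφ

end Symplectic

end

noncomputable section

/-! ### The main theorem -/

section Quotients

variable {E G H M Y Z : Type*} [NormedAddCommGroup E] [NormedSpace ℝ E]
  [NormedAddCommGroup G] [NormedSpace ℝ G] [NormedAddCommGroup H] [NormedSpace ℝ H]
  [TopologicalSpace M] [ChartedSpace E M] [TopologicalSpace Y] [ChartedSpace (E × G) Y]
  [TopologicalSpace Z] [ChartedSpace (E × H) Z]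

/-- A reduction identifies the space of degeneracy leaves with its target. -/
theorem IsReduction.exists_equiv {π : Y → M} {S : Set Y} {n : ℕ}
    {Ω : Y → G [⋀^Fin 2]→L[ℝ] Forms E n} {π' : Z → M} {Ω' : Z → H [⋀^Fin 2]→L[ℝ] Forms E n}
    {f : S → Z} (hf : IsReduction E G H π S Ω π' Ω' f) :
    ∃ Φ : Reduced E G π S Ω ≃ Z, ∀ s, Φ (Quotient.mk _ s) = f s := by
  refine ⟨Equiv.ofBijective
    (Quotient.lift f fun a b h => (hf.fibre_eq_leaf a b).2 h) ⟨?_, fun z => ?_⟩, fun s => rfl⟩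
  · rintro ⟨a⟩ ⟨b⟩ h
    exact Quotient.sound ((hf.fibre_eq_leaf a b).1 h)
  · obtain ⟨s, hs⟩ := hf.surjective z
    exact ⟨Quotient.mk _ s, hs⟩

end Quotients

/-! ### Fibrewise linearity and surjectivity over the sub-bundle. -/

section Linear

variable {E F GC M Q C : Type*}
  [NormedAddCommGroup E] [NormedSpace ℝ E] [FiniteDimensional ℝ E]
  [NormedAddCommGroup F] [NormedSpace ℝ F] [FiniteDimensional ℝ F]
  [NormedAddCommGroup GC] [NormedSpace ℝ GC] [FiniteDimensional ℝ GC]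
  [TopologicalSpace M] [ChartedSpace E M] [IsManifold 𝓘(ℝ, E) ∞ M]
  [TopologicalSpace Q] [ChartedSpace (E × F) Q] [IsManifold 𝓘(ℝ, E × F) ∞ Q]
  [TopologicalSpace C] [ChartedSpace (E × GC) C] [IsManifold 𝓘(ℝ, E × GC) ∞ C]
  {d : ℕ} {π : Q → M} [IsFibred E F π] {πC : C → M} [IsFibred E GC πC]
  {ι : C → Jet E F π}

theorem precomp_surjective {V W N : Type*} [NormedAddCommGroup V] [NormedSpace ℝ V]
    [NormedAddCommGroup W] [NormedSpace ℝ W] [FiniteDimensional ℝ W]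
    [NormedAddCommGroup N] [NormedSpace ℝ N] {A : V →L[ℝ] W} (hA : Function.Injective A) :
    Function.Surjective (fun X : W →L[ℝ] N => X ∘L A) := fun Y => by
  obtain ⟨B, hB⟩ := (A : V →ₗ[ℝ] W).exists_leftInverse_of_injective (LinearMap.ker_eq_bot.2 hA)
  refine ⟨Y ∘L B.toContinuousLinearMap, ?_⟩
  ext v
  exact congrArg Y (LinearMap.congr_fun hB v)

/-- Over `c` the map is precomposition with the injective inclusion of vertical vectors, and a left
inverse of that inclusion gives surjectivity. -/
theorem restrictCov_linear {n : ℕ} (hι : IsSubbundle E F GC π πC ι) (c : C) :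
    ∃ T : (JetVert E F →L[ℝ] Forms E n) →ₗ[ℝ] (GC →L[ℝ] Forms E n),
      Function.Surjective T ∧ ∀ X, ∃ h : (⟨ι c, X⟩ : Cov E F n π) ∈ covOver E F ι n,
        restrictCov E F GC πC ι n ⟨⟨ι c, X⟩, h⟩ = ⟨c, T X⟩ := by
  refine ⟨⟨⟨fun X => X ∘L vertDeriv E F GC ι c, fun X Y => ContinuousLinearMap.add_comp _ _ _⟩,
    fun a X => ContinuousLinearMap.smul_comp _ _ _⟩, ?_, fun X => ⟨⟨c, rfl⟩, ?_⟩⟩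
  · exact precomp_surjective (vertDerivOf_injective (E := E) (G := GC) (V := JetVert E F)
      (πC := πC) (π := jetProj E F π) hι.over_base hι.isSmoothEmbedding c)
  · exact restrictDual_eq (E := E) (G := GC) (V := JetVert E F) (π := jetProj E F π) (πC := πC)
      hι.isSmoothEmbedding.isEmbedding.injective (η := ⟨⟨ι c, X⟩, ⟨c, rfl⟩⟩) rfl

/-- Over a fixed jet `Ψ` is the linear map `psiLin`, which has a right inverse; compose it with the
restriction. -/
theorem PsiC_linear (hd : Module.finrank ℝ E = d + 1) (hι : IsSubbundle E F GC π πC ι) (c : C) :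
    ∃ T : MomJet E F d →ₗ[ℝ] (GC →L[ℝ] Forms E (d + 1)),
      Function.Surjective T ∧ ∀ X, ∃ h : jetPhaseMk E F d π (ι c) X ∈ jetPhaseOver E F ι d,
        PsiC E F GC πC ι d ⟨jetPhaseMk E F d π (ι c) X, h⟩ = ⟨c, T X⟩ := by
  obtain ⟨T, hT, hTX⟩ := restrictCov_linear (n := d + 1) (πC := πC) hι c
  obtain ⟨R, hR⟩ := exists_psiLin_altForm_rightInverse (E := E) (F := F) hd
  refine ⟨T ∘ₗ (psiLin F (altForm E d)).toLinearMap, hT.comp fun Y => ⟨R Y, hR Y⟩, fun X => ?_⟩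
  obtain ⟨h, h'⟩ := hTX (psiLin F (altForm E d) X)
  exact ⟨h, h'⟩

end Linear

end

theorem mainTheorem7 {E F GC M Q C : Type*}
    [NormedAddCommGroup E] [NormedSpace ℝ E] [FiniteDimensional ℝ E]
    [NormedAddCommGroup F] [NormedSpace ℝ F] [FiniteDimensional ℝ F]
    [NormedAddCommGroup GC] [NormedSpace ℝ GC] [FiniteDimensional ℝ GC]
    [TopologicalSpace M] [ChartedSpace E M] [IsManifold 𝓘(ℝ, E) ∞ M]
    [TopologicalSpace Q] [ChartedSpace (E × F) Q] [IsManifold 𝓘(ℝ, E × F) ∞ Q]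
    [TopologicalSpace C] [ChartedSpace (E × GC) C] [IsManifold 𝓘(ℝ, E × GC) ∞ C]
    (d : ℕ) (hd : Module.finrank ℝ E = d + 1)
    (π : Q → M) [IsFibred E F π] (πC : C → M) [IsFibred E GC πC]
    (ι : C → Jet E F π) (hι : IsSubbundle E F GC π πC ι) :
    -- the intrinsic description of `Ψ`
    (∀ (x₀ : M) (p : M → Phase E F d π) (σ : ℝ × M → Q),
      ContMDiffAt 𝓘(ℝ, E) 𝓘(ℝ, E × (F × Mom E F d)) ∞ p x₀ →
      ContMDiffAt (𝓘(ℝ, ℝ).prod 𝓘(ℝ, E)) 𝓘(ℝ, E × F) ∞ σ (0, x₀) →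
      (∀ᶠ z in 𝓝 ((0 : ℝ), x₀), π (σ z) = z.2) →
      (∀ᶠ x in 𝓝 x₀, (p x).base = σ (0, x)) →
      (Psi E F d π (jetOf E (F × Mom E F d) (dualProj E F d π) p x₀)).fib
          (vel E (JetVert E F) (fun t => jetOf E F π (fun x => σ (t, x)) x₀) 0) =
        extDerivAt E (fun x => (p x).fib (vel E F (fun t => σ (t, x)) 0)) x₀) ∧
    -- the unconstrained reduction
    -- `V*(J¹Q) ⊗ ⋀ⁿ T*M`, with its canonical form, is the unconstrained infinitesimal phase bundle
    IsReduction E (JetPhaseVert E F d) (JetVert E F × (JetVert E F →L[ℝ] Forms E (d + 1)))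
      (jetPhaseProj E F d π) univ (omegaTilde E F d π)
      (covProj E F (d + 1) π) (canonForm E (JetVert E F) (d + 1) (jetProj E F π))
      (fun ζ => Psi E F d π ζ) ∧
    -- the fibres of `Ψ_C` are the degeneracy leaves of the restriction of the form to `J¹P|_C`
    IsReduction E (JetPhaseVert E F d) (GC × (GC →L[ℝ] Forms E (d + 1)))
      (jetPhaseProj E F d π) (jetPhaseOver E F ι d) (omegaTilde E F d π)
      (dualProj E GC (d + 1) πC) (canonForm E GC (d + 1) πC)
      (PsiC E F GC πC ι d) ∧
    -- the restriction of covectors is the reduction of `V*(J¹Q)|_C ⊗ ⋀ⁿ T*M`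
    IsReduction E (JetVert E F × (JetVert E F →L[ℝ] Forms E (d + 1)))
      (GC × (GC →L[ℝ] Forms E (d + 1)))
      (covProj E F (d + 1) π) (covOver E F ι (d + 1))
      (canonForm E (JetVert E F) (d + 1) (jetProj E F π))
      (dualProj E GC (d + 1) πC) (canonForm E GC (d + 1) πC)
      (restrictCov E F GC πC ι (d + 1)) ∧
    -- the reduced form is symplectic
    IsSymplectic E (GC × (GC →L[ℝ] Forms E (d + 1))) (canonForm E GC (d + 1) πC) ∧
    -- both maps are epimorphisms of vector bundles over `C`
    (∀ c : C, ∃ T : MomJet E F d →ₗ[ℝ] (GC →L[ℝ] Forms E (d + 1)),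
      Function.Surjective T ∧ ∀ X, ∃ h : jetPhaseMk E F d π (ι c) X ∈ jetPhaseOver E F ι d,
        PsiC E F GC πC ι d ⟨jetPhaseMk E F d π (ι c) X, h⟩ = ⟨c, T X⟩) ∧
    (∀ c : C, ∃ T : (JetVert E F →L[ℝ] Forms E (d + 1)) →ₗ[ℝ] (GC →L[ℝ] Forms E (d + 1)),
      Function.Surjective T ∧ ∀ X, ∃ h : (⟨ι c, X⟩ : Cov E F (d + 1) π) ∈ covOver E F ι (d + 1),
        restrictCov E F GC πC ι (d + 1) ⟨⟨ι c, X⟩, h⟩ = ⟨c, T X⟩) ∧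
    -- the induced isomorphisms of the reduced infinitesimal phase space with `V*C ⊗ ⋀ⁿ T*M`
    (∃ Φ : Reduced E (JetPhaseVert E F d) (jetPhaseProj E F d π) (jetPhaseOver E F ι d)
        (omegaTilde E F d π) ≃ Dual E GC (d + 1) πC,
      ∀ ζ, Φ (Quotient.mk _ ζ) = PsiC E F GC πC ι d ζ) ∧
    (∃ Φ : Reduced E (JetVert E F × (JetVert E F →L[ℝ] Forms E (d + 1)))
        (covProj E F (d + 1) π) (covOver E F ι (d + 1))
        (canonForm E (JetVert E F) (d + 1) (jetProj E F π)) ≃ Dual E GC (d + 1) πC,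
      ∀ η, Φ (Quotient.mk _ η) = restrictCov E F GC πC ι (d + 1) η) := by

  have hΨ := isReduction_PsiC (πC := πC) hd hι
  have hr := isReduction_restrictCov (πC := πC) hd hι
  refine ⟨fun x₀ p σ hp hσ hπ => ?_, isReduction_Psi π hd, hΨ, hr, isSymplectic_canonForm πC hd,
    PsiC_linear hd hι, restrictCov_linear hι, hΨ.exists_equiv, hr.exists_equiv⟩
  exact Psi_canonical π hp hσ hπ
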